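/- For a fundamental discriminant $d$ (positive or negative, $d=1$ included), let $\chi_d=\left(\frac{d}{\cdot}\right)$ be the Dirichlet character modulo $|d|$ given by the Kronecker symbol. For real $x\ge 10$ and $z\in\mathbb{C}$ put $$\mathcal{L}(z,x)=\begin{cases}\log\log x, & |z|\le (\log x)^{-1},\\ -\log|z|, & (\log x)^{-1}<|z|\le 1,\\ 0, & |z|>1,\end{cases}$$ and for $z_1,z_2\in\mathbb{C}$ put $$\mathcal{M}(z_1,z_2,x)=\tfrac12\big(\mathcal{L}(z_1,x)+\mathcal{L}(z_2,x)\big),$$ $$\mathcal{V}(z_1,z_2,x)=\tfrac12\big(\mathcal{L}(2z_1,x)+\mathcal{L}(2z_2,x)+\mathcal{L}(2\Re z_1,x)+\mathcal{L}(2\Re z_2,x)+2\mathcal{L}(z_1+z_2,x)+2\mathcal{L}(z_1+\overline{z_2},x)\big).$$ **Theorem 8.3.** Assume the generalized Riemann hypothesis for $L(s,\chi_d)$ for all fundamental discriminants $d$: every zero with $0<\Re s<1$ has $\Re s=\frac12$. Then there is an absolute constant $X_0\ge 10$ such that for every real $k>0$ and every $\varepsilon>0$ there is a constant $C=C(k,\varepsilon)>0$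 such that for all real $X\ge X_0$ and all $z_1,z_2\in\mathbb{C}$ with $0\le\Re(z_1),\Re(z_2)\le\frac{1}{\log X}$ and $|\Im(z_1)|,|\Im(z_2)|\le X$, $$\sum_{\substack{|d|\le X\\ d\ \text{fundamental discriminant}}}\big|L(\tfrac12+z_1,\chi_d)\,L(\tfrac12+z_2,\chi_d)\big|^k\le C\,X(\log X)^{\varepsilon}\exp\!\Big(k\,\mathcal{M}(z_1,z_2,X)+\tfrac{k^2}{2}\,\mathcal{V}(z_1,z_2,X)\Big).$$ -/

import Mathlib

open scoped NumberTheorySymbols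

/-- The Kronecker symbol `(d / n)` for an integer `d` and a natural number `n`: it is completely
multiplicative in `n > 0`, equals the Legendre symbol at odd primes, takes at `2` the value `0`,
`1`, `-1` according to whether `d` is even, `d ≡ ±1 mod 8`, or `d ≡ ±3 mod 8` (this is `χ₈ d`),
and `(d / 0)` is `1` if `d = ±1` and `0` otherwise. -/
def kroneckerSym (d : ℤ) (n : ℕ) : ℤ :=
  if n = 0 then (if d.natAbs = 1 then 1 else 0)
  else ZMod.χ₈ (d : ZMod 8) ^ n.factorization 2 * J(d | n / 2 ^ n.factorization 2)

/-- Fundamental discriminants (positive or negative, `d = 1` included). -/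
def IsFundamentalDiscriminant (d : ℤ) : Prop :=
  (d % 4 = 1 ∧ Squarefree d) ∨ ∃ m : ℤ, d = 4 * m ∧ (m % 4 = 2 ∨ m % 4 = 3) ∧ Squarefree m

theorem IsFundamentalDiscriminant.ne_zero {d : ℤ} (h : IsFundamentalDiscriminant d) : d ≠ 0 := by
  rcases h with ⟨h, -⟩ | ⟨m, rfl, h, -⟩ <;> omega

theorem kroneckerSym_mul {d : ℤ} {m n : ℕ} (hm : m ≠ 0) (hn : n ≠ 0) :
    kroneckerSym d (m * n) = kroneckerSym d m * kroneckerSym d n := by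
  have h1 : m / 2 ^ m.factorization 2 ≠ 0 := (Nat.ordCompl_pos 2 hm).ne'
  have h2 : n / 2 ^ n.factorization 2 ≠ 0 := (Nat.ordCompl_pos 2 hn).ne'
  have : NeZero (m / 2 ^ m.factorization 2) := ⟨h1⟩
  have : NeZero (n / 2 ^ n.factorization 2) := ⟨h2⟩
  rw [kroneckerSym, kroneckerSym, kroneckerSym, if_neg hm, if_neg hn, if_neg (mul_ne_zero hm hn),
    Nat.ordCompl_mul, jacobiSym.mul_right, Nat.factorization_mul hm hn, Finsupp.add_apply, pow_add]
  ring

theorem kroneckerSym_odd {d : ℤ} {n : ℕ} (hn : Odd n) : kroneckerSym d n = J(d | n) := by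
  have h0 : n ≠ 0 := by rintro rfl; simp at hn
  have h : n.factorization 2 = 0 :=
    Nat.factorization_eq_zero_of_not_dvd (fun h => by
      rcases hn with ⟨k, rfl⟩
      omega)
  simp [kroneckerSym, h0, h]

theorem kroneckerSym_two (d : ℤ) : kroneckerSym d 2 = ZMod.χ₈ (d : ZMod 8) := by
  have h : Nat.factorization 2 2 = 1 := Nat.prime_two.factorization_self
  simp [kroneckerSym, h]

theorem kroneckerSym_one_mod_four_odd {d : ℤ} (hd : d % 4 = 1) {n : ℕ} (hn : Odd n) :
    J(d | n) = J(n | d.natAbs) := by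
  rcases Int.natAbs_eq d with h | h
  · have h4 : d.natAbs % 4 = 1 := by omega
    conv_lhs => rw [h]
    exact jacobiSym.quadratic_reciprocity_one_mod_four h4 hn
  · have h4 : d.natAbs % 4 = 3 := by omega
    have ho : Odd d.natAbs := Nat.odd_iff.2 (by omega)
    have h3 : J(d | n) = J(-1 | n) * J(d.natAbs | n) := by
      rw [← jacobiSym.mul_left, neg_one_mul, ← h]
    rw [h3, jacobiSym.at_neg_one hn]
    rcases Nat.odd_mod_four_iff.1 (Nat.odd_iff.1 hn) with hn4 | hn4
    · rw [ZMod.χ₄_nat_one_mod_four hn4, one_mul]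
      exact jacobiSym.quadratic_reciprocity_one_mod_four' ho hn4
    · rw [ZMod.χ₄_nat_three_mod_four hn4, jacobiSym.quadratic_reciprocity_three_mod_four h4 hn4]
      ring

theorem chi_eight_natAbs (d : ℤ) : ZMod.χ₈ (d : ZMod 8) = ZMod.χ₈ (d.natAbs : ZMod 8) := by
  have h8 : ∀ a : ZMod 8, ZMod.χ₈ (-a) = ZMod.χ₈ a := by decide
  rcases Int.natAbs_eq d with h | h
  · conv_lhs => rw [h]
    simp only [Int.cast_natCast]
  · conv_lhs => rw [h]
    rw [Int.cast_neg, h8]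
    simp only [Int.cast_natCast]

theorem kroneckerSym_one_mod_four {d : ℤ} (hd : d % 4 = 1) (n : ℕ) :
    kroneckerSym d n = J(n | d.natAbs) := by
  induction n using Nat.strong_induction_on with
  | _ n ih =>
    rcases Nat.even_or_odd' n with ⟨k, hk | hk⟩
    · rcases Nat.eq_zero_or_pos k with h0 | h0
      · subst h0
        subst hk
        by_cases h1 : d.natAbs = 1
        · simp [kroneckerSym, h1]
        · have : 1 < d.natAbs := by omega
          simp [kroneckerSym, h1, jacobiSym.zero_left this]
      · have ho : Odd d.natAbs := Nat.odd_iff.2 (by omega)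
        rw [hk, kroneckerSym_mul two_ne_zero h0.ne', ih k (by omega), kroneckerSym_two,
          chi_eight_natAbs, ← jacobiSym.at_two ho, Nat.cast_mul, jacobiSym.mul_left]
        rfl
    · have ho : Odd n := ⟨k, hk⟩
      rw [kroneckerSym_odd ho, kroneckerSym_one_mod_four_odd hd ho]

theorem kroneckerSym_four_mul_even (m : ℤ) (k : ℕ) : kroneckerSym (4 * m) (2 * k) = 0 := by
  rcases Nat.eq_zero_or_pos k with h0 | h0
  · subst h0
    have : (4 * m).natAbs ≠ 1 := by omega
    simp [kroneckerSym, this]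
  · have h8 : ∀ a : ZMod 8, ZMod.χ₈ (4 * a) = 0 := by decide
    rw [kroneckerSym_mul two_ne_zero h0.ne', kroneckerSym_two]
    push_cast
    rw [h8, zero_mul]

theorem kroneckerSym_four_mul_odd (m : ℤ) {n : ℕ} (hn : Odd n) :
    kroneckerSym (4 * m) n = J(m | n) := by
  have h2 : J(2 | n) ^ 2 = 1 := by
    refine jacobiSym.sq_one ?_
    have : Nat.Coprime 2 n := Nat.coprime_two_left.2 hn
    simpa [Int.gcd] using this
  rw [kroneckerSym_odd hn, jacobiSym.mul_left, show (4 : ℤ) = 2 ^ 2 by norm_num,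
    jacobiSym.pow_left, h2, one_mul]

/-- The Kronecker symbol of a fundamental discriminant `d` is periodic modulo `|d|`. -/
theorem kroneckerSym_mod {d : ℤ} (h : IsFundamentalDiscriminant d) (n : ℕ) :
    kroneckerSym d (n % d.natAbs) = kroneckerSym d n := by
  rcases h with ⟨h, -⟩ | ⟨m, rfl, -, -⟩
  · rw [kroneckerSym_one_mod_four h, kroneckerSym_one_mod_four h, jacobiSym.mod_left (n : ℤ),
      Int.natCast_mod]
  · have hN : (4 * m).natAbs = 4 * m.natAbs := by omega
    have hpar : n % (4 * m).natAbs % 2 = n % 2 :=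
      Nat.mod_mod_of_dvd n (by rw [hN]; exact ⟨2 * m.natAbs, by ring⟩)
    rcases Nat.even_or_odd n with he | ho
    · have he' : Even (n % (4 * m).natAbs) := Nat.even_iff.2 (by rw [hpar]; exact Nat.even_iff.1 he)
      obtain ⟨a, ha⟩ := he.two_dvd
      obtain ⟨b, hb⟩ := he'.two_dvd
      rw [hb, ha, kroneckerSym_four_mul_even, kroneckerSym_four_mul_even]
    · have ho' : Odd (n % (4 * m).natAbs) := Nat.odd_iff.2 (by rw [hpar]; exact Nat.odd_iff.1 ho)
      rw [kroneckerSym_four_mul_odd m ho', kroneckerSym_four_mul_odd m ho, jacobiSym.mod_right m ho,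
        hN]

theorem kroneckerSym_mul_of_fundamental {d : ℤ} (h : IsFundamentalDiscriminant d) (m n : ℕ) :
    kroneckerSym d (m * n) = kroneckerSym d m * kroneckerSym d n := by
  have hd : d.natAbs ≠ 0 := Int.natAbs_ne_zero.2 h.ne_zero
  have key : ∀ k : ℕ, kroneckerSym d (k + d.natAbs) = kroneckerSym d k := fun k => by
    rw [← kroneckerSym_mod h (k + d.natAbs), Nat.add_mod_right, kroneckerSym_mod h]
  rw [← key m, ← key n, ← kroneckerSym_mul (by omega) (by omega),
    ← kroneckerSym_mod h (m * n), ← kroneckerSym_mod h ((m + d.natAbs) * (n + d.natAbs)),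
    Nat.mul_mod (m + d.natAbs), Nat.add_mod_right, Nat.add_mod_right, ← Nat.mul_mod]

theorem kroneckerSym_eq_zero {d : ℤ} (h : IsFundamentalDiscriminant d) {n : ℕ}
    (hn : ¬ n.Coprime d.natAbs) : kroneckerSym d n = 0 := by
  have hd : d.natAbs ≠ 0 := Int.natAbs_ne_zero.2 h.ne_zero
  have : NeZero d.natAbs := ⟨hd⟩
  rcases h with ⟨h, -⟩ | ⟨m, rfl, -, -⟩
  · rw [kroneckerSym_one_mod_four h]
    exact jacobiSym.eq_zero_iff_not_coprime.2 hn
  · rcases Nat.even_or_odd n with he | ho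
    · obtain ⟨a, ha⟩ := he.two_dvd
      rw [ha, kroneckerSym_four_mul_even]
    · have : NeZero n := ⟨by rintro rfl; simp at ho⟩
      rw [kroneckerSym_four_mul_odd m ho]
      refine jacobiSym.eq_zero_iff_not_coprime.2 fun hc => hn ?_
      have h4 : Nat.Coprime n 4 := by
        have : Nat.Coprime n (2 ^ 2) := Nat.Coprime.pow_right 2 (Nat.coprime_two_right.2 ho)
        simpa using this
      have hm : Nat.Coprime n m.natAbs := by
        rw [Nat.coprime_comm]
        simpa [Int.gcd, Nat.Coprime] using hc
      rw [Int.natAbs_mul]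
      exact Nat.Coprime.mul_right h4 hm

/-- The type of all fundamental discriminants. -/
abbrev FundamentalDiscriminant : Type := {d : ℤ // IsFundamentalDiscriminant d}

instance FundamentalDiscriminant.instNeZero (d : FundamentalDiscriminant) : NeZero d.1.natAbs :=
  ⟨Int.natAbs_ne_zero.2 d.2.ne_zero⟩

/-- The quadratic Dirichlet character `χ_d = (d / ·)` modulo `|d|`. -/
def kroneckerChar (d : FundamentalDiscriminant) : DirichletCharacter ℂ d.1.natAbs where
  toFun a := (kroneckerSym d.1 a.val : ℂ)
  map_one' := by
    have h1 : kroneckerSym d.1 1 = 1 := by simp [kroneckerSym]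
    rw [ZMod.val_one_eq_one_mod, kroneckerSym_mod d.2, h1, Int.cast_one]
  map_mul' a b := by
    rw [ZMod.val_mul, kroneckerSym_mod d.2, kroneckerSym_mul_of_fundamental d.2, Int.cast_mul]
  map_nonunit' a ha := by
    have h : kroneckerSym d.1 a.val = 0 := kroneckerSym_eq_zero d.2 fun hc => ha <| by
      rw [← ZMod.natCast_zmod_val a]
      exact (ZMod.isUnit_iff_coprime _ _).2 hc
    simp [h]

theorem kroneckerChar_natCast (d : FundamentalDiscriminant) (n : ℕ) :
    kroneckerChar d (n : ZMod d.1.natAbs) = (kroneckerSym d.1 n : ℂ) := by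
  change ((kroneckerSym d.1 (n : ZMod d.1.natAbs).val : ℤ) : ℂ) = _
  rw [ZMod.val_natCast, kroneckerSym_mod d.2]

/-- The generalized Riemann hypothesis for the functions `L(s, χ_d)`, for all fundamental
discriminants `d` (for `d = 1` this is the Riemann hypothesis for `ζ`): every zero in the
critical strip lies on the critical line. -/
def QuadraticGRH : Prop :=
  ∀ (d : FundamentalDiscriminant) (s : ℂ), 0 < s.re → s.re < 1 →
    (kroneckerChar d).LFunction s = 0 → s.re = 1 / 2

open Classical in
/-- The finite set of fundamental discriminants `d` with `|d| ≤ X`. -/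
noncomputable def fundamentalDiscriminants (X : ℝ) : Finset FundamentalDiscriminant :=
  (Finset.Icc (-⌊X⌋) ⌊X⌋).subtype IsFundamentalDiscriminant

theorem mem_fundamentalDiscriminants {X : ℝ} {d : FundamentalDiscriminant} :
    d ∈ fundamentalDiscriminants X ↔ |(d.1 : ℝ)| ≤ X := by
  simp only [fundamentalDiscriminants, Finset.mem_subtype, Finset.mem_Icc]
  rw [← abs_le, Int.le_floor, Int.cast_abs]

/-- The function `ℒ(z, x)`. -/
noncomputable def shiftL (z : ℂ) (x : ℝ) : ℝ :=
  if ‖z‖ ≤ (Real.log x)⁻¹ then Real.log (Real.log x)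
  else if ‖z‖ ≤ 1 then -Real.log ‖z‖
  else 0

/-- The mean `ℳ(z₁, z₂, x)`. -/
noncomputable def shiftM (z₁ z₂ : ℂ) (x : ℝ) : ℝ :=
  (shiftL z₁ x + shiftL z₂ x) / 2

/-- The variance `𝒱(z₁, z₂, x)`. -/
noncomputable def shiftV (z₁ z₂ : ℂ) (x : ℝ) : ℝ :=
  (shiftL (2 * z₁) x + shiftL (2 * z₂) x
    + shiftL ((2 * z₁.re : ℝ) : ℂ) x + shiftL ((2 * z₂.re : ℝ) : ℂ) x
    + 2 * shiftL (z₁ + z₂) x + 2 * shiftL (z₁ + starRingEnd ℂ z₂) x) / 2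

/-!
The proof follows the method of Soundararajan and Harper for upper bounds on moments under GRH.

**A short prime sum controls `log |L|`.** Under GRH the completed `L`-function has modulus increasing
along horizontal lines to the right of the critical line (`norm_completed_le_of_symm`). This is a
consequence of the symmetry of `|E|` about that line and the Phragmén–Lindelöf principle, and needs
no product over zeros. Hence `log |L|` decreases to the left at a rate of at most about
`log |d| + log (2 + |t|)`. Averaging against the nonnegative Fejér kernel turns this into a bound for
truncations of the Dirichlet series of `-L'/L`, and integrating over the length of the truncation
gives `re_le_riesz_sum`: `log |L(s, χ_d)|` is at most the Riesz mean of length `e ^ R` of its Dirichlet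
series, plus `O(log X / R)`. In that mean the higher prime powers are bounded, the squares of primes
contribute `∑ cos (2 t log p) / (2 p)`, and what remains is a sum over primes of
`χ_d(p) p ^ (-1/2)` times a coefficient (`exists_re_sum_le`, `exists_norm_mul_LFunction_le`).

**`ℒ` measures prime sums without character.** Up to `O(1)`, `∑_{p ≤ y} cos (θ log p) / p` is
`log |ζ(1 + 1 / log y + i θ)|`. Under RH, the three lines theorem applied to `log ζ` next to the line
`Re s = 1` shows that this exceeds the contribution of the pole of `ζ` by at most a triple logarithm of
the height (`exists_log_norm_riemannZeta_le`, `sum_cos_le_shiftL`). The squares of primes therefore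
produce `ℳ`, and the variance `∑ (Re p ^ (-z₁) + Re p ^ (-z₂))² / p` of the prime sum is at most `𝒱`
(`sum_sq_shiftCos_le_shiftV`).

**Short prime sums have Gaussian moments.** The sum over fundamental discriminants of an even moment
of `∑ b_p (d / p)` is extended to all integers `|n| ≤ X`. After expansion, nonsquare moduli cancel by
orthogonality, and the diagonal is at most the Gaussian moment with variance `∑ b_p²`, as long as
`y ^ (3 l) ≤ X` for primes up to `y` and moments of order `2 l` (`sum_primeCharSum_pow_le`).

**Assembly.** Values above a high power of `log X` are rare enough to contribute `O(X)`, by a moment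
whose order grows with the size of the value (`exists_sum_large_values_le`). For the others the prime
sum is split at `exp (log X / (log log X) ^ 2)`. The larger primes have tiny variance and matter only
on a negligible set; for the smaller ones the exponential is dominated by a truncated hyperbolic
cosine, whose mean is at most `exp (k² 𝒱 / 2)` up to a power `(log X) ^ ε`
(`exists_sum_moderate_values_le`). The single discriminant `d = 1` is covered by the Lindelöf bound for
`ζ` (`exists_norm_riemannZeta_le`), and a bounded range of `X`, which depends on `k` and `ε`, by trivial
estimates (`exists_sum_filter_ne_one_le_of_le`). In particular `X₀ = 10` is admissible.
-/

/-! ### Quotients of the Gamma function -/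

open Complex in
/-- One factor of the Euler product for `Γ(w + η) / Γ(w)`, for an index `j` at least `|Im w|`. -/
theorem gammaSeq_factor_le {w : ℂ} {η : ℝ} {T j : ℕ} (hw : 0 ≤ w.re) (hw2 : w.re ≤ 2)
    (hT : |w.im| ≤ T) (hT1 : 1 ≤ T) (hj : T ≤ j) (h0 : 0 ≤ η) (h1 : η ≤ 1) :
    (((j + 1 : ℕ) : ℝ) / j) ^ η * (‖w + j‖ / ‖w + η + j‖) ≤
      Real.exp (10 * η * T * (1 / j - 1 / (j + 1 : ℕ))) := by
  have hT' : (1 : ℝ) ≤ T := by exact_mod_cast hT1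
  have hj' : (T : ℝ) ≤ j := by exact_mod_cast hj
  have hj0 : (0 : ℝ) < j := by linarith
  have hn1 : ‖w + j‖ ^ 2 = (w.re + j) ^ 2 + w.im ^ 2 := by
    rw [← normSq_eq_norm_sq, normSq_apply]; simp; ring
  have hn2 : ‖w + η + j‖ ^ 2 = (w.re + η + j) ^ 2 + w.im ^ 2 := by
    rw [← normSq_eq_norm_sq, normSq_apply]; simp; ring
  have hp1 : 0 < ‖w + j‖ := by
    have : 0 < ‖w + j‖ ^ 2 := by rw [hn1]; positivity
    exact lt_of_le_of_ne (norm_nonneg _) fun h => by rw [← h] at this; simp at this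
  have hp2 : 0 < ‖w + η + j‖ := by
    have : 0 < ‖w + η + j‖ ^ 2 := by rw [hn2]; positivity
    exact lt_of_le_of_ne (norm_nonneg _) fun h => by rw [← h] at this; simp at this
  have hl1 : Real.log (((j + 1 : ℕ) : ℝ) / j) ≤ 1 / j := by
    have := Real.log_le_sub_one_of_pos (x := ((j + 1 : ℕ) : ℝ) / j) (by positivity)
    refine this.trans (le_of_eq ?_)
    push_cast; field_simp; ring
  have hsq : w.im ^ 2 ≤ (T : ℝ) ^ 2 := by
    rw [← sq_abs]; gcongr
  set D := ‖w + η + j‖ ^ 2 with hD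
  have hDpos : 0 < D := by positivity
  have hDle : D ≤ (j + 3) ^ 2 + (T : ℝ) ^ 2 := by
    have h3 : (w.re + η + j) ^ 2 ≤ (j + 3) ^ 2 := pow_le_pow_left₀ (by linarith) (by linarith) 2
    linarith
  have hl2 : Real.log (‖w + j‖ / ‖w + η + j‖) ≤ - (η * j / D) := by
    have h2 : Real.log ((‖w + j‖ / ‖w + η + j‖) ^ 2) = 2 * Real.log (‖w + j‖ / ‖w + η + j‖) := by
      rw [Real.log_pow]; norm_num
    have h3 := Real.log_le_sub_one_of_pos (x := (‖w + j‖ / ‖w + η + j‖) ^ 2) (by positivity)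
    rw [h2, div_pow, ← hD, hn1] at h3
    have h4 : ((w.re + j) ^ 2 + w.im ^ 2) / D - 1 ≤ - (2 * (η * j / D)) := by
      rw [div_sub_one hDpos.ne', hn2, ← mul_div_assoc, ← neg_div]
      gcongr
      nlinarith [mul_nonneg h0 hw, sq_nonneg η]
    linarith
  rw [← Real.log_le_iff_le_exp (by positivity), Real.log_mul (by positivity) (by positivity),
    Real.log_rpow (by positivity)]
  have key : 1 / (j : ℝ) - j / D ≤ 10 * T * (1 / j - 1 / (j + 1 : ℕ)) := by
    have e1 : j / ((j + 3) ^ 2 + (T : ℝ) ^ 2) ≤ j / D := by gcongr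
    have e2 : 1 / (j : ℝ) - j / ((j + 3) ^ 2 + (T : ℝ) ^ 2) ≤
        10 * T * (1 / j - 1 / (j + 1 : ℕ)) := by
      have e3 : 10 * T * (1 / (j : ℝ) - 1 / (j + 1 : ℕ)) = 10 * T / (j * (j + 1)) := by
        push_cast; field_simp; ring
      rw [e3, div_sub_div _ _ (by positivity) (by positivity),
        div_le_div_iff₀ (by positivity) (by positivity)]
      have : (6 * (j : ℝ) + 9 + T ^ 2) * (j + 1) ≤ 10 * T * ((j + 3) ^ 2 + (T : ℝ) ^ 2) := by
        have a1 : (T : ℝ) ^ 2 * (j + 1) ≤ T * (j + 3) ^ 2 := by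
          have : (T : ℝ) * (j + 1) ≤ (j + 3) ^ 2 := by nlinarith
          calc (T : ℝ) ^ 2 * (j + 1) = T * (T * (j + 1)) := by ring
            _ ≤ T * (j + 3) ^ 2 := by gcongr
        have a2 : (6 * (j : ℝ) + 9) * (j + 1) ≤ T * (9 * (j + 3) ^ 2) := by
          calc (6 * (j : ℝ) + 9) * (j + 1) ≤ 1 * (9 * (j + 3) ^ 2) := by nlinarith
            _ ≤ _ := by gcongr
        have a3 : (0 : ℝ) ≤ 10 * T * T ^ 2 := by positivity
        linarith
      have a4 := mul_le_mul_of_nonneg_left this hj0.le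
      linarith
    linarith
  calc _ ≤ η * (1 / j) + -(η * j / D) := by gcongr
    _ = η * (1 / j - j / D) := by ring
    _ ≤ η * (10 * T * (1 / j - 1 / (j + 1 : ℕ))) := by gcongr
    _ = _ := by ring

open Complex in
/-- The growth `Γ(w + η) / Γ(w) ≪ (2 + |Im w|)^η`, uniformly for small `η`; the factor tends to `1`
as `η → 0`, so this is a bound for the real part of the digamma function. -/
theorem norm_Gamma_add_le {w : ℂ} {η : ℝ} (hw : 0 < w.re) (hw2 : w.re ≤ 2)
    (h0 : 0 ≤ η) (h1 : η ≤ 1) :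
    ‖Gamma (w + η)‖ ≤ Real.exp (η * (Real.log (2 + |w.im|) + 10)) * ‖Gamma w‖ := by
  set T : ℕ := ⌈|w.im|⌉₊ + 1 with hTdef
  have hT : |w.im| ≤ T := by
    rw [hTdef]; push_cast; linarith [Nat.le_ceil |w.im|]
  have hT1 : 1 ≤ T := by omega
  have hT2 : (T : ℝ) ≤ 2 + |w.im| := by
    rw [hTdef]; push_cast; linarith [Nat.ceil_lt_add_one (abs_nonneg w.im)]
  have hT' : (1 : ℝ) ≤ T := by exact_mod_cast hT1
  have hpos : ∀ j : ℕ, 0 < ‖w + j‖ := fun j => by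
    rw [norm_pos_iff]; intro h
    have := congrArg re h; simp at this; linarith [(Nat.cast_nonneg j : (0 : ℝ) ≤ j)]
  have hpos2 : ∀ j : ℕ, 0 < ‖w + η + j‖ := fun j => by
    rw [norm_pos_iff]; intro h
    have := congrArg re h; simp at this; linarith [(Nat.cast_nonneg j : (0 : ℝ) ≤ j)]
  have hle1 : ∀ j : ℕ, ‖w + j‖ / ‖w + η + j‖ ≤ 1 := fun j => by
    rw [div_le_one (hpos2 j)]
    rw [← sq_le_sq₀ (norm_nonneg _) (norm_nonneg _), ← normSq_eq_norm_sq, ← normSq_eq_norm_sq,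
      normSq_apply, normSq_apply]
    simp only [add_re, natCast_re, add_im, natCast_im, ofReal_re, ofReal_im, add_zero]
    have : (0 : ℝ) ≤ j := Nat.cast_nonneg j
    nlinarith
  -- Factors with `j < T` are at most `1`; those with `j ≥ T` are bounded by `gammaSeq_factor_le`,
  -- and the exponents telescope.
  have hR : ∀ n : ℕ, T ≤ n → (n : ℝ) ^ η * ∏ j ∈ Finset.range n, (‖w + j‖ / ‖w + η + j‖) ≤
      (T : ℝ) ^ η * Real.exp (10 * η * T * (1 / T - 1 / n)) := by
    intro n hn
    induction n, hn using Nat.le_induction with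
    | base =>
      rw [sub_self, mul_zero, Real.exp_zero]
      gcongr
      exact Finset.prod_le_one (fun j _ => by positivity) fun j _ => hle1 j
    | succ n hn ih =>
      have hn0 : (0 : ℝ) < n := by
        have : (T : ℝ) ≤ n := by exact_mod_cast hn
        linarith
      have := mul_le_mul ih (gammaSeq_factor_le hw.le hw2 hT hT1 hn h0 h1) (by positivity)
        (by positivity)
      rw [Finset.prod_range_succ]
      calc _ = ((n : ℝ) ^ η * ∏ j ∈ Finset.range n, (‖w + j‖ / ‖w + η + j‖)) *
            ((((n + 1 : ℕ) : ℝ) / n) ^ η * (‖w + n‖ / ‖w + η + n‖)) := by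
            rw [Real.div_rpow (by positivity) (by positivity)]
            have : (n : ℝ) ^ η ≠ 0 := by positivity
            generalize ∏ j ∈ Finset.range n, (‖w + j‖ / ‖w + η + j‖) = P
            field_simp
        _ ≤ _ := this
        _ = (T : ℝ) ^ η * (Real.exp (10 * η * T * (1 / T - 1 / n)) *
              Real.exp (10 * η * T * (1 / n - 1 / (n + 1 : ℕ)))) := by ring
        _ = _ := by
            rw [← Real.exp_add]; congr 2; ring
  have hlim1 := (GammaSeq_tendsto_Gamma (w + η)).norm
  have hlim2 := (GammaSeq_tendsto_Gamma w).norm.const_mul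
    (Real.exp (η * (Real.log (2 + |w.im|) + 10)))
  refine le_of_tendsto_of_tendsto hlim1 hlim2 ?_
  filter_upwards [Filter.eventually_ge_atTop T] with n hn
  have hn0 : (0 : ℝ) < n := by
    have : (T : ℝ) ≤ n := by exact_mod_cast hn
    linarith
  have hcast : ((n : ℕ) : ℂ) = ((n : ℝ) : ℂ) := by simp
  rw [GammaSeq, GammaSeq, norm_div, norm_div, norm_mul, norm_mul, norm_prod, norm_prod, hcast,
    norm_cpow_eq_rpow_re_of_pos hn0, norm_cpow_eq_rpow_re_of_pos hn0]
  have hb : (n : ℝ) ^ η * ∏ j ∈ Finset.range (n + 1), (‖w + j‖ / ‖w + η + j‖) ≤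
      Real.exp (η * (Real.log (2 + |w.im|) + 10)) := by
    rw [Finset.prod_range_succ]
    calc _ = ((n : ℝ) ^ η * ∏ j ∈ Finset.range n, (‖w + j‖ / ‖w + η + j‖)) *
            (‖w + n‖ / ‖w + η + n‖) := by ring
      _ ≤ (T : ℝ) ^ η * Real.exp (10 * η * T * (1 / T - 1 / n)) * 1 :=
          mul_le_mul (hR n hn) (hle1 n) (by positivity) (by positivity)
      _ ≤ Real.exp (η * Real.log (2 + |w.im|)) * Real.exp (10 * η) := by
          rw [mul_one, mul_comm η (Real.log _), ← Real.rpow_def_of_pos (by positivity)]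
          refine mul_le_mul (Real.rpow_le_rpow (by positivity) hT2 h0) (Real.exp_le_exp.2 ?_)
            (by positivity) (by positivity)
          have : 10 * η * T * (1 / (T : ℝ) - 1 / n) = 10 * η - 10 * η * T / n := by
            field_simp
          rw [this]
          have : 0 ≤ 10 * η * T / n := by positivity
          linarith
      _ = _ := by rw [← Real.exp_add]; congr 1; ring
  rw [Finset.prod_div_distrib] at hb
  have hP1 : 0 < ∏ j ∈ Finset.range (n + 1), ‖w + j‖ := Finset.prod_pos fun j _ => hpos j
  have hP2 : 0 < ∏ j ∈ Finset.range (n + 1), ‖w + η + j‖ := Finset.prod_pos fun j _ => hpos2 j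
  have e1 : (w + η).re = w.re + η := by simp
  rw [e1, Real.rpow_add hn0]
  have := mul_le_mul_of_nonneg_right hb (a := (n : ℝ) ^ w.re * ‖((n.factorial : ℕ) : ℂ)‖ /
    ∏ j ∈ Finset.range (n + 1), ‖w + j‖) (by positivity)
  refine le_trans (le_of_eq ?_) this
  field_simp

open Complex in
/-- The quotient `Γ(w) / Γ(w + h)` is bounded in a half-plane, by the Beta integral. -/
theorem exists_norm_Gamma_le_add {c h : ℝ} (hc : 0 < c) (hh : 0 < h) :
    ∃ C : ℝ, 0 < C ∧ ∀ w : ℂ, c ≤ w.re → ‖Gamma w‖ ≤ C * ‖Gamma (w + h)‖ := by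
  have hG : 0 < ‖Gamma (h : ℂ)‖ := norm_pos_iff.2 (Gamma_ne_zero_of_re_pos (by simpa using hh))
  set I : ℝ := ∫ x in (0 : ℝ)..1, x ^ (c - 1) * (1 - x) ^ (h - 1)
  have hint : IntervalIntegrable (fun x : ℝ => x ^ (c - 1) * (1 - x) ^ (h - 1))
      MeasureTheory.volume 0 1 := by
    have := (betaIntegral_convergent (u := c) (v := h) (by simpa using hc) (by simpa using hh)).norm
    refine this.congr_uIoo ?_
    intro x hx
    rw [Set.uIoo_of_le zero_le_one] at hx
    have hx1 : (0 : ℝ) < 1 - x := by linarith [hx.2]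
    simp only [norm_mul]
    rw [norm_cpow_eq_rpow_re_of_pos hx.1, show (1 : ℂ) - x = ((1 - x : ℝ) : ℂ) by push_cast; rfl,
      norm_cpow_eq_rpow_re_of_pos hx1]
    simp
  refine ⟨(|I| + 1) / ‖Gamma (h : ℂ)‖, by positivity, fun w hw => ?_⟩
  have hw0 : 0 < w.re := hc.trans_le hw
  have h1 := Gamma_mul_Gamma_eq_betaIntegral hw0 (t := (h : ℂ)) (by simpa using hh)
  have h2 : ‖betaIntegral w h‖ ≤ I := by
    rw [betaIntegral]
    refine intervalIntegral.norm_integral_le_of_norm_le zero_le_one ?_ hint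
    have : ∀ᵐ x : ℝ, x ≠ 1 := by
      simp [MeasureTheory.ae_iff]
    filter_upwards [this] with x hx1' hx
    have hx1 : (0 : ℝ) < 1 - x := by
      have := lt_of_le_of_ne hx.2 hx1'
      linarith
    rw [norm_mul, norm_cpow_eq_rpow_re_of_pos hx.1, show (1 : ℂ) - x = ((1 - x : ℝ) : ℂ) by
      push_cast; rfl, norm_cpow_eq_rpow_re_of_pos hx1]
    simp only [sub_re, one_re, ofReal_re]
    gcongr ?_ * _
    exact Real.rpow_le_rpow_of_exponent_ge hx.1 hx.2 (by linarith)
  have h3 : ‖Gamma w‖ * ‖Gamma (h : ℂ)‖ ≤ ‖Gamma (w + h)‖ * (|I| + 1) := by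
    rw [← norm_mul, h1, norm_mul]
    gcongr
    linarith [le_abs_self I]
  rw [div_mul_eq_mul_div, le_div_iff₀ hG]
  linarith

/-! ### Growth of L-functions to the right of `Re s = 0` -/

/-- Partial sums of a bounded periodic sequence with sum zero over a period are at most the period.
-/
theorem norm_sum_range_le_of_periodic {E : Type*} [NormedAddCommGroup E] {f : ℕ → E} {m : ℕ}
    (hm : 0 < m) (hper : ∀ n, f (n + m) = f n) (hsum : ∑ k ∈ Finset.range m, f k = 0)
    (hf : ∀ n, ‖f n‖ ≤ 1) (n : ℕ) : ‖∑ k ∈ Finset.range n, f k‖ ≤ m := by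
  induction n using Nat.strong_induction_on with
  | _ n ih =>
    rcases lt_or_ge n m with h | h
    · calc ‖∑ k ∈ Finset.range n, f k‖ ≤ ∑ k ∈ Finset.range n, ‖f k‖ := norm_sum_le _ _
        _ ≤ ∑ k ∈ Finset.range n, (1 : ℝ) := Finset.sum_le_sum fun k _ => hf k
        _ = n := by simp
        _ ≤ m := by exact_mod_cast h.le
    · obtain ⟨r, rfl⟩ := Nat.exists_eq_add_of_le h
      rw [Finset.sum_range_add, hsum, zero_add]
      simp_rw [add_comm m, hper]
      exact ih r (by omega)

/-- The Mellin transform at `-s` of a bounded function supported on `[1, ∞)` is holomorphic for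
`Re s > 0` and bounded by `M / Re s`. -/
theorem mellin_neg_of_bounded {f : ℝ → ℂ} {M : ℝ} (hf : Measurable f) (hb : ∀ t, ‖f t‖ ≤ M)
    (h0 : ∀ t < 1, f t = 0) {s : ℂ} (hs : 0 < s.re) :
    DifferentiableAt ℂ (fun s => mellin f (-s)) s ∧ ‖mellin f (-s)‖ ≤ M / s.re ∧
      mellin f (-s) = ∫ t in Set.Ioi (1 : ℝ), f t * (t : ℂ) ^ (-(s + 1)) := by
  have hloc : MeasureTheory.LocallyIntegrableOn f (Set.Ioi 0) := by
    refine MeasureTheory.LocallyIntegrable.locallyIntegrableOn ?_ _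
    exact (MeasureTheory.locallyIntegrable_const M).mono hf.aestronglyMeasurable
      (Filter.Eventually.of_forall fun t => (hb t).trans (le_abs_self M))
  have hd : DifferentiableAt ℂ (mellin f) (-s) := by
    refine mellin_differentiableAt_of_isBigO_rpow (a := 0) (b := -s.re - 1) hloc ?_ (by simpa) ?_
      (by simp)
    · simp only [neg_zero, Real.rpow_zero]
      exact Asymptotics.IsBigO.of_bound M (Filter.Eventually.of_forall fun t => by
        simpa using hb t)
    · refine Asymptotics.IsBigO.of_bound 0 ?_
      have : ∀ᶠ t : ℝ in nhdsWithin 0 (Set.Ioi 0), t < 1 :=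
        nhdsWithin_le_nhds (Iio_mem_nhds one_pos)
      filter_upwards [this] with t ht
      simp [h0 t ht]
  have hint : mellin f (-s) = ∫ t in Set.Ioi (1 : ℝ), f t * (t : ℂ) ^ (-(s + 1)) := by
    rw [mellin]
    have hsub : Set.Ioi (1 : ℝ) ⊆ Set.Ioi 0 := Set.Ioi_subset_Ioi zero_le_one
    have h1 : ∀ᵐ t : ℝ, t ≠ 1 := by simp [MeasureTheory.ae_iff]
    rw [← MeasureTheory.setIntegral_eq_of_subset_of_ae_sdiff_eq_zero (s := Set.Ioi (1 : ℝ))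
      (t := Set.Ioi 0) measurableSet_Ioi.nullMeasurableSet hsub]
    · refine MeasureTheory.setIntegral_congr_fun measurableSet_Ioi fun t _ => ?_
      simp only [smul_eq_mul]
      rw [mul_comm, neg_add, sub_eq_add_neg]
    · filter_upwards [h1] with t ht1 ht
      have : t < 1 := lt_of_le_of_ne (not_lt.1 ht.2) ht1
      simp [h0 t this]
  refine ⟨hd.comp s differentiableAt_id.neg, ?_, hint⟩
  rw [hint]
  have hM : 0 ≤ M := (norm_nonneg _).trans (hb 0)
  have h2 : ∫ t in Set.Ioi (1 : ℝ), M * t ^ (-(s.re + 1)) = M / s.re := by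
    rw [MeasureTheory.integral_const_mul, integral_Ioi_rpow_of_lt (by linarith) one_pos]
    simp
    field_simp
  rw [← h2]
  refine MeasureTheory.norm_integral_le_of_norm_le
    ((integrableOn_Ioi_rpow_of_lt (by linarith) one_pos).const_mul M) ?_
  refine (MeasureTheory.ae_restrict_iff' measurableSet_Ioi).2
    (Filter.Eventually.of_forall fun t ht => ?_)
  rw [norm_mul, Complex.norm_cpow_eq_rpow_re_of_pos (one_pos.trans ht)]
  simp only [Complex.neg_re, Complex.add_re, Complex.one_re]
  exact mul_le_mul_of_nonneg_right (hb t) (Real.rpow_nonneg (one_pos.trans ht).le _)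

/-- The identity theorem: an identity of Dirichlet series on `Re s > 1` extends to a larger
half-plane. -/
theorem eq_of_eq_on_one_lt_re {f g : ℂ → ℂ} {c : ℝ}
    (hf : DifferentiableOn ℂ f {s | c < s.re}) (hg : DifferentiableOn ℂ g {s | c < s.re})
    (h : ∀ s : ℂ, 1 < s.re → f s = g s) {s : ℂ} (hs : c < s.re) : f s = g s := by
  have ho : IsOpen {s : ℂ | c < s.re} := isOpen_lt continuous_const Complex.continuous_re
  have hconv : Convex ℝ {s : ℂ | c < s.re} := convex_halfSpace_re_gt c
  set z : ℂ := ((max c 1 + 1 : ℝ) : ℂ)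
  have hz : z ∈ {s : ℂ | c < s.re} := by
    simp [z]; linarith [le_max_left c 1]
  refine (hf.analyticOnNhd ho).eqOn_of_preconnected_of_eventuallyEq (hg.analyticOnNhd ho)
    hconv.isPreconnected hz ?_ hs
  have : {s : ℂ | 1 < s.re} ∈ nhds z := by
    refine (isOpen_lt continuous_const Complex.continuous_re).mem_nhds ?_
    simp [z]
  filter_upwards [this] with s hs using h s hs

theorem sum_range_natCast_zmod {M : Type*} [AddCommMonoid M] {m : ℕ} [NeZero m] (H : ZMod m → M) :
    ∑ k ∈ Finset.range m, H k = ∑ a, H a := by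
  refine Finset.sum_bij (fun k _ => (k : ZMod m)) (fun _ _ => Finset.mem_univ _) ?_ ?_
    fun _ _ => rfl
  · intro a ha b hb hab
    have := (ZMod.natCast_eq_natCast_iff' a b m).1 hab
    rwa [Nat.mod_eq_of_lt (Finset.mem_range.1 ha), Nat.mod_eq_of_lt (Finset.mem_range.1 hb)] at this
  · intro b _
    exact ⟨b.val, Finset.mem_range.2 (ZMod.val_lt b), ZMod.natCast_zmod_val b⟩

/-- The trivial bound for the partial sums of a nontrivial character. -/
theorem DirichletCharacter.norm_sum_Icc_le {N : ℕ} [NeZero N] {χ : DirichletCharacter ℂ N}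
    (hχ : χ ≠ 1) (n : ℕ) : ‖∑ k ∈ Finset.Icc 1 n, χ k‖ ≤ N := by
  have hN : 0 < N := Nat.pos_of_ne_zero (NeZero.ne N)
  have h1 : ∑ k ∈ Finset.range N, χ (k : ZMod N) = 0 := by
    rw [sum_range_natCast_zmod fun k => χ k, χ.sum_eq_zero_of_ne_one hχ]
  have hone : N ≠ 1 := by
    rintro rfl
    exact hχ (χ.level_one)
  have hz : χ ((0 : ℕ) : ZMod N) = 0 := by
    rw [Nat.cast_zero]
    exact χ.map_zero' hone
  have h2 : ∑ k ∈ Finset.Icc 1 n, χ (k : ZMod N) = ∑ k ∈ Finset.range (n + 1), χ (k : ZMod N) := by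
    rw [Finset.range_eq_Ico, Finset.sum_eq_sum_Ico_succ_bot (by omega), hz, zero_add]
    rfl
  rw [h2]
  exact norm_sum_range_le_of_periodic hN (fun k => by simp) h1 (fun k => χ.norm_le_one _) _

/-- Linear growth of `L(s, χ)` for `Re s > 0`, from partial summation. -/
theorem DirichletCharacter.norm_LFunction_le {N : ℕ} [NeZero N] {χ : DirichletCharacter ℂ N}
    (hχ : χ ≠ 1) {s : ℂ} (hs : 0 < s.re) : ‖χ.LFunction s‖ ≤ N * ‖s‖ / s.re := by
  set f : ℝ → ℂ := fun t => ∑ k ∈ Finset.Icc 1 ⌊t⌋₊, χ (k : ZMod N) with hf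
  have hmeas : Measurable f :=
    (measurable_from_top (f := fun n : ℕ => ∑ k ∈ Finset.Icc 1 n, χ (k : ZMod N))).comp
      Nat.measurable_floor
  have hb : ∀ t, ‖f t‖ ≤ N := fun t => norm_sum_Icc_le hχ _
  have h0 : ∀ t < 1, f t = 0 := fun t ht => by
    simp [hf, Nat.floor_eq_zero.2 ht]
  have key : ∀ s : ℂ, 0 < s.re → χ.LFunction s = s * mellin f (-s) := fun s hs => by
    refine eq_of_eq_on_one_lt_re (c := 0) (differentiable_LFunction hχ).differentiableOn
      (g := fun s => s * mellin f (-s)) ?_ ?_ hs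
    · intro z hz
      exact (differentiableAt_id.mul (mellin_neg_of_bounded hmeas hb h0 hz).1).differentiableWithinAt
    · intro z hz
      rw [LFunction_eq_LSeries χ hz, LSeries_eq_mul_integral (fun n => χ (n : ZMod N)) le_rfl
        (by linarith) (DirichletCharacter.LSeriesSummable_of_one_lt_re χ hz),
        (mellin_neg_of_bounded hmeas hb h0 (by linarith : 0 < z.re)).2.2]
      simp only [Real.rpow_zero]
      exact Asymptotics.IsBigO.of_bound N (Filter.Eventually.of_forall fun n => by
        simpa using norm_sum_Icc_le hχ n)
  rw [key s hs, norm_mul, mul_comm, mul_comm (N : ℝ), mul_div_assoc, mul_comm]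
  exact mul_le_mul_of_nonneg_left (mellin_neg_of_bounded hmeas hb h0 hs).2.1 (norm_nonneg _)

/-- The entire function `(s - 1) ζ(s)`. -/
noncomputable def zetaReg : ℂ → ℂ := DirichletCharacter.LFunctionTrivChar₁ 1

theorem differentiable_zetaReg : Differentiable ℂ zetaReg :=
  DirichletCharacter.differentiable_LFunctionTrivChar₁ 1

theorem zetaReg_of_ne_one {s : ℂ} (hs : s ≠ 1) : zetaReg s = (s - 1) * riemannZeta s := by
  rw [zetaReg, DirichletCharacter.LFunctionTrivChar₁, Function.update_of_ne hs,
    DirichletCharacter.LFunctionTrivChar, DirichletCharacter.LFunction_modOne_eq]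

theorem zetaReg_one : zetaReg 1 = 1 := by
  simp [zetaReg, DirichletCharacter.LFunctionTrivChar₁]

/-- Quadratic growth of `(s - 1) ζ(s)` for `Re s > 0`, from partial summation. -/
theorem norm_zetaReg_le {s : ℂ} (hs : 0 < s.re) :
    ‖zetaReg s‖ ≤ ‖s‖ + ‖s‖ * ‖s - 1‖ / s.re := by
  -- The error in the approximation of the summatory function of the constant `1` by `t`.
  set f : ℝ → ℂ := fun t => if 1 ≤ t then ((⌊t⌋₊ : ℝ) - t : ℝ) else 0 with hf
  have hmeas : Measurable f := by
    refine Measurable.ite measurableSet_Ici ?_ measurable_const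
    refine Complex.measurable_ofReal.comp (Measurable.sub ?_ measurable_id)
    exact (measurable_from_top (f := fun n : ℕ => (n : ℝ))).comp Nat.measurable_floor
  have hb : ∀ t, ‖f t‖ ≤ 1 := fun t => by
    simp only [hf]
    split_ifs with h
    · rw [Complex.norm_real, Real.norm_eq_abs, abs_le]
      constructor <;> linarith [Nat.floor_le (by linarith : 0 ≤ t), Nat.lt_floor_add_one t]
    · simp
  have h0 : ∀ t < 1, f t = 0 := fun t ht => by simp [hf, not_le.2 ht]
  have key : ∀ s : ℂ, 0 < s.re → zetaReg s = s + s * (s - 1) * mellin f (-s) := fun s hs => by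
    refine eq_of_eq_on_one_lt_re (c := 0) differentiable_zetaReg.differentiableOn
      (g := fun s => s + s * (s - 1) * mellin f (-s)) ?_ ?_ hs
    · intro z hz
      have := (mellin_neg_of_bounded hmeas hb h0 hz).1
      exact (differentiableAt_id.add ((differentiableAt_id.mul
        (differentiableAt_id.sub_const 1)).mul this)).differentiableWithinAt
    · intro z hz
      have hz0 : 0 < z.re := by linarith
      have hz1 : z ≠ 1 := by rintro rfl; simp at hz
      have h1 := LSeries_eq_mul_integral' (1 : ℕ → ℂ) (r := 1) zero_le_one hz
        (Asymptotics.IsBigO.of_bound 1 (Filter.Eventually.of_forall fun n => by simp))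
      rw [LSeries_one_eq_riemannZeta hz] at h1
      have h2 : ∫ t in Set.Ioi (1 : ℝ), (t : ℂ) ^ (-z) = 1 / (z - 1) := by
        rw [integral_Ioi_cpow_of_lt (by simpa using hz) one_pos]
        simp
        rw [← neg_div_neg_eq]; ring_nf
      have h3 : mellin f (-z) + ∫ t in Set.Ioi (1 : ℝ), (t : ℂ) ^ (-z) =
          ∫ t in Set.Ioi (1 : ℝ), (∑ k ∈ Finset.Icc 1 ⌊t⌋₊, (1 : ℕ → ℂ) k) * (t : ℂ) ^ (-(z + 1)) := by
        rw [(mellin_neg_of_bounded hmeas hb h0 hz0).2.2, ← MeasureTheory.integral_add]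
        · refine MeasureTheory.setIntegral_congr_fun measurableSet_Ioi fun t ht => ?_
          have ht' : (1 : ℝ) ≤ t := le_of_lt ht
          have ht0 : (t : ℂ) ≠ 0 := by
            have : t ≠ 0 := by linarith
            exact_mod_cast this
          have e : (t : ℂ) ^ (-z) = t * (t : ℂ) ^ (-(z + 1)) := by
            nth_rewrite 2 [← Complex.cpow_one (t : ℂ)]
            rw [← Complex.cpow_add _ _ ht0]; ring_nf
          simp only [hf, if_pos ht', e]
          push_cast
          simp
          ring
        · refine MeasureTheory.Integrable.mono'
            (g := fun t : ℝ => t ^ (-(z.re + 1))) (integrableOn_Ioi_rpow_of_lt (by linarith) one_pos)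
            ?_ ?_
          · refine (hmeas.mul ?_).aestronglyMeasurable
            exact (Complex.measurable_ofReal).pow_const _
          · refine (MeasureTheory.ae_restrict_iff' measurableSet_Ioi).2
              (Filter.Eventually.of_forall fun t ht => ?_)
            rw [norm_mul, Complex.norm_cpow_eq_rpow_re_of_pos (one_pos.trans ht)]
            simp only [Complex.neg_re, Complex.add_re, Complex.one_re]
            exact mul_le_of_le_one_left (Real.rpow_nonneg (one_pos.trans ht).le _) (hb t)
        · exact integrableOn_Ioi_cpow_of_lt (by simpa using hz) one_pos
      rw [zetaReg_of_ne_one hz1, h1, ← h3, h2]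
      have : z - 1 ≠ 0 := sub_ne_zero.2 hz1
      field_simp
      ring
  rw [key s hs]
  refine (norm_add_le _ _).trans ?_
  rw [norm_mul, norm_mul, mul_div_assoc, mul_assoc]
  have h4 := (mellin_neg_of_bounded hmeas hb h0 hs).2.1
  have h5 : ‖s - 1‖ * ‖mellin f (-s)‖ ≤ ‖s - 1‖ / s.re := by
    rw [div_eq_mul_one_div]
    exact mul_le_mul_of_nonneg_left h4 (norm_nonneg _)
  linarith [mul_le_mul_of_nonneg_left h5 (norm_nonneg s)]

/-! ### Holomorphic logarithms and monotonicity along horizontal lines -/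

theorem isOpen_half_lt_re : IsOpen {s : ℂ | 1 / 2 < s.re} :=
  isOpen_lt continuous_const Complex.continuous_re

/-- A zero-free entire function on the half-plane `Re s > 1/2` has a holomorphic logarithm there. -/
theorem exists_log_half_plane {F : ℂ → ℂ} (hF : Differentiable ℂ F)
    (h0 : ∀ s : ℂ, 1 / 2 < s.re → F s ≠ 0) :
    ∃ U : ℂ → ℂ, DifferentiableOn ℂ U {s | 1 / 2 < s.re} ∧
      ∀ s : ℂ, 1 / 2 < s.re → Complex.exp (U s) = F s := by
  have hsc : IsSimplyConnected {s : ℂ | 1 / 2 < s.re} := by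
    have hconv : Convex ℝ {s : ℂ | 1 / 2 < s.re} := convex_halfSpace_re_gt (1 / 2)
    have : ContractibleSpace {s : ℂ | 1 / 2 < s.re} :=
      hconv.contractibleSpace ⟨1, by simp; norm_num⟩
    exact SimplyConnectedSpace.ofContractible _
  obtain ⟨U, hU, hexp⟩ := Complex.exists_continuousOn_eqOn_exp_comp hsc isOpen_half_lt_re
    hF.continuous.continuousOn (by rintro ⟨s, hs, h⟩; exact h0 s hs h)
  refine ⟨U, fun s hs => ?_, fun s hs => hexp hs⟩
  have hst := Complex.hasStrictDerivAt_exp (U s)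
  have hne : Complex.exp (U s) ≠ 0 := Complex.exp_ne_zero _
  have hUc : ContinuousAt U s := hU.continuousAt (isOpen_half_lt_re.mem_nhds hs)
  have h1 := hUc.eventually (hst.hasStrictFDerivAt_equiv hne).eventually_left_inverse
  obtain ⟨g, hg, hgU⟩ : ∃ g : ℂ → ℂ, DifferentiableAt ℂ g (Complex.exp (U s)) ∧
      ∀ᶠ z in nhds s, g (Complex.exp (U z)) = U z :=
    ⟨_, (hst.to_localInverse hne).hasDerivAt.differentiableAt, h1⟩
  have h2 : U =ᶠ[nhds s] fun z => g (F z) := by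
    filter_upwards [hgU, isOpen_half_lt_re.mem_nhds hs] with z hz hz2
    have : Complex.exp (U z) = F z := hexp hz2
    rw [← this, hz]
  have h4 : Complex.exp (U s) = F s := hexp hs
  rw [h4] at hg
  exact ((hg.comp s (hF s)).congr_of_eventuallyEq h2).differentiableWithinAt

theorem log_two_add_add_le {x a : ℝ} (hx : 0 ≤ x) (ha : 0 ≤ a) (ha4 : a ≤ 6) :
    Real.log (2 + x + a) ≤ 3 * Real.log (2 + x) := by
  have : Real.log ((2 + x) ^ 3) = 3 * Real.log (2 + x) := by rw [Real.log_pow]; norm_num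
  rw [← this]
  exact Real.log_le_log (by linarith) (by nlinarith [sq_nonneg x, mul_nonneg hx (sq_nonneg x)])

theorem log_two_add_pos {x : ℝ} (hx : 0 ≤ x) : 0 < Real.log (2 + x) :=
  Real.log_pos (by linarith)

/-- Logarithmic growth of the logarithm of a zero-free function of polynomial growth, away from the
edge of the half-plane; this is the Borel–Carathéodory theorem on discs of radius `2 + h / 2`. -/
theorem exists_norm_log_le {F U : ℂ → ℂ} (hUd : DifferentiableOn ℂ U {s | 1 / 2 < s.re})
    (hexp : ∀ s : ℂ, 1 / 2 < s.re → Complex.exp (U s) = F s)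
    (hF : ∃ (A : ℕ) (C : ℝ), ∀ s : ℂ, 1 / 4 ≤ s.re → ‖F s‖ ≤ C * (1 + ‖s‖) ^ A)
    (hU2 : ∃ C : ℝ, ∀ s : ℂ, 2 ≤ s.re → ‖U s‖ ≤ C * Real.log (2 + ‖s‖)) {h : ℝ} (hh : 0 < h)
    (h1 : h ≤ 1) :
    ∃ K : ℝ, 0 < K ∧ ∀ s : ℂ, 1 / 2 + h ≤ s.re → ‖U s‖ ≤ K * Real.log (2 + ‖s‖) := by
  obtain ⟨A, C, hC⟩ := hF
  obtain ⟨C', hC'⟩ := hU2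
  set C1 : ℝ := |C| + 1
  set m : ℝ := Real.log C1 / Real.log 2 + 3 * A + 1
  have hC1 : 1 ≤ C1 := by simp only [C1]; linarith [abs_nonneg C]
  have hm : 0 < m := by
    have : 0 ≤ Real.log C1 := Real.log_nonneg hC1
    have : 0 < Real.log 2 := Real.log_pos one_lt_two
    positivity
  refine ⟨8 * m / h + 3 * |C'| * 10 / h, by positivity, fun s hs => ?_⟩
  set l := Real.log (2 + ‖s‖)
  have hl : 0 < l := log_two_add_pos (norm_nonneg s)
  have hl2 : Real.log 2 ≤ l := Real.log_le_log two_pos (by linarith [norm_nonneg s])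
  -- The disc is centred at `s + 2`, where `U` is under control, and contains `s`.
  have hball : ∀ w ∈ Metric.ball (0 : ℂ) (2 + h / 2), 1 / 2 < (s + 2 + w).re := fun w hw => by
    have : ‖w‖ < 2 + h / 2 := by simpa using hw
    have h3 := (abs_le.1 (Complex.abs_re_le_norm w)).1
    simp only [Complex.add_re, Complex.re_ofNat]
    linarith
  have hd : DifferentiableOn ℂ (fun w => U (s + 2 + w)) (Metric.ball 0 (2 + h / 2)) :=
    hUd.comp (by fun_prop) fun w hw => hball w hw
  have hmaps : Set.MapsTo (fun w => U (s + 2 + w)) (Metric.ball 0 (2 + h / 2))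
      {z | z.re ≤ m * l} := fun w hw => by
    have hw' : ‖w‖ < 2 + h / 2 := by simpa using hw
    have hb := hball w hw
    have e1 : (U (s + 2 + w)).re = Real.log ‖F (s + 2 + w)‖ := by
      rw [← hexp _ hb, Complex.norm_exp, Real.log_exp]
    change (U (s + 2 + w)).re ≤ m * l
    have hn : ‖s + 2 + w‖ ≤ ‖s‖ + 2 + 3 := by
      refine (norm_add₃_le).trans ?_
      simp; linarith
    have e2 : ‖F (s + 2 + w)‖ ≤ C1 * (2 + ‖s‖ + 4) ^ A := by
      refine (hC _ (by linarith)).trans ?_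
      refine mul_le_mul (by simp only [C1]; linarith [le_abs_self C]) ?_ (by positivity)
        (by positivity)
      exact pow_le_pow_left₀ (by positivity) (by linarith) A
    have hF0 : 0 < ‖F (s + 2 + w)‖ := by
      rw [← hexp _ hb]; exact norm_pos_iff.2 (Complex.exp_ne_zero _)
    rw [e1]
    refine (Real.log_le_log hF0 e2).trans ?_
    rw [Real.log_mul (by positivity) (by positivity), Real.log_pow]
    have e3 := log_two_add_add_le (norm_nonneg s) (a := 4) (by norm_num) (by norm_num)
    have e4 : Real.log C1 ≤ Real.log C1 / Real.log 2 * l := by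
      have : 0 < Real.log 2 := Real.log_pos one_lt_two
      rw [div_mul_eq_mul_div, le_div_iff₀ this]
      exact mul_le_mul_of_nonneg_left hl2 (Real.log_nonneg hC1)
    have e5 : (A : ℝ) * Real.log (2 + ‖s‖ + 4) ≤ A * (3 * l) := by gcongr
    simp only [m]
    nlinarith
  have hz : (-2 : ℂ) ∈ Metric.ball (0 : ℂ) (2 + h / 2) := by
    simp; linarith
  have := Complex.borelCaratheodory (f := fun w => U (s + 2 + w)) (mul_pos hm hl) hd hmaps
    (by linarith) hz
  simp only [norm_neg, Complex.norm_ofNat, add_neg_cancel_right, add_zero] at this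
  refine this.trans ?_
  have e6 : ‖U (s + 2)‖ ≤ 3 * |C'| * l := by
    refine (hC' _ (by simp; linarith)).trans ?_
    have n1 : ‖s + 2‖ ≤ ‖s‖ + 2 := by simpa using norm_add_le s 2
    have n2 : Real.log (2 + ‖s + 2‖) ≤ 3 * l :=
      (Real.log_le_log (by positivity) (by linarith)).trans
        (log_two_add_add_le (norm_nonneg s) (a := 2) (by norm_num) (by norm_num))
    calc C' * Real.log (2 + ‖s + 2‖) ≤ |C'| * (3 * l) :=
          mul_le_mul (le_abs_self _) n2 (log_two_add_pos (norm_nonneg _)).le (abs_nonneg _)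
      _ = _ := by ring
  have e7 : 2 + h / 2 - 2 = h / 2 := by ring
  rw [e7]
  have e8 : 2 * (m * l) * 2 / (h / 2) = 8 * m / h * l := by field_simp; ring
  have e9 : ‖U (s + 2)‖ * (2 + h / 2 + 2) / (h / 2) ≤ 3 * |C'| * 10 / h * l := by
    calc _ ≤ (3 * |C'| * l) * 5 / (h / 2) := by gcongr; linarith
      _ = _ := by field_simp; ring
  rw [e8]
  linarith

/-- **Monotonicity across the critical line.** Let `E = N^{s/2} γ(s) F(s)` be zero-free for
`Re s > 1/2` with `|E|` symmetric about the line `Re s = 1/2`. Then `|E|` increases with the real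
part to the right of that line: `E(s) / E(s + δ)` has modulus `1` on `Re s = 1/2 - δ/2`, and the
Phragmén–Lindelöf principle applies to the right of it. -/
theorem norm_completed_le_of_symm {F U γ : ℂ → ℂ} {N : ℝ} (hN : 0 < N) (hFd : Differentiable ℂ F)
    (hUd : DifferentiableOn ℂ U {s | 1 / 2 < s.re})
    (hexp : ∀ s : ℂ, 1 / 2 < s.re → Complex.exp (U s) = F s)
    (hF : ∃ (A : ℕ) (C : ℝ), ∀ s : ℂ, 1 / 4 ≤ s.re → ‖F s‖ ≤ C * (1 + ‖s‖) ^ A)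
    (hU2 : ∃ C : ℝ, ∀ s : ℂ, 2 ≤ s.re → ‖U s‖ ≤ C * Real.log (2 + ‖s‖))
    (hγd : ∀ s : ℂ, 0 < s.re → DifferentiableAt ℂ γ s) (hγ0 : ∀ s : ℂ, 0 < s.re → γ s ≠ 0)
    (hγb : ∀ δ : ℝ, 0 < δ → ∃ C : ℝ, 0 < C ∧ ∀ s : ℂ, 1 / 4 ≤ s.re → ‖γ s‖ ≤ C * ‖γ (s + δ)‖)
    (hreal : ∀ δ : ℝ, 0 < δ → ∃ C : ℝ, ∀ x : ℝ, 2 ≤ x → ‖F x‖ ≤ C * ‖F (x + δ)‖)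
    {E : ℂ → ℂ} (hE : ∀ s, E s = (N : ℂ) ^ (s / 2) * γ s * F s)
    (hsymm : ∀ h t : ℝ, 0 < h → h ≤ 1 / 4 →
      ‖E (1 / 2 - h + t * Complex.I)‖ = ‖E (1 / 2 + h + t * Complex.I)‖)
    {δ : ℝ} (hδ : 0 < δ) (hδ2 : δ ≤ 1 / 2) {s : ℂ} (hs : 1 / 2 ≤ s.re) :
    ‖E s‖ ≤ ‖E (s + δ)‖ := by
  obtain ⟨Cγ, hCγ, hγ⟩ := hγb δ hδ
  obtain ⟨B, hB⟩ := hreal δ hδ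
  obtain ⟨K, hK, hUK⟩ := exists_norm_log_le hUd hexp hF hU2 (h := δ / 2) (by linarith) (by linarith)
  obtain ⟨A, C, hC⟩ := hF
  have hNc : (N : ℂ) ≠ 0 := by exact_mod_cast hN.ne'
  have hEne : ∀ s : ℂ, 1 / 2 < s.re → E s ≠ 0 := fun s hs => by
    rw [hE, ← hexp s hs]
    have := hγ0 s (by linarith)
    have h2 : (N : ℂ) ^ (s / 2) ≠ 0 := by simp [Complex.cpow_eq_zero_iff, hNc]
    exact mul_ne_zero (mul_ne_zero h2 this) (Complex.exp_ne_zero _)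
  have hEd : ∀ s : ℂ, 0 < s.re → DifferentiableAt ℂ E s := fun s hs => by
    have : E = fun s => (N : ℂ) ^ (s / 2) * γ s * F s := funext hE
    rw [this]
    refine DifferentiableAt.mul (DifferentiableAt.mul ?_ (hγd s hs)) (hFd s)
    exact DifferentiableAt.const_cpow (by fun_prop) (Or.inl hNc)
  -- The points `1/2 - δ/2 + w` and `1/2 - δ/2 + w + δ` are reflections of each other in the
  -- critical line when `Re w = 0`.
  set f : ℂ → ℂ := fun w => E (1 / 2 - δ / 2 + w) / E (1 / 2 - δ / 2 + w + δ) with hf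
  have hre1 : ∀ w : ℂ, (1 / 2 - δ / 2 + w : ℂ).re = 1 / 2 - δ / 2 + w.re := fun w => by
    simp
  have hre2 : ∀ w : ℂ, (1 / 2 - δ / 2 + w + δ : ℂ).re = 1 / 2 + δ / 2 + w.re := fun w => by
    rw [Complex.add_re, hre1]; simp; ring
  have hnormE : ∀ z : ℂ, ‖E z‖ = N ^ (z.re / 2) * ‖γ z‖ * ‖F z‖ := fun z => by
    rw [hE, norm_mul, norm_mul, Complex.norm_cpow_eq_rpow_re_of_pos hN]
    congr 3
    simp
  -- The quotient of completed functions in terms of the quotient of the `F`.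
  have hquot : ∀ w : ℂ, 0 ≤ w.re → ‖f w‖ ≤ N ^ (-(δ / 2)) * Cγ *
      (‖F (1 / 2 - δ / 2 + w)‖ / ‖F (1 / 2 - δ / 2 + w + δ)‖) := fun w hw => by
    have g0 : 0 < ‖γ (1 / 2 - δ / 2 + w + δ)‖ := norm_pos_iff.2 (hγ0 _ (by rw [hre2]; linarith))
    have f0 : 0 < ‖F (1 / 2 - δ / 2 + w + δ)‖ := by
      rw [← hexp _ (by rw [hre2]; linarith)]; exact norm_pos_iff.2 (Complex.exp_ne_zero _)
    have g1 := hγ (1 / 2 - δ / 2 + w) (by rw [hre1]; linarith)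
    have e1 : N ^ ((1 / 2 - δ / 2 + w : ℂ).re / 2) =
        N ^ (-(δ / 2)) * N ^ ((1 / 2 - δ / 2 + w + δ : ℂ).re / 2) := by
      rw [← Real.rpow_add hN, hre1, hre2]; congr 1; ring
    have p1 : 0 < N ^ ((1 / 2 - δ / 2 + w + δ : ℂ).re / 2) := Real.rpow_pos_of_pos hN _
    have p2 : 0 < N ^ (-(δ / 2)) := Real.rpow_pos_of_pos hN _
    rw [hf, norm_div, hnormE, hnormE, e1, div_le_iff₀ (by positivity)]
    calc _ ≤ N ^ (-(δ / 2)) * N ^ ((1 / 2 - δ / 2 + w + δ : ℂ).re / 2) *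
          (Cγ * ‖γ (1 / 2 - δ / 2 + w + δ)‖) * ‖F (1 / 2 - δ / 2 + w)‖ := by gcongr
      _ = _ := by
        generalize ‖F (1 / 2 - δ / 2 + w + δ)‖ = b at f0 ⊢
        generalize ‖F (1 / 2 - δ / 2 + w)‖ = a
        field_simp
  -- The quotient has exponential type, as the Phragmén–Lindelöf principle requires.
  have hbound : ∀ w : ℂ, 0 ≤ w.re → ‖f w‖ ≤ N ^ (-(δ / 2)) * Cγ *
      (|C| * Real.exp (A * (2 + ‖w‖)) * Real.exp (K * (3 + ‖w‖))) := fun w hw => by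
    refine (hquot w hw).trans ?_
    have n1 : ‖(1 / 2 - δ / 2 + w : ℂ)‖ ≤ 1 + ‖w‖ := by
      have : ‖(1 / 2 - δ / 2 : ℂ)‖ ≤ 1 := by
        rw [show (1 / 2 - δ / 2 : ℂ) = ((1 / 2 - δ / 2 : ℝ) : ℂ) by push_cast; ring,
          Complex.norm_real, Real.norm_eq_abs, abs_le]
        constructor <;> linarith
      linarith [norm_add_le (1 / 2 - δ / 2 : ℂ) w]
    have n2 : ‖(1 / 2 - δ / 2 + w + δ : ℂ)‖ ≤ 2 + ‖w‖ := by
      have : ‖(δ : ℂ)‖ ≤ 1 := by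
        rw [Complex.norm_real, Real.norm_eq_abs, abs_le]; constructor <;> linarith
      linarith [norm_add_le (1 / 2 - δ / 2 + w : ℂ) δ]
    have q1 : ‖F (1 / 2 - δ / 2 + w)‖ ≤ |C| * Real.exp (A * (2 + ‖w‖)) := by
      refine (hC _ (by rw [hre1]; linarith)).trans ?_
      refine mul_le_mul (le_abs_self _) ?_ (by positivity) (abs_nonneg _)
      rw [Real.exp_nat_mul]
      gcongr
      linarith [Real.add_one_le_exp (2 + ‖w‖)]
    have q2 : Real.exp (-(K * (3 + ‖w‖))) ≤ ‖F (1 / 2 - δ / 2 + w + δ)‖ := by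
      have hr : 1 / 2 + δ / 2 ≤ (1 / 2 - δ / 2 + w + δ : ℂ).re := by rw [hre2]; linarith
      rw [← hexp _ (by linarith), Complex.norm_exp, Real.exp_le_exp]
      have k1 := hUK _ hr
      have k2 := (abs_le.1 (Complex.abs_re_le_norm (U (1 / 2 - δ / 2 + w + δ)))).1
      have k3 : Real.log (2 + ‖(1 / 2 - δ / 2 + w + δ : ℂ)‖) ≤ 3 + ‖w‖ := by
        have := Real.log_le_sub_one_of_pos
          (x := 2 + ‖(1 / 2 - δ / 2 + w + δ : ℂ)‖) (by positivity)
        linarith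
      have k4 := mul_le_mul_of_nonneg_left k3 hK.le
      linarith
    have q3 : ‖F (1 / 2 - δ / 2 + w)‖ / ‖F (1 / 2 - δ / 2 + w + δ)‖ ≤
        |C| * Real.exp (A * (2 + ‖w‖)) / Real.exp (-(K * (3 + ‖w‖))) :=
      div_le_div₀ (by positivity) q1 (Real.exp_pos _) q2
    rw [Real.exp_neg, div_inv_eq_mul] at q3
    gcongr
  have hcl : closure {z : ℂ | 0 < z.re} = {z | 0 ≤ z.re} := Complex.closure_setOfPred_lt_re 0
  have hdiff : DiffContOnCl ℂ f {z | 0 < z.re} := by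
    refine DifferentiableOn.diffContOnCl ?_
    rw [hcl]
    intro w hw
    have hw' : 0 ≤ w.re := hw
    refine DifferentiableAt.differentiableWithinAt ?_
    refine DifferentiableAt.div ?_ ?_ (hEne _ (by rw [hre2]; linarith))
    · exact (hEd _ (by rw [hre1]; linarith)).comp w (by fun_prop)
    · exact (hEd (1 / 2 - δ / 2 + w + δ) (by rw [hre2]; linarith)).comp w (by fun_prop)
  have hPL := PhragmenLindelof.right_half_plane_of_bounded_on_real (f := f) (C := 1)
    (z := s - (1 / 2 - δ / 2)) hdiff ?_ ?_ ?_ ?_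
  · rw [hf] at hPL
    simp only [add_sub_cancel, norm_div] at hPL
    have : 0 < ‖E (s + δ)‖ := norm_pos_iff.2 (hEne _ (by simp; linarith))
    rwa [div_le_one this] at hPL
  · refine ⟨1, by norm_num, A + K, ?_⟩
    refine Asymptotics.IsBigO.of_bound
      (N ^ (-(δ / 2)) * Cγ * (|C| * Real.exp (A * 2) * Real.exp (K * 3))) ?_
    refine Filter.eventually_inf_principal.2 (Filter.Eventually.of_forall fun w hw => ?_)
    refine (hbound w (le_of_lt hw)).trans (le_of_eq ?_)
    rw [Real.norm_eq_abs, Real.abs_exp, Real.rpow_one, mul_add, mul_add, add_mul, Real.exp_add,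
      Real.exp_add, Real.exp_add]
    ring
  · refine ⟨N ^ (-(δ / 2)) * Cγ * |B|, ?_⟩
    rw [Filter.eventually_map]
    filter_upwards [Filter.eventually_ge_atTop 2] with x hx
    refine (hquot x (by simp; linarith)).trans ?_
    have hx2 := hB (1 / 2 - δ / 2 + x) (by linarith)
    push_cast at hx2
    have f0 : 0 < ‖F (1 / 2 - δ / 2 + x + δ)‖ := by
      rw [← hexp _ (by rw [hre2]; simp; linarith)]; exact norm_pos_iff.2 (Complex.exp_ne_zero _)
    have p2 : 0 < N ^ (-(δ / 2)) := Real.rpow_pos_of_pos hN _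
    gcongr
    rw [div_le_iff₀ f0]
    exact hx2.trans (mul_le_mul_of_nonneg_right (le_abs_self _) f0.le)
  · intro t
    have := hsymm (δ / 2) t (by linarith) (by linarith)
    have e : (1 / 2 - δ / 2 + t * Complex.I + δ : ℂ) = 1 / 2 + δ / 2 + t * Complex.I := by ring
    push_cast at this
    rw [hf]
    simp only [e]
    rw [norm_div, this]
    exact div_self_le_one _
  · simp
    linarith

/-! ### The Fejér kernel -/

/-- The Fejér kernel on the real line, normalized to have integral `1`. -/
noncomputable def fejer (u : ℝ) : ℝ := (1 - Real.cos u) / (Real.pi * u ^ 2)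

theorem fejer_nonneg (u : ℝ) : 0 ≤ fejer u := by
  have := Real.cos_le_one u
  exact div_nonneg (by linarith) (by positivity)

theorem fejer_le (u : ℝ) : fejer u ≤ 2 * (1 + u ^ 2)⁻¹ := by
  rcases eq_or_ne u 0 with rfl | hu
  · simp [fejer]
  have hu2 : 0 < u ^ 2 := by positivity
  have hpi := Real.pi_gt_three
  rw [fejer, ← div_eq_mul_inv, div_le_div_iff₀ (by positivity) (by positivity)]
  have h1 : 1 - Real.cos u ≤ u ^ 2 / 2 := by linarith [Real.one_sub_sq_div_two_le_cos (x := u)]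
  have h2 : 1 - Real.cos u ≤ 2 := by linarith [Real.neg_one_le_cos u]
  nlinarith [Real.cos_le_one u]

theorem measurable_fejer : Measurable fejer := by
  unfold fejer
  exact (measurable_const.sub Real.measurable_cos).div (measurable_const.mul (measurable_id.pow_const 2))

/-- The Fejér kernel decays fast enough to integrate functions of logarithmic growth. -/
theorem fejer_mul_log_le (u : ℝ) :
    fejer u * (1 + Real.log (1 + |u|)) ≤ 8 * (1 + ‖u‖ ^ 2) ^ (-(3 / 2 : ℝ) / 2) := by
  have hy : 1 ≤ 1 + u ^ 2 := by nlinarith [sq_nonneg u]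
  have hy0 : 0 < 1 + u ^ 2 := by linarith
  have h1 : Real.log (1 + |u|) ≤ Real.log 2 + 2 * (1 + u ^ 2) ^ (1 / 4 : ℝ) := by
    have e1 : (1 + |u|) ^ 2 ≤ 2 ^ 2 * (1 + u ^ 2) := by
      rw [← sq_abs u]; nlinarith [sq_nonneg (1 - |u|), abs_nonneg u]
    have e2 := Real.log_le_log (by positivity) e1
    rw [Real.log_mul (by norm_num) hy0.ne', Real.log_pow, Real.log_pow] at e2
    have e3 := Real.log_le_rpow_div (x := 1 + u ^ 2) hy0.le (ε := 1 / 4) (by norm_num)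
    push_cast at e2
    linarith
  have h2 : 1 ≤ (1 + u ^ 2) ^ (1 / 4 : ℝ) := Real.one_le_rpow hy (by norm_num)
  have h3 : 1 + Real.log (1 + |u|) ≤ 4 * (1 + u ^ 2) ^ (1 / 4 : ℝ) := by
    linarith [Real.log_two_lt_d9]
  have h4 : 0 ≤ Real.log (1 + |u|) := Real.log_nonneg (by linarith [abs_nonneg u])
  have h5 : (1 + ‖u‖ ^ 2) ^ (-(3 / 2 : ℝ) / 2) = (1 + u ^ 2)⁻¹ * (1 + u ^ 2) ^ (1 / 4 : ℝ) := by
    rw [Real.norm_eq_abs, sq_abs, ← Real.rpow_neg_one, ← Real.rpow_add hy0]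
    norm_num
  rw [h5]
  calc _ ≤ 2 * (1 + u ^ 2)⁻¹ * (4 * (1 + u ^ 2) ^ (1 / 4 : ℝ)) :=
        mul_le_mul (fejer_le u) h3 (by linarith) (by positivity)
    _ = _ := by ring

theorem integrable_fejer_mul_log :
    MeasureTheory.Integrable fun u => fejer u * (1 + Real.log (1 + |u|)) := by
  refine ((integrable_rpow_neg_one_add_norm_sq (E := ℝ) (r := 3 / 2)
    (by simp; norm_num)).const_mul 8).mono' ?_ ?_
  · refine (measurable_fejer.mul (measurable_const.add ?_)).aestronglyMeasurable
    exact Real.measurable_log.comp (measurable_const.add measurable_id.abs)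
  · refine Filter.Eventually.of_forall fun u => ?_
    rw [Real.norm_eq_abs, abs_of_nonneg]
    · exact fejer_mul_log_le u
    · exact mul_nonneg (fejer_nonneg u)
        (by linarith [Real.log_nonneg (by linarith [abs_nonneg u] : 1 ≤ 1 + |u|)])

/-- Functions of logarithmic growth are integrable against the Fejér kernel. -/
theorem integrable_mul_fejer {g : ℝ → ℂ} {A : ℝ} (hg : MeasureTheory.AEStronglyMeasurable g)
    (hA : ∀ u, ‖g u‖ ≤ A * (1 + Real.log (1 + |u|))) :
    MeasureTheory.Integrable fun u => g u * fejer u := by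
  refine (integrable_fejer_mul_log.const_mul A).mono'
    (hg.mul (Complex.measurable_ofReal.comp measurable_fejer).aestronglyMeasurable) ?_
  refine Filter.Eventually.of_forall fun u => ?_
  rw [norm_mul, Complex.norm_real, Real.norm_of_nonneg (fejer_nonneg u)]
  have := mul_le_mul_of_nonneg_right (hA u) (fejer_nonneg u)
  linarith

theorem integrable_fejer : MeasureTheory.Integrable fejer := by
  refine integrable_fejer_mul_log.mono' measurable_fejer.aestronglyMeasurable ?_
  refine Filter.Eventually.of_forall fun u => ?_
  rw [Real.norm_of_nonneg (fejer_nonneg u)]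
  refine le_mul_of_one_le_right (fejer_nonneg u) ?_
  linarith [Real.log_nonneg (by linarith [abs_nonneg u] : 1 ≤ 1 + |u|)]

/-- The Fourier transform of the triangle function, computed directly; Fourier inversion then gives
the transform of the Fejér kernel. -/
theorem fourier_triangle (w : ℝ) :
    FourierTransform.fourier (fun x : ℝ => ((max 0 (1 - |x|) : ℝ) : ℂ)) w =
      if w = 0 then 1 else ((2 * Real.pi * fejer (2 * Real.pi * w) : ℝ) : ℂ) := by
  rw [Real.fourier_real_eq_integral_exp_smul]
  set c : ℂ := ((-2 * Real.pi * w : ℝ) : ℂ) * Complex.I with hc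
  have hexp : ∀ v : ℝ, (((-2 * Real.pi * v * w : ℝ) : ℂ) * Complex.I) = c * v := fun v => by
    rw [hc]; push_cast; ring
  simp_rw [hexp, smul_eq_mul]
  have hcont : Continuous fun v : ℝ => Complex.exp (c * v) * ((max 0 (1 - |v|) : ℝ) : ℂ) := by
    fun_prop
  have h1 : ∫ v : ℝ, Complex.exp (c * v) * ((max 0 (1 - |v|) : ℝ) : ℂ) =
      ∫ v in (-1 : ℝ)..1, Complex.exp (c * v) * ((max 0 (1 - |v|) : ℝ) : ℂ) := by
    rw [intervalIntegral.integral_of_le (by norm_num)]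
    symm
    refine MeasureTheory.setIntegral_eq_integral_of_forall_compl_eq_zero fun v hv => ?_
    have : 1 - |v| ≤ 0 := by
      by_contra h
      have h2 := abs_lt.1 (by linarith : |v| < 1)
      exact hv ⟨h2.1, h2.2.le⟩
    simp [max_eq_left this]
  rw [h1, ← intervalIntegral.integral_add_adjacent_intervals (b := 0)
    (hcont.intervalIntegrable _ _) (hcont.intervalIntegrable _ _)]
  have h2 : ∫ v in (-1 : ℝ)..0, Complex.exp (c * v) * ((max 0 (1 - |v|) : ℝ) : ℂ) =
      ∫ v in (-1 : ℝ)..0, Complex.exp (c * v) * (1 + v) := by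
    refine intervalIntegral.integral_congr fun v hv => ?_
    rw [Set.uIcc_of_le (by norm_num)] at hv
    have : max 0 (1 - |v|) = 1 + v := by
      rw [abs_of_nonpos hv.2, max_eq_right (by linarith [hv.1])]; ring
    simp only [this]; push_cast; ring
  have h3 : ∫ v in (0 : ℝ)..1, Complex.exp (c * v) * ((max 0 (1 - |v|) : ℝ) : ℂ) =
      ∫ v in (0 : ℝ)..1, Complex.exp (c * v) * (1 - v) := by
    refine intervalIntegral.integral_congr fun v hv => ?_
    rw [Set.uIcc_of_le (by norm_num)] at hv
    have : max 0 (1 - |v|) = 1 - v := by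
      rw [abs_of_nonneg hv.1, max_eq_right (by linarith [hv.2])]
    simp only [this]; push_cast; ring
  rw [h2, h3]
  split_ifs with hw
  · have : c = 0 := by simp [hc, hw]
    simp only [this, zero_mul, Complex.exp_zero, one_mul]
    rw [intervalIntegral.integral_eq_sub_of_hasDerivAt
        (f := fun v : ℝ => (v : ℂ) + (v : ℂ) ^ 2 / 2),
      intervalIntegral.integral_eq_sub_of_hasDerivAt
        (f := fun v : ℝ => (v : ℂ) - (v : ℂ) ^ 2 / 2)]
    · push_cast; ring
    · intro v _
      have := (Complex.ofRealCLM.hasDerivAt (x := v))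
      simp only [Complex.ofRealCLM_apply] at this
      convert! this.sub ((this.pow 2).div_const 2) using 1
      simp
    · exact Continuous.intervalIntegrable (by fun_prop) _ _
    · intro v _
      have := (Complex.ofRealCLM.hasDerivAt (x := v))
      simp only [Complex.ofRealCLM_apply] at this
      convert! this.add ((this.pow 2).div_const 2) using 1
      simp
    · exact Continuous.intervalIntegrable (by fun_prop) _ _
  · have hpi := Real.pi_pos
    have hc0 : c ≠ 0 := by
      simp [hc, hw, hpi.ne']
    have hE : ∀ v : ℝ, HasDerivAt (fun v : ℝ => Complex.exp (c * v)) (Complex.exp (c * v) * c) v :=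
      fun v => by
        have := (Complex.ofRealCLM.hasDerivAt (x := v))
        simp only [Complex.ofRealCLM_apply] at this
        convert! (this.const_mul c).cexp using 1
        simp
    have hI : ∀ v : ℝ, HasDerivAt (fun v : ℝ => (v : ℂ)) 1 v := fun v => by
      simpa using (hasDerivAt_id v).ofReal_comp
    rw [intervalIntegral.integral_eq_sub_of_hasDerivAt
        (f := fun v : ℝ => (1 + (v : ℂ)) * Complex.exp (c * v) / c - Complex.exp (c * v) / c ^ 2),
      intervalIntegral.integral_eq_sub_of_hasDerivAt
        (f := fun v : ℝ => (1 - (v : ℂ)) * Complex.exp (c * v) / c + Complex.exp (c * v) / c ^ 2)]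
    · have hcos : Complex.exp c + Complex.exp (-c) = 2 * Real.cos (2 * Real.pi * w) := by
        rw [Complex.ofReal_cos, Complex.two_cos, hc, add_comm]
        congr 2 <;> push_cast <;> ring
      have hc2 : c ^ 2 = - ((2 * Real.pi * w : ℝ) : ℂ) ^ 2 := by
        rw [hc, mul_pow, Complex.I_sq]; push_cast; ring
      have : (1 + ((0 : ℝ) : ℂ)) * Complex.exp (c * (0 : ℝ)) / c - Complex.exp (c * (0 : ℝ)) / c ^ 2 -
          ((1 + ((-1 : ℝ) : ℂ)) * Complex.exp (c * (-1 : ℝ)) / c -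
            Complex.exp (c * (-1 : ℝ)) / c ^ 2) +
          ((1 - ((1 : ℝ) : ℂ)) * Complex.exp (c * (1 : ℝ)) / c + Complex.exp (c * (1 : ℝ)) / c ^ 2 -
          ((1 - ((0 : ℝ) : ℂ)) * Complex.exp (c * (0 : ℝ)) / c +
            Complex.exp (c * (0 : ℝ)) / c ^ 2)) =
          (Complex.exp c + Complex.exp (-c) - 2) / c ^ 2 := by
        push_cast
        simp only [mul_zero, Complex.exp_zero, mul_one, mul_neg]
        field_simp
        ring
      rw [this, hcos, hc2, fejer]
      have hw' : (w : ℂ) ≠ 0 := by exact_mod_cast hw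
      have hpi' : (Real.pi : ℂ) ≠ 0 := by exact_mod_cast hpi.ne'
      push_cast
      field_simp
      ring
    · intro v _
      convert! ((((hI v).const_sub 1).mul (hE v)).div_const c).add ((hE v).div_const (c ^ 2)) using 1
      field_simp
      ring
    · exact Continuous.intervalIntegrable (by fun_prop) _ _
    · intro v _
      convert! ((((hI v).const_add 1).mul (hE v)).div_const c).sub ((hE v).div_const (c ^ 2)) using 1
      field_simp
      ring
    · exact Continuous.intervalIntegrable (by fun_prop) _ _

/-- The Fourier transform of the Fejér kernel is the triangle function. -/
theorem integral_exp_mul_fejer (ξ : ℝ) :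
    ∫ u : ℝ, Complex.exp (-(u * ξ : ℝ) * Complex.I) * fejer u = ((max 0 (1 - |ξ|) : ℝ) : ℂ) := by
  set f : ℝ → ℂ := fun x => ((max 0 (1 - |x|) : ℝ) : ℂ) with hf
  have hpi := Real.pi_pos
  have hfc : Continuous f := by fun_prop
  have hsupp : HasCompactSupport f := by
    refine HasCompactSupport.intro (K := Set.Icc (-1) 1) isCompact_Icc fun x hx => ?_
    have : 1 - |x| ≤ 0 := by
      by_contra h
      exact hx (abs_le.1 (by linarith : |x| ≤ 1))
    simp [hf, max_eq_left this]
  have hfi : MeasureTheory.Integrable f := hfc.integrable_of_hasCompactSupport hsupp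
  have hae : FourierTransform.fourier f =ᵐ[MeasureTheory.volume]
      fun w => ((2 * Real.pi * fejer (2 * Real.pi * w) : ℝ) : ℂ) := by
    have : ∀ᵐ w : ℝ, w ≠ 0 := by simp [MeasureTheory.ae_iff]
    filter_upwards [this] with w hw
    rw [hf, fourier_triangle, if_neg hw]
  have hint : MeasureTheory.Integrable
      (fun w : ℝ => ((2 * Real.pi * fejer (2 * Real.pi * w) : ℝ) : ℂ)) :=
    ((integrable_fejer.comp_mul_left' (by positivity)).const_mul (2 * Real.pi)).ofReal
  have hinv := hfi.fourierInv_fourier_eq (hint.congr hae.symm) (v := -ξ) hfc.continuousAt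
  rw [Real.fourierInv_eq'] at hinv
  have h1 : ∫ v : ℝ, Complex.exp (((2 * Real.pi * inner ℝ v (-ξ) : ℝ) : ℂ) * Complex.I) •
      FourierTransform.fourier f v = ∫ v : ℝ, (2 * Real.pi : ℝ) •
        (fun u : ℝ => Complex.exp (-(u * ξ : ℝ) * Complex.I) * (fejer u : ℂ)) (2 * Real.pi * v) := by
    refine MeasureTheory.integral_congr_ae ?_
    filter_upwards [hae] with v hv
    rw [hv]
    have e2 : (2 * Real.pi * inner ℝ v (-ξ) : ℝ) = -(2 * Real.pi * v * ξ) := by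
      simp; ring
    rw [e2]
    simp only [smul_eq_mul, Complex.real_smul]
    push_cast
    ring
  rw [h1, MeasureTheory.integral_smul, MeasureTheory.Measure.integral_comp_mul_left
    (fun u : ℝ => Complex.exp (-(u * ξ : ℝ) * Complex.I) * (fejer u : ℂ)) (2 * Real.pi), smul_smul,
    abs_of_pos (by positivity), mul_inv_cancel₀ (by positivity), one_smul] at hinv
  rw [hinv, hf]
  simp

theorem integral_fejer : ∫ u : ℝ, fejer u = 1 := by
  have := integral_exp_mul_fejer 0
  simp only [mul_zero, Complex.ofReal_zero, neg_zero, zero_mul, Complex.exp_zero, one_mul,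
    abs_zero, sub_zero] at this
  rw [integral_complex_ofReal] at this
  have h2 : max (0 : ℝ) 1 = 1 := max_eq_right zero_le_one
  rw [h2] at this
  exact_mod_cast this

/-! ### Fejér means of Dirichlet series -/

/-- The Fejér weight `(1 - log n / R)₊`. -/
noncomputable def fejerWeight (R : ℝ) (n : ℕ) : ℝ := max 0 (1 - Real.log n / R)

theorem fejerWeight_nonneg (R : ℝ) (n : ℕ) : 0 ≤ fejerWeight R n := le_max_left _ _

theorem fejerWeight_le_one {R : ℝ} (hR : 0 < R) (n : ℕ) : fejerWeight R n ≤ 1 :=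
  max_le zero_le_one (by
    have : 0 ≤ Real.log n / R := div_nonneg (Real.log_natCast_nonneg n) hR.le
    linarith)

theorem fejerWeight_eq_zero {R : ℝ} (hR : 0 < R) {n : ℕ} (hn : Real.exp R ≤ n) :
    fejerWeight R n = 0 := by
  refine max_eq_left ?_
  have h1 : R ≤ Real.log n := (Real.le_log_iff_exp_le ((Real.exp_pos R).trans_le hn)).2 hn
  have := (one_le_div hR).2 h1
  linarith

theorem term_add_mul_I (a : ℕ → ℂ) (s : ℂ) (v : ℝ) (n : ℕ) :
    LSeries.term a (s + v * Complex.I) n =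
      LSeries.term a s n * Complex.exp (-(v * Real.log n : ℝ) * Complex.I) := by
  rcases eq_or_ne n 0 with rfl | hn
  · simp
  rw [LSeries.term_of_ne_zero hn, LSeries.term_of_ne_zero hn,
    Complex.cpow_add _ _ (by exact_mod_cast hn), div_mul_eq_div_div, div_eq_mul_inv (a n / _)]
  congr 1
  rw [Complex.cpow_def_of_ne_zero (by exact_mod_cast hn), ← Complex.exp_neg,
    ← Complex.natCast_log]
  congr 1
  push_cast
  ring

/-- Averaging a Dirichlet series against the Fejér kernel along a vertical line truncates it. -/
theorem integral_LSeries_mul_fejer {a : ℕ → ℂ} {s : ℂ} (hs : LSeriesSummable a s) {R : ℝ}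
    (hR : 0 < R) {N : ℕ} (hN : Real.exp R ≤ N) :
    ∫ u : ℝ, LSeries a (s + (u / R : ℝ) * Complex.I) * fejer u =
      ∑ n ∈ Finset.range N, LSeries.term a s n * fejerWeight R n := by
  set F : ℕ → ℝ → ℂ := fun n u => LSeries.term a s n *
    (Complex.exp (-(u * (Real.log n / R) : ℝ) * Complex.I) * fejer u) with hF
  have hnorm : ∀ n u, ‖F n u‖ = ‖LSeries.term a s n‖ * fejer u := fun n u => by
    rw [hF]
    simp only [norm_mul]
    rw [Complex.norm_real, Real.norm_of_nonneg (fejer_nonneg u),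
      show (-((u * (Real.log n / R) : ℝ) : ℂ)) = ((-(u * (Real.log n / R)) : ℝ) : ℂ) by
        push_cast; ring, Complex.norm_exp_ofReal_mul_I, one_mul]
  have hmeas : ∀ n, MeasureTheory.AEStronglyMeasurable (F n) := fun n => by
    refine (measurable_const.mul (Measurable.mul ?_
      (Complex.measurable_ofReal.comp measurable_fejer))).aestronglyMeasurable
    exact Continuous.measurable (by fun_prop)
  have hint : ∀ n, MeasureTheory.Integrable (F n) := fun n =>
    (integrable_fejer.const_mul ‖LSeries.term a s n‖).mono' (hmeas n)
      (Filter.Eventually.of_forall fun u => (hnorm n u).le)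
  have hval : ∀ n, ∫ u, F n u = LSeries.term a s n * fejerWeight R n := fun n => by
    rw [hF]
    simp only
    rw [MeasureTheory.integral_const_mul, integral_exp_mul_fejer, fejerWeight,
      abs_of_nonneg (div_nonneg (Real.log_natCast_nonneg n) hR.le)]
  have hsum : Summable fun n => ∫ u, ‖F n u‖ := by
    simp_rw [hnorm, MeasureTheory.integral_const_mul, integral_fejer, mul_one]
    exact hs.norm
  have h1 := (MeasureTheory.hasSum_integral_of_summable_integral_norm hint hsum).tsum_eq
  have h2 : ∀ u : ℝ, LSeries a (s + (u / R : ℝ) * Complex.I) * fejer u = ∑' n, F n u := fun u => by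
    rw [LSeries, ← tsum_mul_right]
    refine tsum_congr fun n => ?_
    rw [term_add_mul_I, hF]
    simp only
    rw [mul_assoc]
    congr 4
    push_cast
    ring
  simp_rw [h2]
  rw [← h1]
  simp_rw [hval]
  refine tsum_eq_sum fun n hn => ?_
  rw [Finset.mem_range, not_lt] at hn
  rw [fejerWeight_eq_zero hR (hN.trans (by exact_mod_cast hn))]
  simp

/-- Logarithmic growth of `U` along the vertical line through `s`, in the form in which it is
integrated against the Fejér kernel. -/
theorem norm_shift_le {U : ℂ → ℂ} {h K : ℝ} (hK : 0 < K)
    (hUK : ∀ s : ℂ, 1 / 2 + h ≤ s.re → ‖U s‖ ≤ K * Real.log (2 + ‖s‖)) {s : ℂ}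
    (hs : 1 / 2 + h ≤ s.re) {R : ℝ} (hR : 1 ≤ R) (u : ℝ) :
    ‖U (s + (u / R : ℝ) * Complex.I)‖ ≤ K * Real.log (4 + ‖s‖) * (1 + Real.log (1 + |u|)) := by
  have hre : (s + (u / R : ℝ) * Complex.I).re = s.re := by simp
  refine (hUK _ (by rw [hre]; exact hs)).trans ?_
  rw [mul_assoc]
  refine mul_le_mul_of_nonneg_left ?_ hK.le
  have h1 : ‖s + (u / R : ℝ) * Complex.I‖ ≤ ‖s‖ + |u| := by
    refine (norm_add_le _ _).trans ?_
    rw [norm_mul, Complex.norm_I, mul_one, Complex.norm_real, Real.norm_eq_abs, abs_div,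
      abs_of_pos (by linarith : 0 < R)]
    gcongr
    exact div_le_self (abs_nonneg u) hR
  have h2 : 0 ≤ Real.log (1 + |u|) := Real.log_nonneg (by linarith [abs_nonneg u])
  have h3 : 1 ≤ Real.log (4 + ‖s‖) := by
    rw [Real.le_log_iff_exp_le (by positivity)]
    linarith [Real.exp_one_lt_d9, norm_nonneg s]
  calc Real.log (2 + ‖s + (u / R : ℝ) * Complex.I‖) ≤ Real.log ((4 + ‖s‖) * (1 + |u|)) := by
        refine Real.log_le_log (by positivity) ?_
        nlinarith [norm_nonneg s, abs_nonneg u, mul_nonneg (norm_nonneg s) (abs_nonneg u)]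
    _ = Real.log (4 + ‖s‖) + Real.log (1 + |u|) :=
        Real.log_mul (by positivity) (by positivity)
    _ ≤ _ := by nlinarith

section FejerMean

variable {U : ℂ → ℂ} (hUd : DifferentiableOn ℂ U {s | 1 / 2 < s.re})
  (hgrow : ∀ h : ℝ, 0 < h → h ≤ 1 → ∃ K : ℝ, 0 < K ∧
    ∀ s : ℂ, 1 / 2 + h ≤ s.re → ‖U s‖ ≤ K * Real.log (2 + ‖s‖))
include hUd

theorem continuous_shift {s : ℂ} (hs : 1 / 2 < s.re) (R : ℝ) :
    Continuous fun u : ℝ => U (s + (u / R : ℝ) * Complex.I) :=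
  hUd.continuousOn.comp_continuous (by fun_prop) fun u => by simpa using hs

include hgrow

theorem integrable_shift_mul_fejer {s : ℂ} (hs : 1 / 2 < s.re) {R : ℝ} (hR : 1 ≤ R) :
    MeasureTheory.Integrable fun u : ℝ => U (s + (u / R : ℝ) * Complex.I) * fejer u := by
  obtain ⟨K, hK, hUK⟩ := hgrow (min 1 (s.re - 1 / 2)) (by simp; linarith) (min_le_left _ _)
  exact integrable_mul_fejer (continuous_shift hUd hs R).aestronglyMeasurable
    (norm_shift_le hK hUK (by linarith [min_le_right 1 (s.re - 1 / 2)]) hR)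

/-- Fejér means along vertical lines are holomorphic in the base point; Cauchy estimates dominate
the derivative. -/
theorem differentiableOn_integral_shift_mul_fejer {R : ℝ} (hR : 1 ≤ R) :
    DifferentiableOn ℂ (fun s => ∫ u : ℝ, U (s + (u / R : ℝ) * Complex.I) * fejer u)
      {s | 1 / 2 < s.re} := by
  intro s₀ hs₀
  have hs₀' : 1 / 2 < s₀.re := hs₀
  set h : ℝ := min 1 ((s₀.re - 1 / 2) / 3) with hh
  have hpos : 0 < h := by rw [hh]; simp; linarith
  have h1 : h ≤ 1 := min_le_left _ _
  have h3 : 3 * h ≤ s₀.re - 1 / 2 := by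
    have := min_le_right 1 ((s₀.re - 1 / 2) / 3)
    linarith
  obtain ⟨K, hK, hUK⟩ := hgrow h hpos h1
  have hball : ∀ s ∈ Metric.ball s₀ h, 1 / 2 + 2 * h ≤ s.re := fun s hs => by
    rw [Metric.mem_ball, dist_eq_norm] at hs
    have := (abs_le.1 (Complex.abs_re_le_norm (s - s₀))).1
    rw [Complex.sub_re] at this
    linarith
  have hd' : DifferentiableOn ℂ (deriv U) {s | 1 / 2 < s.re} := hUd.deriv isOpen_half_lt_re
  have hderiv : ∀ s ∈ Metric.ball s₀ h, ∀ u : ℝ, ‖deriv U (s + (u / R : ℝ) * Complex.I)‖ ≤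
      K * Real.log (6 + ‖s₀‖) / h * (1 + Real.log (1 + |u|)) := fun s hs u => by
    have hb := hball s hs
    have hclosed : ∀ z ∈ Metric.closedBall s h, 1 / 2 + h ≤ z.re := fun z hz => by
      rw [Metric.mem_closedBall, dist_eq_norm] at hz
      have := (abs_le.1 (Complex.abs_re_le_norm (z - s))).1
      rw [Complex.sub_re] at this
      linarith
    have e : deriv U (s + (u / R : ℝ) * Complex.I) =
        deriv (fun z => U (z + (u / R : ℝ) * Complex.I)) s := by
      rw [deriv_comp_add_const]
    rw [e, div_mul_eq_mul_div]
    refine Complex.norm_deriv_le_of_forall_mem_sphere_norm_le hpos ?_ fun z hz => ?_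
    · refine DifferentiableOn.diffContOnCl ?_
      rw [closure_ball s hpos.ne']
      refine hUd.comp (by fun_prop) fun z hz => ?_
      have := hclosed z hz
      simp only [Set.mem_ofPred_eq, Complex.add_re, Complex.mul_re, Complex.ofReal_re, Complex.I_re,
        mul_zero, Complex.ofReal_im, Complex.I_im, mul_one, sub_self, add_zero]
      linarith
    · refine (norm_shift_le hK hUK (hclosed z (Metric.sphere_subset_closedBall hz)) hR u).trans ?_
      have hz' : ‖z‖ ≤ ‖s₀‖ + 2 := by
        rw [mem_sphere_iff_norm] at hz
        rw [Metric.mem_ball, dist_eq_norm] at hs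
        have e1 : z = (z - s) + (s - s₀) + s₀ := by ring
        calc ‖z‖ = ‖(z - s) + (s - s₀) + s₀‖ := by rw [← e1]
          _ ≤ ‖z - s‖ + ‖s - s₀‖ + ‖s₀‖ := norm_add₃_le
          _ ≤ _ := by linarith
      have h2 : 0 ≤ Real.log (1 + |u|) := Real.log_nonneg (by linarith [abs_nonneg u])
      exact mul_le_mul_of_nonneg_right (mul_le_mul_of_nonneg_left
        (Real.log_le_log (by positivity) (by linarith)) hK.le) (by linarith)
  have hb2 : ∀ u : ℝ, ∀ s ∈ Metric.ball s₀ h, 1 / 2 < (s + (u / R : ℝ) * Complex.I).re :=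
    fun u s hs => by
      have := hball s hs
      simp only [Complex.add_re, Complex.mul_re, Complex.ofReal_re, Complex.I_re,
        mul_zero, Complex.ofReal_im, Complex.I_im, mul_one, sub_self, add_zero]
      linarith
  have key := hasDerivAt_integral_of_dominated_loc_of_deriv_le (μ := MeasureTheory.volume)
    (F := fun s (u : ℝ) => U (s + (u / R : ℝ) * Complex.I) * fejer u)
    (F' := fun s (u : ℝ) => deriv U (s + (u / R : ℝ) * Complex.I) * fejer u)
    (bound := fun u => K * Real.log (6 + ‖s₀‖) / h * (fejer u * (1 + Real.log (1 + |u|))))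
    (x₀ := s₀) (s := Metric.ball s₀ h) (Metric.ball_mem_nhds s₀ hpos) ?_ ?_ ?_ ?_ ?_ ?_
  · exact key.2.differentiableAt.differentiableWithinAt
  · filter_upwards [isOpen_half_lt_re.mem_nhds hs₀] with s hs
    exact (integrable_shift_mul_fejer hUd hgrow hs hR).aestronglyMeasurable
  · exact integrable_shift_mul_fejer hUd hgrow hs₀ hR
  · refine Continuous.aestronglyMeasurable ?_ |>.mul
      (Complex.measurable_ofReal.comp measurable_fejer).aestronglyMeasurable
    exact hd'.continuousOn.comp_continuous (by fun_prop) fun u => by simpa using hs₀'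
  · refine Filter.Eventually.of_forall fun u s hs => ?_
    rw [norm_mul, Complex.norm_real, Real.norm_of_nonneg (fejer_nonneg u)]
    have := mul_le_mul_of_nonneg_right (hderiv s hs u) (fejer_nonneg u)
    linarith
  · exact integrable_fejer_mul_log.const_mul _
  · refine Filter.Eventually.of_forall fun u s hs => ?_
    have hU := (hUd.differentiableAt (isOpen_half_lt_re.mem_nhds (hb2 u s hs))).hasDerivAt
    exact (HasDerivAt.comp_add_const s _ hU).mul_const _

/-- Fejér means recover the function as the window shrinks. -/
theorem tendsto_integral_shift_mul_fejer {s : ℂ} (hs : 1 / 2 < s.re) :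
    Filter.Tendsto (fun R : ℝ => ∫ u : ℝ, U (s + (u / R : ℝ) * Complex.I) * fejer u) Filter.atTop
      (nhds (U s)) := by
  obtain ⟨K, hK, hUK⟩ := hgrow (min 1 (s.re - 1 / 2)) (by simp; linarith) (min_le_left _ _)
  have hlim : ∫ u : ℝ, U s * fejer u = U s := by
    rw [MeasureTheory.integral_const_mul, integral_complex_ofReal, integral_fejer]; simp
  rw [← hlim]
  refine MeasureTheory.tendsto_integral_filter_of_dominated_convergence
    (fun u => K * Real.log (4 + ‖s‖) * (fejer u * (1 + Real.log (1 + |u|)))) ?_ ?_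
    (integrable_fejer_mul_log.const_mul _) ?_
  · filter_upwards [Filter.eventually_ge_atTop 1] with R hR
    exact (integrable_shift_mul_fejer hUd hgrow hs hR).aestronglyMeasurable
  · filter_upwards [Filter.eventually_ge_atTop 1] with R hR
    refine Filter.Eventually.of_forall fun u => ?_
    rw [norm_mul, Complex.norm_real, Real.norm_of_nonneg (fejer_nonneg u)]
    have := mul_le_mul_of_nonneg_right (norm_shift_le hK hUK
      (by linarith [min_le_right 1 (s.re - 1 / 2)] : _ ≤ s.re) hR u) (fejer_nonneg u)
    linarith
  · refine Filter.Eventually.of_forall fun u => ?_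
    refine Filter.Tendsto.mul_const _ ?_
    have hc : ContinuousAt U s := hUd.continuousOn.continuousAt (isOpen_half_lt_re.mem_nhds hs)
    refine hc.tendsto.comp ?_
    have h1 : Filter.Tendsto (fun R : ℝ => u / R) Filter.atTop (nhds 0) :=
      Filter.Tendsto.const_div_atTop Filter.tendsto_id u
    have h2 : Filter.Tendsto (fun R : ℝ => ((u / R : ℝ) : ℂ)) Filter.atTop (nhds ((0 : ℝ) : ℂ)) :=
      (Complex.continuous_ofReal.tendsto 0).comp h1
    have h3 := (h2.mul_const Complex.I).const_add s
    simpa using h3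

/-- The truncated Dirichlet series equals the Fejér mean of its continuation `U`, also to the left
of the half-plane of absolute convergence. -/
theorem fejer_sum_eq_integral {a : ℕ → ℂ} (hsum : ∀ s : ℂ, 1 < s.re → LSeriesSummable a s)
    (hU : ∀ s : ℂ, 1 < s.re → U s = LSeries a s) {s : ℂ} (hs : 1 / 2 < s.re) {R : ℝ} (hR : 1 ≤ R)
    {N : ℕ} (hN : Real.exp R ≤ N) :
    ∑ n ∈ Finset.range N, LSeries.term a s n * fejerWeight R n =
      ∫ u : ℝ, U (s + (u / R : ℝ) * Complex.I) * fejer u := by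
  refine eq_of_eq_on_one_lt_re (c := 1 / 2)
    (f := fun s => ∑ n ∈ Finset.range N, LSeries.term a s n * fejerWeight R n) ?_
    (differentiableOn_integral_shift_mul_fejer hUd hgrow hR) ?_ hs
  · refine DifferentiableOn.fun_sum fun n _ => ?_
    intro z _
    exact ((LSeries.hasDerivAt_term a n z).mul_const _).differentiableAt.differentiableWithinAt
  · intro z hz
    rw [← integral_LSeries_mul_fejer (hsum z hz) (by linarith) hN]
    refine MeasureTheory.integral_congr_ae (Filter.Eventually.of_forall fun u => ?_)
    simp only
    rw [hU _ (by simpa using hz)]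

end FejerMean

/-! ### Upper bounds by short Dirichlet polynomials -/

/-- The first logarithmic moment `∫ (1 + log (1 + |u|)) fejer u du`. -/
noncomputable def fejerLogMoment : ℝ := ∫ u, fejer u * (1 + Real.log (1 + |u|))

theorem fejerLogMoment_nonneg : 0 ≤ fejerLogMoment :=
  MeasureTheory.integral_nonneg fun u => mul_nonneg (fejer_nonneg u)
    (by linarith [Real.log_nonneg (by linarith [abs_nonneg u] : 1 ≤ 1 + |u|)])

theorem nonneg_of_hasDerivAt_of_le {φ : ℝ → ℝ} {c r : ℝ} (hr : 0 < r) (hφ : HasDerivAt φ c 0)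
    (h : ∀ δ, 0 < δ → δ ≤ r → φ 0 ≤ φ δ) : 0 ≤ c := by
  have h1 : Filter.Tendsto (slope φ 0) (nhdsWithin 0 (Set.Ioi 0)) (nhds c) :=
    (hasDerivAt_iff_tendsto_slope.1 hφ).mono_left
      (nhdsWithin_mono 0 fun x hx => (Set.mem_Ioi.1 hx).ne')
  refine ge_of_tendsto h1 ?_
  have h2 : ∀ᶠ δ : ℝ in nhdsWithin 0 (Set.Ioi 0), δ < r :=
    nhdsWithin_le_nhds (Iio_mem_nhds hr)
  filter_upwards [h2, self_mem_nhdsWithin] with δ hδ hδ0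
  have hδ0' : 0 < δ := hδ0
  rw [slope_def_field]
  exact div_nonneg (by linarith [h δ hδ0' hδ.le]) (by linarith)

section MainInequality

variable {U : ℂ → ℂ} (hUd : DifferentiableOn ℂ U {s | 1 / 2 < s.re})
  (hgrow : ∀ h : ℝ, 0 < h → h ≤ 1 → ∃ K : ℝ, 0 < K ∧
    ∀ s : ℂ, 1 / 2 + h ≤ s.re → ‖U s‖ ≤ K * Real.log (2 + ‖s‖))
  {a : ℕ → ℂ} (hsum : ∀ s : ℂ, 1 < s.re → LSeriesSummable a s)
  (hU : ∀ s : ℂ, 1 < s.re → U s = LSeries a s)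
  {s : ℂ} (hs : 1 / 2 < s.re) {B₀ B₁ : ℝ} (hB₀ : 0 ≤ B₀) (hB₁ : 0 ≤ B₁)
  (hmono : ∀ δ : ℝ, 0 < δ → δ ≤ 1 / 2 → ∀ v : ℝ,
    (U (s + v * Complex.I)).re - (U (s + v * Complex.I + δ)).re ≤
      δ * (B₀ + B₁ * Real.log (2 + |s.im + v|)))
include hUd hgrow hsum hU hs hB₀ hB₁ hmono

omit hB₀ in
/-- A bound for the decrease of `Re U` to the left survives averaging against the nonnegative Fejér
kernel, hence passes to the truncated Dirichlet series. -/
theorem fejer_sum_sub_le {R : ℝ} (hR : 1 ≤ R) {N : ℕ} (hN : Real.exp R ≤ N) {δ : ℝ} (hδ : 0 < δ)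
    (hδ2 : δ ≤ 1 / 2) :
    (∑ n ∈ Finset.range N, LSeries.term a s n * fejerWeight R n).re -
      (∑ n ∈ Finset.range N, LSeries.term a (s + δ) n * fejerWeight R n).re ≤
      δ * (B₀ + B₁ * (Real.log (2 + |s.im|) + fejerLogMoment)) := by
  have hs2 : 1 / 2 < (s + δ).re := by simp; linarith
  have i1 := integrable_shift_mul_fejer hUd hgrow hs hR
  have i2 := integrable_shift_mul_fejer hUd hgrow hs2 hR
  rw [fejer_sum_eq_integral hUd hgrow hsum hU hs hR hN,
    fejer_sum_eq_integral hUd hgrow hsum hU hs2 hR hN, ← Complex.sub_re,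
    ← MeasureTheory.integral_sub i1 i2]
  have h1 := Complex.reCLM.integral_comp_comm (i1.sub i2)
  simp only [Complex.reCLM_apply, Pi.sub_apply] at h1
  rw [← h1]
  have hint : MeasureTheory.Integrable fun u : ℝ => δ * ((B₀ + B₁ * Real.log (2 + |s.im|)) *
      fejer u + B₁ * (fejer u * (1 + Real.log (1 + |u|)))) :=
    ((integrable_fejer.const_mul _).add (integrable_fejer_mul_log.const_mul _)).const_mul _
  refine (MeasureTheory.integral_mono (i1.sub i2).re hint fun u => ?_).trans (le_of_eq ?_)
  · have e1 : s + δ + (u / R : ℝ) * Complex.I = s + (u / R : ℝ) * Complex.I + δ := by ring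
    have h2 := hmono δ hδ hδ2 (u / R)
    have h3 : Real.log (2 + |s.im + u / R|) ≤ Real.log (2 + |s.im|) + Real.log (1 + |u|) := by
      rw [← Real.log_mul (by positivity) (by positivity)]
      refine Real.log_le_log (by positivity) ?_
      have : |u / R| ≤ |u| := by
        rw [abs_div, abs_of_pos (by linarith : 0 < R)]
        exact div_le_self (abs_nonneg u) hR
      nlinarith [abs_add_le s.im (u / R), abs_nonneg s.im, abs_nonneg u,
        mul_nonneg (abs_nonneg s.im) (abs_nonneg u)]
    have h4 := fejer_nonneg u
    change ((U (s + (u / R : ℝ) * Complex.I) * fejer u -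
      U (s + δ + (u / R : ℝ) * Complex.I) * fejer u : ℂ)).re ≤ _
    rw [e1, ← sub_mul, Complex.re_mul_ofReal, Complex.sub_re]
    calc _ ≤ δ * (B₀ + B₁ * Real.log (2 + |s.im + u / R|)) * fejer u := by gcongr
      _ ≤ δ * (B₀ + B₁ * (Real.log (2 + |s.im|) + (1 + Real.log (1 + |u|)))) * fejer u := by
          gcongr; linarith
      _ = _ := by ring
  · rw [MeasureTheory.integral_const_mul, MeasureTheory.integral_add
      (integrable_fejer.const_mul _) (integrable_fejer_mul_log.const_mul _),
      MeasureTheory.integral_const_mul, MeasureTheory.integral_const_mul, integral_fejer,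
      fejerLogMoment]
    ring

omit hB₀ in
/-- Positivity of the Fejér kernel bounds the truncated logarithmic derivative from above. -/
theorem fejer_logMul_sum_le {R : ℝ} (hR : 1 ≤ R) {N : ℕ} (hN : Real.exp R ≤ N) :
    (∑ n ∈ Finset.range N, LSeries.term a s n * fejerWeight R n * Real.log n).re ≤
      B₀ + B₁ * (Real.log (2 + |s.im|) + fejerLogMoment) := by
  set B := B₀ + B₁ * (Real.log (2 + |s.im|) + fejerLogMoment)
  set Q : ℂ → ℂ := fun z => ∑ n ∈ Finset.range N, LSeries.term a z n * fejerWeight R n with hQ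
  have hQd : HasDerivAt Q (-∑ n ∈ Finset.range N,
      LSeries.term a s n * fejerWeight R n * Real.log n) s := by
    rw [hQ, ← Finset.sum_neg_distrib]
    refine HasDerivAt.fun_sum fun n _ => ?_
    have := (LSeries.hasDerivAt_term a n s).mul_const (fejerWeight R n : ℂ)
    convert! this using 1
    rcases eq_or_ne n 0 with rfl | hn
    · simp
    · rw [LSeries.term_of_ne_zero hn, LSeries.term_of_ne_zero hn, LSeries.logMul,
        Complex.natCast_log]
      ring
  have h1 : HasDerivAt (fun δ : ℝ => Q (s + δ)) (-∑ n ∈ Finset.range N,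
      LSeries.term a s n * fejerWeight R n * Real.log n) 0 := by
    have e : HasDerivAt (fun z : ℂ => Q (s + z)) (-∑ n ∈ Finset.range N,
        LSeries.term a s n * fejerWeight R n * Real.log n) ((0 : ℝ) : ℂ) :=
      HasDerivAt.comp_const_add s _ (by simpa using hQd)
    exact e.comp_ofReal
  have h2 : HasDerivAt (fun δ : ℝ => (Q (s + δ)).re + δ * B) ((-∑ n ∈ Finset.range N,
      LSeries.term a s n * fejerWeight R n * Real.log n).re + 1 * B) 0 := by
    refine HasDerivAt.add ?_ ((hasDerivAt_id' (0 : ℝ)).mul_const B)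
    have := Complex.reCLM.hasFDerivAt.comp_hasDerivAt (0 : ℝ) h1
    exact this
  have h3 := nonneg_of_hasDerivAt_of_le (r := 1 / 2) (by norm_num) h2 fun δ hδ hδ2 => by
    have := fejer_sum_sub_le hUd hgrow hsum hU hs hB₁ hmono hR hN hδ hδ2
    simp only [hQ]
    simp only [Complex.ofReal_zero, add_zero, zero_mul]
    linarith
  rw [Complex.neg_re] at h3
  linarith

omit hUd hgrow hsum hU hs hB₀ hB₁ hmono in
theorem hasDerivAt_max_zero_sq (x : ℝ) : HasDerivAt (fun y : ℝ => (max 0 y) ^ 2) (2 * max 0 x) x := by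
  rcases lt_trichotomy x 0 with h | h | h
  · rw [max_eq_left h.le, mul_zero]
    refine (hasDerivAt_const x (0 : ℝ)).congr_of_eventuallyEq ?_
    filter_upwards [Iio_mem_nhds h] with y hy
    simp [max_eq_left (Set.mem_Iio.1 hy).le]
  · subst h
    rw [max_self, mul_zero, hasDerivAt_iff_isLittleO_nhds_zero]
    simp only [zero_add, max_self, smul_zero, sub_zero]
    refine Asymptotics.IsBigO.trans_isLittleO (g := fun h : ℝ => h ^ 2) ?_ ?_
    · refine Asymptotics.IsBigO.of_bound 1 (Filter.Eventually.of_forall fun y => ?_)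
      rw [one_mul, Real.norm_of_nonneg (sq_nonneg y), zero_pow two_ne_zero, sub_zero,
        Real.norm_of_nonneg (sq_nonneg _)]
      rcases le_total 0 y with h | h
      · rw [max_eq_right h]
      · rw [max_eq_left h]; simpa using sq_nonneg y
    · exact Asymptotics.isLittleO_pow_id one_lt_two
  · rw [max_eq_right h.le]
    have := (hasDerivAt_id' x).pow 2
    simp only [Nat.cast_ofNat, Nat.add_one_sub_one, pow_one, mul_one] at this
    refine this.congr_of_eventuallyEq ?_
    filter_upwards [Ioi_mem_nhds h] with y hy
    simp [max_eq_right (le_of_lt (Set.mem_Ioi.1 hy))]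

omit hUd hgrow hsum hU hs hB₀ hB₁ hmono in
theorem hasDerivAt_fejerWeight_sq {R : ℝ} (hR : 0 < R) (n : ℕ) :
    HasDerivAt (fun R => fejerWeight R n ^ 2) (2 / R ^ 2 * (fejerWeight R n * Real.log n)) R := by
  have h1 : HasDerivAt (fun R : ℝ => 1 - Real.log n / R) (Real.log n / R ^ 2) R := by
    have := ((hasDerivAt_inv hR.ne').const_mul (Real.log n)).const_sub 1
    convert! this using 1
    field_simp
  have := (hasDerivAt_max_zero_sq (1 - Real.log n / R)).comp R h1
  convert! this using 1
  rw [fejerWeight]; ring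

omit hUd hgrow hsum hU hs hB₀ hB₁ hmono in
theorem hasDerivAt_sq_mul_fejerWeight_sq {R : ℝ} (hR : 0 < R) (n : ℕ) :
    HasDerivAt (fun R => R ^ 2 * fejerWeight R n ^ 2) (2 * R * fejerWeight R n) R := by
  have h := ((hasDerivAt_id' R).pow 2).mul (hasDerivAt_fejerWeight_sq hR n)
  convert! h using 1
  simp only [Nat.cast_ofNat, Nat.add_one_sub_one, pow_one, mul_one, Pi.pow_apply]
  rcases le_total 0 (1 - Real.log n / R) with h1 | h1
  · rw [fejerWeight, max_eq_right h1]; field_simp; ring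
  · rw [fejerWeight, max_eq_left h1]; ring

/-- **Upper bound by a short Dirichlet polynomial.** If `Re U` decreases at a controlled rate to the
left, then `Re U(s)` is at most the Riesz mean of length `e^R` of the Dirichlet series of `U`, up to
the rate divided by `R`. The Riesz mean `p(R)` satisfies `p'(R) ≤ 2 B / R ^ 2` by
`fejer_logMul_sum_le` and tends to `Re U(s)`, being itself an average of Fejér means. -/
theorem re_le_riesz_sum {R : ℝ} (hR : 1 ≤ R) {N : ℕ} (hN : Real.exp R ≤ N) :
    (U s).re ≤ (∑ n ∈ Finset.range N, LSeries.term a s n * (fejerWeight R n ^ 2 : ℝ)).re +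
      2 * (B₀ + B₁ * (Real.log (2 + |s.im|) + fejerLogMoment)) / R := by
  set B := B₀ + B₁ * (Real.log (2 + |s.im|) + fejerLogMoment) with hB
  have hB0 : 0 ≤ B := by
    have := (log_two_add_pos (abs_nonneg s.im)).le
    have := fejerLogMoment_nonneg
    positivity
  set p : ℕ → ℝ → ℝ := fun M r =>
    ∑ n ∈ Finset.range M, (LSeries.term a s n).re * fejerWeight r n ^ 2 with hp
  set q : ℕ → ℝ → ℝ := fun M r =>
    ∑ n ∈ Finset.range M, (LSeries.term a s n).re * fejerWeight r n with hq
  have hpre : ∀ M r, (∑ n ∈ Finset.range M, LSeries.term a s n * (fejerWeight r n ^ 2 : ℝ)).re =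
      p M r := fun M r => by
    rw [Complex.re_sum]
    exact Finset.sum_congr rfl fun n _ => Complex.re_mul_ofReal _ _
  have hqre : ∀ M r, (∑ n ∈ Finset.range M, LSeries.term a s n * fejerWeight r n).re = q M r :=
    fun M r => by
      rw [Complex.re_sum]
      exact Finset.sum_congr rfl fun n _ => Complex.re_mul_ofReal _ _
  have hpN : ∀ M, N ≤ M → p M R = p N R := fun M hM => by
    refine (Finset.sum_subset (Finset.range_mono hM) fun n _ hn => ?_).symm
    rw [Finset.mem_range, not_lt] at hn
    rw [fejerWeight_eq_zero (by linarith) (hN.trans (by exact_mod_cast hn))]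
    simp
  -- The function `p(r) + 2 B / r` decreases.
  have hanti : ∀ M : ℕ, ∀ A : ℝ, R ≤ A → Real.exp A ≤ M → p M A ≤ p M R + 2 * B / R := by
    intro M A hA hM
    have hd : ∀ r ∈ Set.Icc R A, HasDerivAt (fun r => p M r + 2 * B * r⁻¹)
        (2 / r ^ 2 * ((∑ n ∈ Finset.range M,
          LSeries.term a s n * fejerWeight r n * Real.log n).re - B)) r := fun r hr => by
      have hr0 : 0 < r := by linarith [hr.1]
      have h1 : HasDerivAt (p M) (∑ n ∈ Finset.range M, (LSeries.term a s n).re *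
          (2 / r ^ 2 * (fejerWeight r n * Real.log n))) r :=
        HasDerivAt.fun_sum fun n _ => (hasDerivAt_fejerWeight_sq hr0 n).const_mul _
      have h2 := h1.add ((hasDerivAt_inv hr0.ne').const_mul (2 * B))
      convert! h2 using 1
      rw [mul_sub, Complex.re_sum, Finset.mul_sum, sub_eq_add_neg]
      congr 1
      · refine Finset.sum_congr rfl fun n _ => ?_
        rw [mul_assoc, ← Complex.ofReal_mul, Complex.re_mul_ofReal]
        ring
      · field_simp
    have hant : AntitoneOn (fun r => p M r + 2 * B * r⁻¹) (Set.Icc R A) := by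
      refine antitoneOn_of_deriv_nonpos (convex_Icc R A)
        (fun r hr => (hd r hr).continuousAt.continuousWithinAt)
        (fun r hr => (hd r (interior_subset hr)).differentiableAt.differentiableWithinAt)
        fun r hr => ?_
      have hr' := interior_subset hr
      rw [(hd r hr').deriv]
      have := fejer_logMul_sum_le hUd hgrow hsum hU hs hB₁ hmono (R := r)
        (by linarith [hr'.1]) (N := M) ((Real.exp_le_exp.2 hr'.2).trans hM)
      exact mul_nonpos_of_nonneg_of_nonpos (by positivity) (by linarith)
    have h3 := hant (Set.left_mem_Icc.2 hA) (Set.right_mem_Icc.2 hA) hA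
    simp only at h3
    have h4 : 0 ≤ 2 * B * A⁻¹ := by
      have : 0 < A := by linarith
      positivity
    rw [div_eq_mul_inv _ R]
    linarith
  rw [hpre]
  refine le_of_forall_pos_le_add fun η hη => ?_
  have hlim := (Complex.continuous_re.tendsto _).comp (tendsto_integral_shift_mul_fejer hUd hgrow hs)
  obtain ⟨A₀, hA₀⟩ := Filter.eventually_atTop.1
    (hlim.eventually (Ioi_mem_nhds (by linarith : (U s).re - η / 2 < (U s).re)))
  set A₁ := max A₀ R
  have hA₁ : 1 ≤ A₁ := hR.trans (le_max_right _ _)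
  set c : ℝ := (U s).re - η / 2
  -- The function `A ^ 2 (p(A) - c)` increases once the Fejér means exceed `c`.
  have hmonoA : ∀ M : ℕ, ∀ A : ℝ, A₁ ≤ A → Real.exp A ≤ M →
      A₁ ^ 2 * (p M A₁ - c) ≤ A ^ 2 * (p M A - c) := by
    intro M A hA hM
    have hd : ∀ r ∈ Set.Icc A₁ A, HasDerivAt (fun r => r ^ 2 * (p M r - c))
        (2 * r * (q M r - c)) r := fun r hr => by
      have hr0 : 0 < r := by linarith [hr.1]
      have h1 : HasDerivAt (fun r => ∑ n ∈ Finset.range M, (LSeries.term a s n).re *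
          (r ^ 2 * fejerWeight r n ^ 2)) (∑ n ∈ Finset.range M, (LSeries.term a s n).re *
          (2 * r * fejerWeight r n)) r :=
        HasDerivAt.fun_sum fun n _ => (hasDerivAt_sq_mul_fejerWeight_sq hr0 n).const_mul _
      have h2 := h1.sub (((hasDerivAt_id' r).pow 2).mul_const c)
      convert! h2 using 1
      · funext y
        simp only [hp, mul_sub, Finset.mul_sum, Pi.sub_apply, Pi.pow_apply]
        congr 1
        exact Finset.sum_congr rfl fun n _ => by ring
      · simp only [hq, mul_sub, Finset.mul_sum, Nat.cast_ofNat, Nat.add_one_sub_one, pow_one,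
          mul_one]
        congr 1
        exact Finset.sum_congr rfl fun n _ => by ring
    have hmon : MonotoneOn (fun r => r ^ 2 * (p M r - c)) (Set.Icc A₁ A) := by
      refine monotoneOn_of_deriv_nonneg (convex_Icc A₁ A)
        (fun r hr => (hd r hr).continuousAt.continuousWithinAt)
        (fun r hr => (hd r (interior_subset hr)).differentiableAt.differentiableWithinAt)
        fun r hr => ?_
      have hr' := interior_subset hr
      rw [(hd r hr').deriv]
      have h1 := hA₀ r ((le_max_left _ _).trans hr'.1)
      have h2 := fejer_sum_eq_integral hUd hgrow hsum hU hs (R := r) (hA₁.trans hr'.1) (N := M)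
        ((Real.exp_le_exp.2 hr'.2).trans hM)
      simp only [Function.comp_apply] at h1
      rw [← h2, hqre] at h1
      have : 0 ≤ r := by linarith [hr'.1]
      exact mul_nonneg (by linarith) (by linarith)
    exact hmon (Set.left_mem_Icc.2 hA) (Set.right_mem_Icc.2 hA) hA
  -- The value at `A₁` does not depend on the number of terms.
  set N₁ : ℕ := max N ⌈Real.exp A₁⌉₊
  have hN₁ : Real.exp A₁ ≤ N₁ := (Nat.le_ceil _).trans (by exact_mod_cast le_max_right _ _)
  have hpN₁ : ∀ M, N₁ ≤ M → p M A₁ = p N₁ A₁ := fun M hM => by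
    refine (Finset.sum_subset (Finset.range_mono hM) fun n _ hn => ?_).symm
    rw [Finset.mem_range, not_lt] at hn
    rw [fejerWeight_eq_zero (by linarith) (hN₁.trans (by exact_mod_cast hn))]
    simp
  set c₁ : ℝ := A₁ ^ 2 * (p N₁ A₁ - c)
  obtain ⟨A, hA1, hA2⟩ : ∃ A : ℝ, A₁ ≤ A ∧ -(η / 2) * A ^ 2 ≤ c₁ := by
    refine ⟨max A₁ (2 * |c₁| / η), le_max_left _ _, ?_⟩
    set A := max A₁ (2 * |c₁| / η)
    have h1 : 2 * |c₁| / η ≤ A := le_max_right _ _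
    have h2 : 1 ≤ A := hA₁.trans (le_max_left _ _)
    rw [div_le_iff₀ hη] at h1
    have h3 : A ≤ A ^ 2 := by nlinarith
    have h4 : A * η ≤ A ^ 2 * η := by gcongr
    linarith [neg_abs_le c₁]
  set M : ℕ := max N₁ ⌈Real.exp A⌉₊
  have hM : Real.exp A ≤ M := (Nat.le_ceil _).trans (by exact_mod_cast le_max_right _ _)
  have f1 := hmonoA M A hA1 hM
  rw [hpN₁ M (le_max_left _ _)] at f1
  have f2 := hanti M A ((le_max_right _ _).trans hA1) hM
  rw [hpN M ((le_max_left _ _).trans (le_max_left _ _))] at f2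
  have hA0 : 0 < A ^ 2 := by
    have : 0 < A := by linarith
    positivity
  have f3 : -(η / 2) ≤ p M A - c := by
    by_contra hcon
    push Not at hcon
    have := mul_lt_mul_of_pos_left hcon hA0
    have : c₁ = A₁ ^ 2 * (p N₁ A₁ - c) := rfl
    nlinarith
  simp only [c] at f3
  linarith

end MainInequality

/-! ### Primitivity of the Kronecker character -/

/-- A Dirichlet character modulo `N` is primitive as soon as, for every prime `p ∣ N`, it is not
trivial on the residues coprime to `N` that are `1` modulo `N / p`. -/
theorem DirichletCharacter.isPrimitive_of_exists {N : ℕ} [NeZero N] {χ : DirichletCharacter ℂ N}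
    (h : ∀ p : ℕ, p.Prime → p ∣ N → ∃ n : ℕ, n.Coprime N ∧ n ≡ 1 [MOD N / p] ∧ χ n ≠ 1) :
    χ.IsPrimitive := by
  by_contra hcon
  rw [DirichletCharacter.isPrimitive_def] at hcon
  obtain ⟨k, hk⟩ := χ.conductor_dvd_level
  have hk1 : k ≠ 1 := by
    rintro rfl
    exact hcon (by rw [mul_one] at hk; exact hk.symm)
  obtain ⟨p, hp, l, rfl⟩ := Nat.exists_prime_and_dvd hk1
  have hN : N / p = χ.conductor * l := by
    refine Nat.div_eq_of_eq_mul_left hp.pos ?_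
    linarith
  obtain ⟨n, hn, hn1, hχ⟩ := h p hp ⟨χ.conductor * l, by linarith⟩
  have hd : N / p ∣ N := Nat.div_dvd_of_dvd ⟨χ.conductor * l, by linarith⟩
  have hf : χ.FactorsThrough (N / p) :=
    DirichletCharacter.FactorsThrough.mono χ χ.factorsThrough_conductor ⟨l, hN⟩ hd
  rw [DirichletCharacter.factorsThrough_iff_ker_unitsMap hd] at hf
  have hu : ZMod.unitOfCoprime n hn ∈ (ZMod.unitsMap hd).ker := by
    rw [MonoidHom.mem_ker]
    ext
    rw [ZMod.unitsMap_val, ZMod.coe_unitOfCoprime, ZMod.cast_natCast hd]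
    rw [Units.val_one]
    exact_mod_cast (ZMod.natCast_eq_natCast_iff _ _ _).2 hn1
  have := hf hu
  rw [MonoidHom.mem_ker] at this
  apply hχ
  have h2 := congrArg Units.val this
  rw [MulChar.coe_toUnitHom] at h2
  simpa using h2

theorem exists_jacobiSym_eq_neg_one {p : ℕ} (hp : p.Prime) (hp2 : p ≠ 2) :
    ∃ r : ℕ, J(r | p) = -1 := by
  have : Fact p.Prime := ⟨hp⟩
  obtain ⟨a, ha⟩ := quadraticChar_exists_neg_one (F := ZMod p) (by rwa [ZMod.ringChar_zmod_n])
  refine ⟨a.val, ?_⟩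
  rw [← jacobiSym.legendreSym.to_jacobiSym, legendreSym]
  simpa using ha

theorem jacobiSym_eq_of_modEq {a b m : ℕ} (h : a ≡ b [MOD m]) : J(a | m) = J(b | m) :=
  jacobiSym.mod_left' (by exact_mod_cast h)

theorem jacobiSym_eq_one_of_modEq_one {m : ℤ} {n : ℕ} (h : n ≡ 1 [MOD 4 * m.natAbs])
    (hn : Odd n) : J(m | n) = 1 := by
  rw [jacobiSym.mod_right m hn, h, ← jacobiSym.mod_right m odd_one, jacobiSym.one_right]

/-- A number at which the symbol is `-1` is coprime to the discriminant. -/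
theorem kroneckerSym_coprime {d : ℤ} (hd : IsFundamentalDiscriminant d) {n : ℕ}
    (h : kroneckerSym d n = -1) : n.Coprime d.natAbs := by
  by_contra hc
  rw [kroneckerSym_eq_zero hd hc] at h
  norm_num at h

/-- The symbol `(d / ·)` is not induced from the modulus `|d| / p`. By quadratic reciprocity a
witness is found by prescribing a nonresidue modulo `p` when `p` is odd, and explicitly when `p =
2`. -/
theorem exists_kroneckerSym_eq_neg_one {d : ℤ} (hd : IsFundamentalDiscriminant d) {p : ℕ}
    (hp : p.Prime) (hpd : p ∣ d.natAbs) :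
    ∃ n : ℕ, n ≡ 1 [MOD d.natAbs / p] ∧ kroneckerSym d n = -1 := by
  rcases hd with ⟨h4, hsq⟩ | ⟨m, rfl, hm4, hsq⟩
  · have hsq' : Squarefree d.natAbs := Int.squarefree_natAbs.2 hsq
    have hp2 : p ≠ 2 := by rintro rfl; omega
    obtain ⟨q, hq⟩ := hpd
    have hdiv : d.natAbs / p = q := by rw [hq, Nat.mul_div_cancel_left _ hp.pos]
    have hcop : Nat.Coprime q p := by
      rw [hq] at hsq'
      exact (Nat.coprime_of_squarefree_mul hsq').symm
    obtain ⟨r, hr⟩ := exists_jacobiSym_eq_neg_one hp hp2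
    obtain ⟨n, hn1, hn2⟩ := Nat.chineseRemainder hcop 1 r
    refine ⟨n, by rwa [hdiv], ?_⟩
    have hq0 : q ≠ 0 := by rintro rfl; simp at hq; omega
    rw [kroneckerSym_one_mod_four h4, hq, jacobiSym.mul_right' _ hp.ne_zero hq0,
      jacobiSym_eq_of_modEq hn1, jacobiSym_eq_of_modEq hn2, hr]
    simp
  · have hsq' : Squarefree m.natAbs := Int.squarefree_natAbs.2 hsq
    have hN : (4 * m).natAbs = 4 * m.natAbs := by omega
    rw [hN] at hpd ⊢
    have hm0 : m.natAbs ≠ 0 := by omega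
    rcases eq_or_ne p 2 with rfl | hp2
    · rcases hm4 with hm4 | hm4
      · obtain ⟨m', rfl⟩ : ∃ m', m = 2 * m' := ⟨m / 2, by omega⟩
        have hn : Odd (1 + 4 * m'.natAbs) := by rw [Nat.odd_iff]; omega
        refine ⟨1 + 4 * m'.natAbs, ?_, ?_⟩
        · have : 4 * (2 * m').natAbs / 2 = 4 * m'.natAbs := by omega
          rw [this]
          simp [Nat.ModEq]
        · rw [kroneckerSym_four_mul_odd _ hn, jacobiSym.mul_left,
            jacobiSym_eq_one_of_modEq_one (m := m') (by simp [Nat.ModEq]) hn, jacobiSym.at_two hn,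
            ZMod.χ₈_nat_eq_if_mod_eight, if_neg (by omega), if_neg (by omega), mul_one]
      · have hn : Odd (1 + 2 * m.natAbs) := by rw [Nat.odd_iff]; omega
        refine ⟨1 + 2 * m.natAbs, ?_, ?_⟩
        · have : 4 * m.natAbs / 2 = 2 * m.natAbs := by omega
          rw [this]
          simp [Nat.ModEq]
        · rw [kroneckerSym_four_mul_odd _ hn]
          have h1 : J((1 + 2 * m.natAbs : ℕ) | m.natAbs) = 1 := by
            rw [jacobiSym_eq_of_modEq (b := 1) (by simp [Nat.ModEq])]
            simp
          rcases Int.natAbs_eq m with h | h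
          · conv_lhs => rw [h]
            simp only [Int.natAbs_natCast]
            rw [jacobiSym.quadratic_reciprocity_three_mod_four (by omega) (by omega), h1]
          · conv_lhs => rw [h]
            rw [Int.natAbs_neg, Int.natAbs_natCast, jacobiSym.neg _ hn,
              ZMod.χ₄_nat_three_mod_four (by omega),
              jacobiSym.quadratic_reciprocity_one_mod_four (by omega) hn, h1, mul_one]
    · have hpm : p ∣ m.natAbs := by
        rcases (hp.dvd_mul).1 hpd with h | h
        · exact absurd ((Nat.prime_dvd_prime_iff_eq hp Nat.prime_two).1
            (hp.dvd_of_dvd_pow (show p ∣ 2 ^ 2 from h))) hp2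
        · exact h
      obtain ⟨m', hm'⟩ := Int.natCast_dvd.2 hpm
      have hma : m.natAbs = p * m'.natAbs := by rw [hm', Int.natAbs_mul, Int.natAbs_natCast]
      have hdiv : 4 * m.natAbs / p = 4 * m'.natAbs := by
        rw [hma, show 4 * (p * m'.natAbs) = p * (4 * m'.natAbs) by ring,
          Nat.mul_div_cancel_left _ hp.pos]
      have hcop : Nat.Coprime (4 * m'.natAbs) p := by
        rw [hma] at hsq'
        refine Nat.Coprime.mul_left ?_ (Nat.coprime_of_squarefree_mul hsq').symm
        exact Nat.Coprime.pow_left 2 ((Nat.coprime_primes Nat.prime_two hp).2 (Ne.symm hp2))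
      obtain ⟨r, hr⟩ := exists_jacobiSym_eq_neg_one hp hp2
      obtain ⟨n, hn1, hn2⟩ := Nat.chineseRemainder hcop 1 r
      have hn4 : n % 4 = 1 := (hn1.of_mul_right _ : n ≡ 1 [MOD 4])
      have hn : Odd n := by rw [Nat.odd_iff]; omega
      refine ⟨n, by rwa [hdiv], ?_⟩
      rw [kroneckerSym_four_mul_odd _ hn, hm', jacobiSym.mul_left,
        jacobiSym_eq_one_of_modEq_one hn1 hn, mul_one,
        jacobiSym.quadratic_reciprocity_one_mod_four' (hp.odd_of_ne_two hp2) hn4,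
        jacobiSym_eq_of_modEq hn2, hr]

/-- Primitivity makes the functional equation available. -/
theorem kroneckerChar_isPrimitive (d : FundamentalDiscriminant) : (kroneckerChar d).IsPrimitive := by
  refine DirichletCharacter.isPrimitive_of_exists fun p hp hpd => ?_
  obtain ⟨n, hn1, hn2⟩ := exists_kroneckerSym_eq_neg_one d.2 hp hpd
  refine ⟨n, kroneckerSym_coprime d.2 hn2, hn1, ?_⟩
  rw [kroneckerChar_natCast, hn2]
  norm_num

theorem FundamentalDiscriminant.natAbs_eq_one_iff (d : FundamentalDiscriminant) :
    d.1.natAbs = 1 ↔ d.1 = 1 := by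
  rcases d.2 with ⟨h, -⟩ | ⟨m, h, -⟩ <;> omega

theorem kroneckerChar_ne_one {d : FundamentalDiscriminant} (hd : d.1 ≠ 1) :
    kroneckerChar d ≠ 1 := by
  intro h
  have h1 := kroneckerChar_isPrimitive d
  rw [DirichletCharacter.isPrimitive_def, h, DirichletCharacter.conductor_one] at h1
  exact hd ((FundamentalDiscriminant.natAbs_eq_one_iff d).1 h1.symm)

theorem kroneckerSym_trichotomy (d : ℤ) (n : ℕ) :
    kroneckerSym d n = 0 ∨ kroneckerSym d n = 1 ∨ kroneckerSym d n = -1 := by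
  have h8 : ∀ a : ZMod 8, ZMod.χ₈ a = 0 ∨ ZMod.χ₈ a = 1 ∨ ZMod.χ₈ a = -1 := by decide
  rw [kroneckerSym]
  split_ifs
  · simp
  · simp
  · have h1 : ZMod.χ₈ (d : ZMod 8) ^ n.factorization 2 = 0 ∨
        ZMod.χ₈ (d : ZMod 8) ^ n.factorization 2 = 1 ∨
        ZMod.χ₈ (d : ZMod 8) ^ n.factorization 2 = -1 := by
      rcases h8 d with h | h | h <;> rw [h]
      · rcases eq_or_ne (n.factorization 2) 0 with h0 | h0
        · simp [h0]
        · simp [h0]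
      · simp
      · exact Or.inr (neg_one_pow_eq_or ℤ _)
    rcases h1 with h1 | h1 | h1 <;>
      rcases jacobiSym.trichotomy d (n / 2 ^ n.factorization 2) with h2 | h2 | h2 <;>
      rw [h1, h2] <;> decide

theorem kroneckerChar_inv (d : FundamentalDiscriminant) : (kroneckerChar d)⁻¹ = kroneckerChar d := by
  refine inv_eq_of_mul_eq_one_left (MulChar.ext fun a => ?_)
  rw [MulChar.mul_apply, MulChar.one_apply_coe]
  have h1 : IsUnit (kroneckerChar d a) := a.isUnit.map (kroneckerChar d)
  change ((kroneckerSym d.1 (a : ZMod d.1.natAbs).val : ℤ) : ℂ) *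
    ((kroneckerSym d.1 (a : ZMod d.1.natAbs).val : ℤ) : ℂ) = 1
  change IsUnit ((kroneckerSym d.1 (a : ZMod d.1.natAbs).val : ℤ) : ℂ) at h1
  rcases kroneckerSym_trichotomy d.1 (a : ZMod d.1.natAbs).val with h | h | h
  · rw [h] at h1; simp at h1
  · rw [h]; norm_num
  · rw [h]; norm_num

/-! ### Gamma factors, functional equation and coefficients of the logarithm -/

open scoped ComplexConjugate

theorem differentiableAt_Gammaℝ {s : ℂ} (hs : 0 < s.re) : DifferentiableAt ℂ Complex.Gammaℝ s := by
  have h : Complex.Gammaℝ = fun s => (Complex.Gammaℝ s)⁻¹⁻¹ := by funext s; rw [inv_inv]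
  rw [h]
  exact (Complex.differentiable_Gammaℝ_inv s).inv (inv_ne_zero (Complex.Gammaℝ_ne_zero_of_re_pos hs))

theorem norm_Gammaℝ (s : ℂ) :
    ‖Complex.Gammaℝ s‖ = Real.pi ^ (-s.re / 2) * ‖Complex.Gamma (s / 2)‖ := by
  rw [Complex.Gammaℝ_def, norm_mul, Complex.norm_cpow_eq_rpow_re_of_pos Real.pi_pos]
  congr 2
  rw [show -s / 2 = ((1 / 2 : ℝ) : ℂ) * (-s) by push_cast; ring, Complex.re_ofReal_mul]
  simp; ring

theorem norm_Gammaℝ_conj (s : ℂ) : ‖Complex.Gammaℝ (conj s)‖ = ‖Complex.Gammaℝ s‖ := by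
  rw [norm_Gammaℝ, norm_Gammaℝ, Complex.conj_re]
  have : conj s / 2 = conj (s / 2) := by rw [map_div₀, map_ofNat]
  rw [this, Complex.Gamma_conj, RCLike.norm_conj]

theorem re_div_two (s : ℂ) : (s / 2).re = s.re / 2 := by simp

theorem im_div_two (s : ℂ) : (s / 2).im = s.im / 2 := by simp

theorem exists_norm_Gammaℝ_le_add {δ : ℝ} (hδ : 0 < δ) :
    ∃ C : ℝ, 0 < C ∧ ∀ s : ℂ, 1 / 4 ≤ s.re → ‖Complex.Gammaℝ s‖ ≤ C * ‖Complex.Gammaℝ (s + δ)‖ := by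
  obtain ⟨C, hC, h⟩ := exists_norm_Gamma_le_add (c := 1 / 8) (h := δ / 2) (by norm_num) (by positivity)
  refine ⟨C * Real.pi ^ (δ / 2), by positivity, fun s hs => ?_⟩
  rw [norm_Gammaℝ, norm_Gammaℝ]
  have h1 := h (s / 2) (by rw [re_div_two]; linarith)
  have e : (s + δ) / 2 = s / 2 + (δ / 2 : ℝ) := by push_cast; ring
  have e2 : Real.pi ^ (-s.re / 2) = Real.pi ^ (δ / 2) * Real.pi ^ (-(s + δ).re / 2) := by
    rw [← Real.rpow_add Real.pi_pos]; congr 1; simp; ring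
  rw [e, e2]
  calc _ ≤ Real.pi ^ (δ / 2) * Real.pi ^ (-(s + δ).re / 2) *
        (C * ‖Complex.Gamma (s / 2 + (δ / 2 : ℝ))‖) := by gcongr
    _ = _ := by ring

theorem norm_Gammaℝ_add_le {s : ℂ} {δ : ℝ} (hs : 0 < s.re) (hs2 : s.re ≤ 2) (hδ : 0 ≤ δ)
    (hδ2 : δ ≤ 1) :
    ‖Complex.Gammaℝ (s + δ)‖ ≤
      Real.exp (δ * (Real.log (2 + |s.im|) / 2 + 5)) * ‖Complex.Gammaℝ s‖ := by
  rw [norm_Gammaℝ, norm_Gammaℝ]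
  have h1 := norm_Gamma_add_le (w := s / 2) (η := δ / 2) (by rw [re_div_two]; linarith)
    (by rw [re_div_two]; linarith) (by linarith) (by linarith)
  have e : (s + δ) / 2 = s / 2 + (δ / 2 : ℝ) := by push_cast; ring
  have h2 : Real.pi ^ (-(s + δ).re / 2) ≤ Real.pi ^ (-s.re / 2) :=
    Real.rpow_le_rpow_of_exponent_le (by linarith [Real.pi_gt_three]) (by simp; linarith)
  have h3 : Real.exp (δ / 2 * (Real.log (2 + |(s / 2).im|) + 10)) ≤
      Real.exp (δ * (Real.log (2 + |s.im|) / 2 + 5)) := by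
    rw [Real.exp_le_exp]
    have h4 : Real.log (2 + |(s / 2).im|) ≤ Real.log (2 + |s.im|) := by
      refine Real.log_le_log (by positivity) ?_
      rw [im_div_two, abs_div, abs_two]
      linarith [abs_nonneg s.im]
    nlinarith
  rw [e]
  calc _ ≤ Real.pi ^ (-s.re / 2) * (Real.exp (δ * (Real.log (2 + |s.im|) / 2 + 5)) *
        ‖Complex.Gamma (s / 2)‖) := by
        gcongr
        exact h1.trans (by gcongr)
    _ = _ := by ring

/-- The quantitative form of monotonicity of `|N ^ (s / 2) γ(s) F(s)|` along horizontal lines. -/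
theorem norm_le_exp_mul_norm_add {F U γ : ℂ → ℂ} {N : ℝ} (hN : 0 < N) (hFd : Differentiable ℂ F)
    (hUd : DifferentiableOn ℂ U {s | 1 / 2 < s.re})
    (hexp : ∀ s : ℂ, 1 / 2 < s.re → Complex.exp (U s) = F s)
    (hF : ∃ (A : ℕ) (C : ℝ), ∀ s : ℂ, 1 / 4 ≤ s.re → ‖F s‖ ≤ C * (1 + ‖s‖) ^ A)
    (hU2 : ∃ C : ℝ, ∀ s : ℂ, 2 ≤ s.re → ‖U s‖ ≤ C * Real.log (2 + ‖s‖))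
    (hγd : ∀ s : ℂ, 0 < s.re → DifferentiableAt ℂ γ s) (hγ0 : ∀ s : ℂ, 0 < s.re → γ s ≠ 0)
    (hγb : ∀ δ : ℝ, 0 < δ → ∃ C : ℝ, 0 < C ∧ ∀ s : ℂ, 1 / 4 ≤ s.re → ‖γ s‖ ≤ C * ‖γ (s + δ)‖)
    (hγδ : ∀ (s : ℂ) (δ : ℝ), 1 / 2 ≤ s.re → s.re ≤ 1 → 0 ≤ δ → δ ≤ 1 →
      ‖γ (s + δ)‖ ≤ Real.exp (δ * (Real.log (2 + |s.im|) / 2 + 7)) * ‖γ s‖)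
    (hreal : ∀ δ : ℝ, 0 < δ → ∃ C : ℝ, ∀ x : ℝ, 2 ≤ x → ‖F x‖ ≤ C * ‖F (x + δ)‖)
    (hsymm : ∀ s : ℂ, 0 < s.re → s.re < 1 →
      ‖(N : ℂ) ^ ((1 - s) / 2) * γ (1 - s) * F (1 - s)‖ = ‖(N : ℂ) ^ (s / 2) * γ s * F s‖)
    (hconj : ∀ s : ℂ, 0 < s.re → ‖γ (conj s) * F (conj s)‖ = ‖γ s * F s‖)
    {δ : ℝ} (hδ : 0 < δ) (hδ2 : δ ≤ 1 / 2) {s : ℂ} (hs : 1 / 2 ≤ s.re) (hs1 : s.re ≤ 1) :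
    ‖F s‖ ≤ Real.exp (δ * (Real.log N / 2 + 7 + 1 / 2 * Real.log (2 + |s.im|))) * ‖F (s + δ)‖ := by
  have hnorm : ∀ z : ℂ, ‖(N : ℂ) ^ (z / 2)‖ = Real.exp (Real.log N / 2 * z.re) := fun z => by
    rw [Complex.norm_cpow_eq_rpow_re_of_pos hN, re_div_two, Real.rpow_def_of_pos hN]
    ring_nf
  have h1 := norm_completed_le_of_symm (E := fun s => (N : ℂ) ^ (s / 2) * γ s * F s) hN hFd hUd hexp
    hF hU2 hγd hγ0 hγb hreal (fun _ => rfl) (fun h t hh hh4 => by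
      have e : (1 / 2 - h + t * Complex.I : ℂ) = 1 - conj (1 / 2 + h + t * Complex.I : ℂ) := by
        apply Complex.ext <;> simp
        ring
      have hre : (1 / 2 + h + t * Complex.I : ℂ).re = 1 / 2 + h := by simp
      rw [e, hsymm _ (by rw [Complex.conj_re, hre]; linarith) (by rw [Complex.conj_re, hre]; linarith),
        mul_assoc, mul_assoc, norm_mul,
        hconj _ (by rw [hre]; linarith), norm_mul (_ ^ _), hnorm, hnorm, Complex.conj_re]) hδ hδ2 hs
  beta_reduce at h1
  rw [norm_mul, norm_mul, norm_mul, norm_mul, hnorm, hnorm] at h1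
  have hγs : 0 < ‖γ s‖ := norm_pos_iff.2 (hγ0 s (by linarith))
  have h2 := hγδ s δ hs hs1 hδ.le (by linarith)
  have hre : (s + δ).re = s.re + δ := by simp
  rw [hre] at h1
  refine le_of_mul_le_mul_left (h1.trans ?_)
    (mul_pos (Real.exp_pos (Real.log N / 2 * s.re)) hγs)
  calc _ ≤ Real.exp (Real.log N / 2 * (s.re + δ)) *
        (Real.exp (δ * (Real.log (2 + |s.im|) / 2 + 7)) * ‖γ s‖) * ‖F (s + δ)‖ := by gcongr
    _ = _ := by
      have e : Real.exp (Real.log N / 2 * (s.re + δ)) =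
        Real.exp (Real.log N / 2 * s.re) * Real.exp (δ * (Real.log N / 2)) := by
        rw [← Real.exp_add]; ring_nf
      have e2 : Real.exp (δ * (Real.log N / 2 + 7 + 1 / 2 * Real.log (2 + |s.im|))) =
        Real.exp (δ * (Real.log N / 2)) * Real.exp (δ * (Real.log (2 + |s.im|) / 2 + 7)) := by
        rw [← Real.exp_add]; ring_nf
      rw [e, e2]; ring

/-- A logarithm of `F` on `Re s > 1/2` can be normalized to agree with a given one on `Re s > 1`. -/
theorem exists_log_half_plane_eq {F V : ℂ → ℂ} (hF : Differentiable ℂ F)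
    (h0 : ∀ s : ℂ, 1 / 2 < s.re → F s ≠ 0) (hVd : DifferentiableOn ℂ V {s | 1 < s.re})
    (hV : ∀ s : ℂ, 1 < s.re → Complex.exp (V s) = F s) :
    ∃ U : ℂ → ℂ, DifferentiableOn ℂ U {s | 1 / 2 < s.re} ∧
      (∀ s : ℂ, 1 / 2 < s.re → Complex.exp (U s) = F s) ∧ ∀ s : ℂ, 1 < s.re → U s = V s := by
  obtain ⟨U, hUd, hU⟩ := exists_log_half_plane hF h0
  have hopen : IsOpen {s : ℂ | 1 < s.re} := isOpen_lt continuous_const Complex.continuous_re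
  have hUV : ∀ s : ℂ, 1 < s.re → Complex.exp (U s - V s) = 1 := fun s hs => by
    rw [Complex.exp_sub, hU s (by linarith), hV s hs, div_self (h0 s (by linarith))]
  have hd : DifferentiableOn ℂ (fun s => U s - V s) {s | 1 < s.re} :=
    (hUd.mono fun s (hs : 1 < s.re) => Set.mem_ofPred.2 (by linarith)).sub hVd
  have hder : ∀ s ∈ {s : ℂ | 1 < s.re}, deriv (fun s => U s - V s) s = 0 := fun s hs => by
    have h1 : HasDerivAt (fun s => U s - V s) (deriv (fun s => U s - V s) s) s :=
      (hd.differentiableAt (hopen.mem_nhds hs)).hasDerivAt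
    have h2 := h1.cexp
    have h3 : HasDerivAt (fun s => Complex.exp (U s - V s)) 0 s :=
      (hasDerivAt_const s (1 : ℂ)).congr_of_eventuallyEq
        (Filter.eventually_of_mem (hopen.mem_nhds hs) fun z hz => hUV z hz)
    have h4 := h2.unique h3
    rw [hUV s hs, one_mul] at h4
    exact h4
  obtain ⟨c, hc⟩ := hopen.exists_is_const_of_deriv_eq_zero
    ((convex_halfSpace_re_gt 1).isPreconnected) hd hder
  refine ⟨fun s => U s - c, hUd.sub_const c, fun s hs => ?_, fun s hs => ?_⟩
  · have h2 := hUV 2 (by norm_num)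
    rw [hc 2 (show (2 : ℂ) ∈ {s : ℂ | 1 < s.re} by norm_num)] at h2
    rw [Complex.exp_sub, hU s hs, h2, div_one]
  · rw [← hc s (show s ∈ {s : ℂ | 1 < s.re} from hs)]
    ring

/-- The coefficients `f(n) Λ(n) / log n` of the logarithm of the Dirichlet series of a completely
multiplicative `f`. -/
noncomputable def logCoeff (f : ℕ → ℂ) (n : ℕ) : ℂ :=
  f n * ArithmeticFunction.vonMangoldt n / Real.log n

theorem norm_logCoeff_le {f : ℕ → ℂ} (hf : ∀ n, ‖f n‖ ≤ 1) (n : ℕ) : ‖logCoeff f n‖ ≤ 1 := by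
  rw [logCoeff, norm_div, norm_mul, Complex.norm_real, Complex.norm_real, Real.norm_eq_abs,
    Real.norm_eq_abs, abs_of_nonneg ArithmeticFunction.vonMangoldt_nonneg,
    abs_of_nonneg (Real.log_natCast_nonneg n)]
  refine div_le_one_of_le₀ ?_ (Real.log_natCast_nonneg n)
  exact (mul_le_of_le_one_left ArithmeticFunction.vonMangoldt_nonneg (hf n)).trans
    ArithmeticFunction.vonMangoldt_le_log

section LogCoeff

variable {f : ℕ → ℂ} (hf : ∀ n, ‖f n‖ ≤ 1)
include hf

theorem LSeriesSummable_logCoeff {s : ℂ} (hs : 1 < s.re) : LSeriesSummable (logCoeff f) s :=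
  LSeriesSummable_of_bounded_of_one_lt_re (m := 1) (fun n _ => norm_logCoeff_le hf n) hs

theorem differentiableOn_LSeries_logCoeff :
    DifferentiableOn ℂ (LSeries (logCoeff f)) {s | 1 < s.re} := by
  refine (LSeries_differentiableOn (logCoeff f)).mono fun s (hs : 1 < s.re) => ?_
  have : LSeries.abscissaOfAbsConv (logCoeff f) ≤ (1 : ℝ) :=
    LSeries.abscissaOfAbsConv_le_of_forall_lt_LSeriesSummable fun y hy =>
      LSeriesSummable_logCoeff hf (by simpa using hy)
  exact this.trans_lt (by exact_mod_cast hs)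

theorem exists_norm_LSeries_logCoeff_le :
    ∃ C : ℝ, 0 ≤ C ∧ ∀ s : ℂ, 2 ≤ s.re → ‖LSeries (logCoeff f) s‖ ≤ C := by
  have hsum := (LSeriesSummable_logCoeff hf (s := 2) (by norm_num)).norm
  refine ⟨∑' n, ‖LSeries.term (logCoeff f) 2 n‖, tsum_nonneg fun _ => norm_nonneg _, fun s hs => ?_⟩
  have hle : ∀ n, ‖LSeries.term (logCoeff f) s n‖ ≤ ‖LSeries.term (logCoeff f) 2 n‖ := fun n =>
    LSeries.norm_term_le_of_re_le_re _ (by simpa using hs) n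
  exact tsum_of_norm_bounded hsum.hasSum hle

end LogCoeff

/-- A crude bound for a quotient of two exponentials with bounded exponents. -/
theorem norm_le_exp_mul_of_norm_log_le {u v C : ℝ} {a b : ℂ} (ha : ‖a‖ ≤ u) (hb : ‖b‖ ≤ v)
    (huv : u + v ≤ C) : ‖Complex.exp a‖ ≤ Real.exp C * ‖Complex.exp b‖ := by
  rw [Complex.norm_exp, Complex.norm_exp, ← Real.exp_add, Real.exp_le_exp]
  have h1 := (abs_le.1 ((Complex.abs_re_le_norm a).trans ha)).2
  have h2 := (abs_le.1 ((Complex.abs_re_le_norm b).trans hb)).1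
  linarith

section Quadratic

variable (d : FundamentalDiscriminant)

theorem LSeries_kroneckerChar_conj (s : ℂ) :
    LSeries (fun n => kroneckerChar d n) (conj s) = conj (LSeries (fun n => kroneckerChar d n) s) := by
  rw [LSeries, LSeries, Complex.conj_tsum]
  refine tsum_congr fun n => ?_
  rcases eq_or_ne n 0 with rfl | hn
  · simp
  · rw [LSeries.term_of_ne_zero hn, LSeries.term_of_ne_zero hn, map_div₀, kroneckerChar_natCast,
      map_intCast, Complex.cpow_conj _ _ (by rw [Complex.natCast_arg]; positivity),
      Complex.conj_natCast]

theorem LFunction_kroneckerChar_conj (hd : d.1 ≠ 1) {s : ℂ} (hs : 0 < s.re) :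
    (kroneckerChar d).LFunction (conj s) = conj ((kroneckerChar d).LFunction s) := by
  have hdiff := DirichletCharacter.differentiable_LFunction (kroneckerChar_ne_one hd)
  have h := eq_of_eq_on_one_lt_re (c := 0) (f := fun s => conj ((kroneckerChar d).LFunction (conj s)))
    (g := (kroneckerChar d).LFunction)
    (fun z _ => (differentiableAt_conj_conj_iff.mpr (hdiff _)).differentiableWithinAt)
    hdiff.differentiableOn (fun z hz => by
      rw [DirichletCharacter.LFunction_eq_LSeries _ (by simpa using hz),
        DirichletCharacter.LFunction_eq_LSeries _ hz, LSeries_kroneckerChar_conj, Complex.conj_conj])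
    hs
  rw [← h, Complex.conj_conj]

theorem exists_gammaFactor_eq : ∃ a : ℝ, 0 ≤ a ∧ a ≤ 1 ∧
    ∀ s, (kroneckerChar d).gammaFactor s = Complex.Gammaℝ (s + a) := by
  rcases (kroneckerChar d).even_or_odd with h | h
  · exact ⟨0, le_rfl, zero_le_one, fun s => by rw [h.gammaFactor_def]; simp⟩
  · exact ⟨1, zero_le_one, le_rfl, fun s => by rw [h.gammaFactor_def]; simp⟩

theorem completedLFunction_kroneckerChar_eq {s : ℂ} (hs : 0 < s.re) :
    (kroneckerChar d).completedLFunction s =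
      (kroneckerChar d).gammaFactor s * (kroneckerChar d).LFunction s := by
  obtain ⟨a, ha, -, h⟩ := exists_gammaFactor_eq d
  rw [DirichletCharacter.LFunction_eq_completed_div_gammaFactor _ _
    (Or.inl (by rintro rfl; simp at hs)), mul_div_cancel₀]
  rw [h]
  exact Complex.Gammaℝ_ne_zero_of_re_pos (by simp; linarith)

/-- Applying the functional equation twice shows that the root number of a real character has square
`1`. -/
theorem norm_rootNumber_kroneckerChar : ‖(kroneckerChar d).rootNumber‖ = 1 := by
  have hfe := DirichletCharacter.IsPrimitive.completedLFunction_one_sub (kroneckerChar_isPrimitive d)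
  rw [kroneckerChar_inv] at hfe
  have hN : (d.1.natAbs : ℂ) ≠ 0 := by exact_mod_cast NeZero.ne d.1.natAbs
  have h1 := hfe 2
  have h2 := hfe (1 - 2)
  rw [sub_sub_cancel, h1] at h2
  have h0 : (kroneckerChar d).completedLFunction 2 ≠ 0 := by
    rw [completedLFunction_kroneckerChar_eq d (by norm_num)]
    refine mul_ne_zero ?_ ?_
    · obtain ⟨a, ha, -, h⟩ := exists_gammaFactor_eq d
      rw [h]
      exact Complex.Gammaℝ_ne_zero_of_re_pos (by simp; linarith)
    · rw [DirichletCharacter.LFunction_eq_LSeries _ (by norm_num)]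
      exact DirichletCharacter.LSeries_ne_zero_of_one_lt_re _ (by norm_num)
  have h3 : (d.1.natAbs : ℂ) ^ ((1 - 2 : ℂ) - 1 / 2) * (d.1.natAbs : ℂ) ^ ((2 : ℂ) - 1 / 2) = 1 := by
    rw [← Complex.cpow_add _ _ hN]; norm_num
  have h4 : (kroneckerChar d).rootNumber * (kroneckerChar d).rootNumber = 1 := by
    refine mul_right_cancel₀ h0 ?_
    rw [one_mul]
    conv_rhs => rw [h2]
    linear_combination (-(kroneckerChar d).rootNumber * (kroneckerChar d).rootNumber *
      (kroneckerChar d).completedLFunction 2) * h3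
  have h5 := congrArg norm h4
  rw [norm_mul, norm_one] at h5
  nlinarith [norm_nonneg (kroneckerChar d).rootNumber]

end Quadratic

/-! ### The upper bound for `log |L(s, χ_d)|` -/

/-- The coefficients of `log L(s, χ_d)`. -/
noncomputable def quadCoeff (d : FundamentalDiscriminant) : ℕ → ℂ :=
  logCoeff fun n => kroneckerChar d n

theorem LFunction_kroneckerChar_ne_zero (hGRH : QuadraticGRH) {d : FundamentalDiscriminant}
    (hd : d.1 ≠ 1) {s : ℂ} (hs : 1 / 2 < s.re) : (kroneckerChar d).LFunction s ≠ 0 := by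
  intro h
  rcases lt_or_ge s.re 1 with h1 | h1
  · exact absurd (hGRH d s (by linarith) h1 h) hs.ne'
  · exact DirichletCharacter.LFunction_ne_zero_of_one_le_re _ (Or.inl (kroneckerChar_ne_one hd)) h1 h

section Quadratic

variable {d : FundamentalDiscriminant} (hd : d.1 ≠ 1)
include hd

/-- Under GRH, the holomorphic logarithm of `L(s, χ_d)` on `Re s > 1/2` that continues its Dirichlet
series. -/
theorem exists_log_LFunction (hGRH : QuadraticGRH) :
    ∃ U : ℂ → ℂ, DifferentiableOn ℂ U {s | 1 / 2 < s.re} ∧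
      (∀ s : ℂ, 1 / 2 < s.re → Complex.exp (U s) = (kroneckerChar d).LFunction s) ∧
      ∀ s : ℂ, 1 < s.re → U s = LSeries (quadCoeff d) s :=
  exists_log_half_plane_eq (DirichletCharacter.differentiable_LFunction (kroneckerChar_ne_one hd))
    (fun _ hs => LFunction_kroneckerChar_ne_zero hGRH hd hs)
    (differentiableOn_LSeries_logCoeff fun n => (kroneckerChar d).norm_le_one n)
    fun s hs => by
      rw [DirichletCharacter.LFunction_eq_LSeries _ hs]
      exact DirichletCharacter.LSeries_eq_exp_LSeries _ hs

omit hd in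
theorem exists_norm_quadCoeff_log_le {U : ℂ → ℂ}
    (hU : ∀ s : ℂ, 1 < s.re → U s = LSeries (quadCoeff d) s) :
    ∃ C : ℝ, 0 ≤ C ∧ ∀ s : ℂ, 2 ≤ s.re → ‖U s‖ ≤ C := by
  obtain ⟨C, hC, h⟩ := exists_norm_LSeries_logCoeff_le (f := fun n : ℕ => kroneckerChar d n)
    fun n => (kroneckerChar d).norm_le_one n
  exact ⟨C, hC, fun s hs => by rw [hU s (by linarith)]; exact h s hs⟩

theorem exists_norm_LFunction_le_pow :
    ∃ (A : ℕ) (C : ℝ), ∀ s : ℂ, 1 / 4 ≤ s.re →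
      ‖(kroneckerChar d).LFunction s‖ ≤ C * (1 + ‖s‖) ^ A := by
  refine ⟨1, 4 * d.1.natAbs, fun s hs => ?_⟩
  refine (DirichletCharacter.norm_LFunction_le (kroneckerChar_ne_one hd) (by linarith)).trans ?_
  rw [div_le_iff₀ (by linarith), pow_one]
  have h0 : (0 : ℝ) ≤ d.1.natAbs := Nat.cast_nonneg _
  calc (d.1.natAbs : ℝ) * ‖s‖ ≤ d.1.natAbs * (1 + ‖s‖) := by gcongr; linarith
    _ = 4 * d.1.natAbs * (1 + ‖s‖) * (1 / 4) := by ring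
    _ ≤ _ := by gcongr

/-- Horizontal monotonicity of the completed `L`-function, with the gamma factor and the conductor
estimated. -/
theorem norm_LFunction_le_exp_mul (hGRH : QuadraticGRH) {δ : ℝ} (hδ : 0 < δ) (hδ2 : δ ≤ 1 / 2)
    {s : ℂ} (hs : 1 / 2 ≤ s.re) (hs1 : s.re ≤ 1) :
    ‖(kroneckerChar d).LFunction s‖ ≤
      Real.exp (δ * (Real.log d.1.natAbs / 2 + 7 + 1 / 2 * Real.log (2 + |s.im|))) *
        ‖(kroneckerChar d).LFunction (s + δ)‖ := by
  obtain ⟨U, hUd, hexp, hU⟩ := exists_log_LFunction hd hGRH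
  obtain ⟨C, hC, hUC⟩ := exists_norm_quadCoeff_log_le hU
  obtain ⟨a, ha0, ha1, ha⟩ := exists_gammaFactor_eq d
  have hN : (0 : ℝ) < d.1.natAbs := by exact_mod_cast Nat.pos_of_ne_zero (NeZero.ne _)
  have hre : ∀ s : ℂ, (s + a).re = s.re + a := fun s => by simp
  have him : ∀ s : ℂ, (s + a).im = s.im := fun s => by simp
  refine norm_le_exp_mul_norm_add (U := U) (γ := (kroneckerChar d).gammaFactor) hN
    (DirichletCharacter.differentiable_LFunction (kroneckerChar_ne_one hd)) hUd hexp
    (exists_norm_LFunction_le_pow hd) ⟨C / Real.log 2, fun s hs => ?_⟩ (fun s hs => ?_)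
    (fun s hs => ?_) (fun δ hδ => ?_) (fun s δ hs hs1 hδ hδ1 => ?_) (fun δ hδ => ?_)
    (fun s hs hs1 => ?_) (fun s hs => ?_) hδ hδ2 hs hs1
  · refine (hUC s hs).trans ?_
    rw [div_mul_eq_mul_div, le_div_iff₀ (Real.log_pos one_lt_two)]
    gcongr
    linarith [norm_nonneg s]
  · have : (kroneckerChar d).gammaFactor = fun s => Complex.Gammaℝ (s + a) := funext ha
    rw [this]
    exact (differentiableAt_Gammaℝ (by rw [hre]; linarith)).comp s
      (differentiableAt_id.add_const (a : ℂ))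
  · rw [ha]
    exact Complex.Gammaℝ_ne_zero_of_re_pos (by rw [hre]; linarith)
  · obtain ⟨C, hC, h⟩ := exists_norm_Gammaℝ_le_add hδ
    refine ⟨C, hC, fun s hs => ?_⟩
    rw [ha, ha, add_right_comm]
    exact h _ (by rw [hre]; linarith)
  · rw [ha, ha, add_right_comm]
    refine (norm_Gammaℝ_add_le (by rw [hre]; linarith) (by rw [hre]; linarith) hδ hδ1).trans ?_
    rw [him]
    gcongr
    norm_num
  · refine ⟨Real.exp (2 * C), fun x hx => ?_⟩
    have e : ((x : ℂ) + δ).re = x + δ := by simp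
    rw [← hexp x (by rw [Complex.ofReal_re]; linarith), ← hexp (x + δ) (by rw [e]; linarith)]
    exact norm_le_exp_mul_of_norm_log_le (hUC _ (by rw [Complex.ofReal_re]; linarith))
      (hUC _ (by rw [e]; linarith)) (by linarith)
  · have h1 : 0 < (1 - s).re := by simp; linarith
    have hfe := DirichletCharacter.IsPrimitive.completedLFunction_one_sub
      (kroneckerChar_isPrimitive d) s
    rw [kroneckerChar_inv, completedLFunction_kroneckerChar_eq d h1,
      completedLFunction_kroneckerChar_eq d hs] at hfe
    rw [mul_assoc, hfe, mul_assoc, norm_mul, norm_mul, norm_mul, norm_rootNumber_kroneckerChar,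
      one_mul, ← mul_assoc, ← norm_mul, ← norm_mul, ← mul_assoc]
    congr 3
    have hN0 : ((d.1.natAbs : ℝ) : ℂ) ≠ 0 := by exact_mod_cast hN.ne'
    rw [Complex.ofReal_natCast] at hN0 ⊢
    rw [← Complex.cpow_add _ _ hN0]
    congr 1; ring
  · rw [norm_mul, norm_mul, LFunction_kroneckerChar_conj d hd hs, RCLike.norm_conj, ha, ha,
      show conj s + (a : ℂ) = conj (s + a) by simp, norm_Gammaℝ_conj]

/-- Under GRH, `log |L(s, χ_d)|` for `1/2 ≤ Re s < 1` is at most the Riesz mean of length `e ^ R` of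
its Dirichlet series, with an error of order `(log |d| + log (2 + |Im s|)) / R`. -/
theorem norm_LFunction_le_riesz_sum (hGRH : QuadraticGRH) {R : ℝ} (hR : 1 ≤ R) {N : ℕ}
    (hN : Real.exp R ≤ N) {s : ℂ} (hs : 1 / 2 ≤ s.re) (hs1 : s.re < 1) :
    ‖(kroneckerChar d).LFunction s‖ ≤
      Real.exp ((∑ n ∈ Finset.range N,
        LSeries.term (quadCoeff d) s n * (fejerWeight R n ^ 2 : ℝ)).re +
      2 * ((Real.log d.1.natAbs / 2 + 7) +
        1 / 2 * (Real.log (2 + |s.im|) + fejerLogMoment)) / R) := by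
  obtain ⟨U, hUd, hexp, hU⟩ := exists_log_LFunction hd hGRH
  obtain ⟨C, hC, hUC⟩ := exists_norm_quadCoeff_log_le hU
  have hN1 : (1 : ℝ) ≤ d.1.natAbs := by exact_mod_cast Nat.one_le_iff_ne_zero.2 (NeZero.ne _)
  have hgrow : ∀ h : ℝ, 0 < h → h ≤ 1 → ∃ K : ℝ, 0 < K ∧
      ∀ s : ℂ, 1 / 2 + h ≤ s.re → ‖U s‖ ≤ K * Real.log (2 + ‖s‖) := fun h h0 h1 =>
    exists_norm_log_le hUd hexp (exists_norm_LFunction_le_pow hd) ⟨C / Real.log 2, fun s hs => by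
      refine (hUC s hs).trans ?_
      rw [div_mul_eq_mul_div, le_div_iff₀ (Real.log_pos one_lt_two)]
      gcongr
      linarith [norm_nonneg s]⟩ h0 h1
  -- The inequality inside the half plane.
  have key : ∀ s : ℂ, 1 / 2 < s.re → s.re ≤ 1 → ‖(kroneckerChar d).LFunction s‖ ≤
      Real.exp ((∑ n ∈ Finset.range N,
        LSeries.term (quadCoeff d) s n * (fejerWeight R n ^ 2 : ℝ)).re +
      2 * ((Real.log d.1.natAbs / 2 + 7) +
        1 / 2 * (Real.log (2 + |s.im|) + fejerLogMoment)) / R) := fun s hs hs1 => by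
    rw [← hexp s hs, Complex.norm_exp, Real.exp_le_exp]
    refine re_le_riesz_sum hUd hgrow (a := quadCoeff d)
      (fun s hs => LSeriesSummable_logCoeff (fun n => (kroneckerChar d).norm_le_one n) hs) hU hs
      (by have := Real.log_nonneg hN1; positivity) (by norm_num) (fun δ hδ hδ2 v => ?_) hR hN
    have hre : (s + v * Complex.I).re = s.re := by simp
    have hre2 : (s + v * Complex.I + δ).re = s.re + δ := by simp
    have him : (s + v * Complex.I).im = s.im + v := by simp
    have h1 := norm_LFunction_le_exp_mul hd hGRH hδ hδ2 (s := s + v * Complex.I)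
      (by rw [hre]; exact hs.le) (by rw [hre]; exact hs1)
    rw [← hexp _ (by rw [hre]; exact hs), ← hexp _ (by rw [hre2]; linarith), Complex.norm_exp,
      Complex.norm_exp, ← Real.exp_add, Real.exp_le_exp, him] at h1
    linarith
  -- The critical line is reached by continuity.
  have hcont : Continuous fun η : ℝ => Real.exp ((∑ n ∈ Finset.range N,
        LSeries.term (quadCoeff d) (s + η) n * (fejerWeight R n ^ 2 : ℝ)).re +
      2 * ((Real.log d.1.natAbs / 2 + 7) +
        1 / 2 * (Real.log (2 + |s.im|) + fejerLogMoment)) / R) := by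
    refine Real.continuous_exp.comp ((Complex.continuous_re.comp ?_).add continuous_const)
    refine continuous_finsetSum _ fun n _ => Continuous.mul ?_ continuous_const
    rcases eq_or_ne n 0 with rfl | hn
    · simpa using continuous_const
    · simp only [LSeries.term_of_ne_zero hn]
      refine continuous_const.div ?_ fun η => ?_
      · exact (continuous_const.add Complex.continuous_ofReal).const_cpow
          (Or.inl (by exact_mod_cast hn))
      · rw [Ne, Complex.cpow_eq_zero_iff]; simp [hn]
  have hcont2 : Continuous fun η : ℝ => ‖(kroneckerChar d).LFunction (s + η)‖ :=
    ((DirichletCharacter.differentiable_LFunction (kroneckerChar_ne_one hd)).continuous.comp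
      (continuous_const.add Complex.continuous_ofReal)).norm
  have hev : ∀ᶠ η : ℝ in nhdsWithin 0 (Set.Ioi 0), η < 1 - s.re :=
    nhdsWithin_le_nhds (Iio_mem_nhds (by linarith))
  have h := le_of_tendsto_of_tendsto ((hcont2.tendsto 0).mono_left nhdsWithin_le_nhds)
    ((hcont.tendsto 0).mono_left nhdsWithin_le_nhds) (by
      filter_upwards [hev, self_mem_nhdsWithin] with η hη hη0
      have hη0' : 0 < η := hη0
      have hre : (s + η).re = s.re + η := by simp
      have him : (s + η).im = s.im := by simp
      have := key (s + η) (by rw [hre]; linarith) (by rw [hre]; linarith)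
      rwa [him] at this)
  simpa using h

end Quadratic

/-! ### The function `(s - 1) ζ(s)` -/

/-- For `d = 1` the `L`-function is `ζ`. -/
theorem LFunction_kroneckerChar_of_eq_one {d : FundamentalDiscriminant} (hd : d.1 = 1) (s : ℂ) :
    (kroneckerChar d).LFunction s = riemannZeta s := by
  obtain ⟨d, h⟩ := d
  subst hd
  exact congrFun (DirichletCharacter.LFunction_modOne_eq (χ := (kroneckerChar ⟨1, h⟩ :))) s

theorem isFundamentalDiscriminant_one : IsFundamentalDiscriminant 1 :=
  Or.inl ⟨by norm_num, squarefree_one⟩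

theorem zetaReg_ne_zero (hGRH : QuadraticGRH) {s : ℂ} (hs : 1 / 2 < s.re) : zetaReg s ≠ 0 := by
  rcases eq_or_ne s 1 with rfl | h1
  · rw [zetaReg_one]; exact one_ne_zero
  · rw [zetaReg_of_ne_one h1]
    refine mul_ne_zero (sub_ne_zero.2 h1) ?_
    rcases lt_or_ge s.re 1 with h | h
    · intro h0
      have := hGRH ⟨1, isFundamentalDiscriminant_one⟩ s (by linarith) h
        (by rw [LFunction_kroneckerChar_of_eq_one rfl, h0])
      linarith
    · exact riemannZeta_ne_zero_of_one_le_re h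

/-- The Dirichlet series of `log ζ`. -/
noncomputable def logZeta (s : ℂ) : ℂ := LSeries (logCoeff fun _ => 1) s

theorem exp_logZeta {s : ℂ} (hs : 1 < s.re) : Complex.exp (logZeta s) = riemannZeta s := by
  rw [← riemannZeta_eq_exp_LSeries hs, logZeta]
  congr 2
  funext n
  simp [logCoeff]

/-- The logarithm of `(s - 1) ζ(s)` on `Re s > 1/2`, under RH. -/
theorem exists_log_zetaReg (hGRH : QuadraticGRH) :
    ∃ U : ℂ → ℂ, DifferentiableOn ℂ U {s | 1 / 2 < s.re} ∧
      (∀ s : ℂ, 1 / 2 < s.re → Complex.exp (U s) = zetaReg s) ∧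
      ∀ s : ℂ, 1 < s.re → U s = Complex.log (s - 1) + logZeta s := by
  have hne : ∀ s : ℂ, 1 < s.re → s - 1 ≠ 0 := fun s hs => by
    rw [sub_ne_zero]; rintro rfl; simp at hs
  refine exists_log_half_plane_eq differentiable_zetaReg (fun s hs => zetaReg_ne_zero hGRH hs)
    (DifferentiableOn.add (fun s hs => ?_) (differentiableOn_LSeries_logCoeff fun n => by simp))
    fun s hs => ?_
  · have hs' : 1 < s.re := hs
    exact ((differentiableAt_id.sub_const 1).clog
      (Or.inl (by simp; linarith))).differentiableWithinAt
  · rw [Complex.exp_add, Complex.exp_log (hne s hs), exp_logZeta hs,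
      zetaReg_of_ne_one (sub_ne_zero.1 (hne s hs))]

theorem norm_clog_sub_one_le {s : ℂ} (hs : 2 ≤ s.re) :
    ‖Complex.log (s - 1)‖ ≤ (1 + Real.pi / Real.log 2) * Real.log (2 + ‖s‖) := by
  have h1 : 1 ≤ ‖s - 1‖ := by
    have := Complex.re_le_norm (s - 1)
    simp at this
    linarith
  have h2 : ‖s - 1‖ ≤ 2 + ‖s‖ := (norm_sub_le _ _).trans (by rw [norm_one]; linarith [norm_nonneg s])
  have h3 : |Real.log ‖s - 1‖| ≤ Real.log (2 + ‖s‖) := by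
    rw [abs_of_nonneg (Real.log_nonneg h1)]
    exact Real.log_le_log (by linarith) h2
  have h4 : Real.pi ≤ Real.pi / Real.log 2 * Real.log (2 + ‖s‖) := by
    rw [div_mul_eq_mul_div, le_div_iff₀ (Real.log_pos one_lt_two)]
    gcongr
    linarith [norm_nonneg s]
  have h5 := Complex.norm_le_abs_re_add_abs_im (Complex.log (s - 1))
  rw [Complex.log_re, Complex.log_im] at h5
  have h6 := Complex.abs_arg_le_pi (s - 1)
  linarith

theorem exists_norm_log_zetaReg_le {U : ℂ → ℂ}
    (hU : ∀ s : ℂ, 1 < s.re → U s = Complex.log (s - 1) + logZeta s) :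
    ∃ C : ℝ, 0 ≤ C ∧ ∀ s : ℂ, 2 ≤ s.re → ‖U s‖ ≤ C * Real.log (2 + ‖s‖) := by
  obtain ⟨C, hC, h⟩ := exists_norm_LSeries_logCoeff_le (f := fun _ : ℕ => 1) fun n => by simp
  have hl2 := Real.log_pos one_lt_two
  refine ⟨(1 + Real.pi / Real.log 2) + C / Real.log 2, ?_, fun s hs => ?_⟩
  · have := Real.pi_pos
    positivity
  · rw [hU s (by linarith), add_mul]
    refine (norm_add_le _ _).trans (add_le_add (norm_clog_sub_one_le hs) ((h s hs).trans ?_))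
    rw [div_mul_eq_mul_div, le_div_iff₀ hl2]
    gcongr
    linarith [norm_nonneg s]

theorem exists_norm_zetaReg_le_pow :
    ∃ (A : ℕ) (C : ℝ), ∀ s : ℂ, 1 / 4 ≤ s.re → ‖zetaReg s‖ ≤ C * (1 + ‖s‖) ^ A := by
  refine ⟨2, 5, fun s hs => (norm_zetaReg_le (by linarith)).trans ?_⟩
  have h1 : ‖s - 1‖ ≤ ‖s‖ + 1 := (norm_sub_le _ _).trans (by rw [norm_one])
  have h2 : ‖s‖ * ‖s - 1‖ / s.re ≤ ‖s‖ * (‖s‖ + 1) * 4 := by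
    rw [div_le_iff₀ (by linarith)]
    have : ‖s‖ * ‖s - 1‖ ≤ ‖s‖ * (‖s‖ + 1) := by gcongr
    have h0 : 0 ≤ ‖s‖ * (‖s‖ + 1) := by positivity
    nlinarith
  nlinarith [norm_nonneg s]

/-- Horizontal monotonicity for `ζ`: the additional factor `s` in the gamma factor makes `s (s - 1)
ζ(s)`, completed, symmetric about the critical line. -/
theorem norm_zetaReg_le_exp_mul (hGRH : QuadraticGRH) {δ : ℝ} (hδ : 0 < δ) (hδ2 : δ ≤ 1 / 2)
    {s : ℂ} (hs : 1 / 2 ≤ s.re) (hs1 : s.re ≤ 1) :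
    ‖zetaReg s‖ ≤ Real.exp (δ * (7 + 1 / 2 * Real.log (2 + |s.im|))) * ‖zetaReg (s + δ)‖ := by
  obtain ⟨U, hUd, hexp, hU⟩ := exists_log_zetaReg hGRH
  obtain ⟨C, hC, hUC⟩ := exists_norm_log_zetaReg_le hU
  obtain ⟨C', hC', hl⟩ := exists_norm_LSeries_logCoeff_le (f := fun _ : ℕ => 1) fun n => by simp
  have hne : ∀ s : ℂ, 0 < s.re → s ≠ 0 := fun s hs => by rintro rfl; simp at hs
  have hadd : ∀ (s : ℂ) (δ : ℝ), 0 ≤ s.re → 0 ≤ δ → ‖s‖ ≤ ‖s + δ‖ := fun s δ hs hδ => by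
    rw [Complex.norm_eq_sqrt_sq_add_sq, Complex.norm_eq_sqrt_sq_add_sq]
    apply Real.sqrt_le_sqrt
    simp
    gcongr
    linarith
  have h := norm_le_exp_mul_norm_add (U := U) (F := zetaReg) (N := 1)
    (γ := fun s => s * Complex.Gammaℝ s) one_pos differentiable_zetaReg hUd hexp
    exists_norm_zetaReg_le_pow ⟨C, hUC⟩
    (fun s hs => differentiableAt_id.mul (differentiableAt_Gammaℝ hs))
    (fun s hs => mul_ne_zero (hne s hs) (Complex.Gammaℝ_ne_zero_of_re_pos hs))
    (fun δ hδ => ?_) (fun s δ hs hs1 hδ hδ1 => ?_) (fun δ hδ => ?_)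
    (fun s hs hs1 => ?_) (fun s hs => ?_) hδ hδ2 hs hs1
  · simpa using h
  · obtain ⟨C, hC, h⟩ := exists_norm_Gammaℝ_le_add hδ
    refine ⟨C, hC, fun s hs => ?_⟩
    rw [norm_mul, norm_mul, mul_left_comm]
    exact mul_le_mul (hadd s δ (by linarith) hδ.le) (h s hs) (norm_nonneg _) (norm_nonneg _)
  · rw [norm_mul, norm_mul]
    have h1 := norm_Gammaℝ_add_le (s := s) (by linarith) (by linarith) hδ hδ1
    have h2 : ‖s + δ‖ ≤ Real.exp (2 * δ) * ‖s‖ := by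
      have h3 : 1 / 2 ≤ ‖s‖ := hs.trans (Complex.re_le_norm s)
      have h4 : ‖s + δ‖ ≤ ‖s‖ + δ := (norm_add_le _ _).trans (by
        rw [Complex.norm_real, Real.norm_of_nonneg hδ])
      have h5 := Real.add_one_le_exp (2 * δ)
      nlinarith
    calc _ ≤ (Real.exp (2 * δ) * ‖s‖) * (Real.exp (δ * (Real.log (2 + |s.im|) / 2 + 5)) *
          ‖Complex.Gammaℝ s‖) := by gcongr
      _ = _ := by
        have e : Real.exp (δ * (Real.log (2 + |s.im|) / 2 + 7)) = Real.exp (2 * δ) *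
          Real.exp (δ * (Real.log (2 + |s.im|) / 2 + 5)) := by rw [← Real.exp_add]; ring_nf
        rw [e]; ring
  · refine ⟨Real.exp (2 * C'), fun x hx => ?_⟩
    have e : ((x : ℂ) + δ).re = x + δ := by simp
    have hx1 : (x : ℂ) ≠ 1 := by
      have : x ≠ 1 := by linarith
      exact_mod_cast this
    have hx2 : (x : ℂ) + δ ≠ 1 := by
      have : x + δ ≠ 1 := by linarith
      exact_mod_cast this
    rw [zetaReg_of_ne_one hx1, zetaReg_of_ne_one hx2, norm_mul, norm_mul, mul_left_comm,
      ← exp_logZeta (by rw [Complex.ofReal_re]; linarith), ← exp_logZeta (by rw [e]; linarith)]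
    refine mul_le_mul ?_ (norm_le_exp_mul_of_norm_log_le (hl _ (by rw [Complex.ofReal_re]; linarith))
      (hl _ (by rw [e]; linarith)) (by linarith)) (norm_nonneg _) (norm_nonneg _)
    have := hadd (x - 1) δ (by simp; linarith) hδ.le
    rwa [sub_add_eq_add_sub] at this
  · have h0 : s ≠ 0 := hne s hs
    have h1 : s ≠ 1 := by rintro rfl; simp at hs1
    have h2 : 1 - s ≠ 0 := sub_ne_zero.2 h1.symm
    have h3 : 1 - s ≠ 1 := by rw [Ne, sub_eq_self]; exact h0
    have e : ∀ z : ℂ, z ≠ 0 → z ≠ 1 → 0 < z.re →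
        z * Complex.Gammaℝ z * zetaReg z = z * (z - 1) * completedRiemannZeta z := fun z z0 z1 zr => by
      rw [zetaReg_of_ne_one z1, riemannZeta_def_of_ne_zero z0]
      have := Complex.Gammaℝ_ne_zero_of_re_pos zr
      field_simp
    simp only [Complex.ofReal_one, Complex.one_cpow, one_mul]
    rw [e s h0 h1 hs, e (1 - s) h2 h3 (by simp; linarith), completedRiemannZeta_one_sub]
    congr 2; ring
  · rw [norm_mul, norm_mul, norm_mul (s * _), norm_mul s, norm_Gammaℝ_conj, RCLike.norm_conj]
    congr 1
    rcases eq_or_ne s 1 with rfl | h1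
    · simp
    · have h2 : conj s ≠ 1 := by
        rw [Ne, map_eq_one_iff _ (starRingEnd ℂ).injective]; exact h1
      rw [zetaReg_of_ne_one h1, zetaReg_of_ne_one h2, riemannZeta_conj, norm_mul, norm_mul,
        RCLike.norm_conj]
      congr 1
      rw [← RCLike.norm_conj, map_sub, map_one, Complex.conj_conj]

/-! ### The three lines theorem for functions of logarithmic growth -/

/-- The three lines theorem for a function of logarithmic growth, localized at the height of `s` by
the factor `1 / (w + 2 - i Im s)`. -/
theorem norm_le_of_log_growth {G : ℂ → ℂ} {l u K M : ℝ} (hl : 1 / 2 < l) (hlu : l < u) (hu : u ≤ 3)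
    (hK : 0 ≤ K) (hGd : DifferentiableOn ℂ G {s | 1 / 2 < s.re})
    (hG : ∀ s : ℂ, l ≤ s.re → ‖G s‖ ≤ K * Real.log (2 + ‖s‖))
    (hM : ∀ s : ℂ, s.re = u → ‖G s‖ ≤ M) {s : ℂ} (hs : l ≤ s.re) (hsu : s.re ≤ u) :
    ‖G s‖ ≤ 5 * ((K * (Real.log (5 + |s.im|) + 1)) ^ (1 - (s.re - l) / (u - l)) *
      M ^ ((s.re - l) / (u - l))) := by
  -- Dividing by `D` makes `G` bounded on the strip, at the cost of a factor at most `5` at `s`.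
  set D : ℂ → ℂ := fun w => w + (2 - s.im * Complex.I) with hD
  have hDre : ∀ w, (D w).re = w.re + 2 := fun w => by simp [hD]
  have hDim : ∀ w, (D w).im = w.im - s.im := fun w => by simp [hD]; ring
  have hD1 : ∀ w : ℂ, l ≤ w.re → 1 ≤ ‖D w‖ := fun w hw => by
    have := Complex.re_le_norm (D w)
    rw [hDre] at this
    linarith
  have hD0 : ∀ w : ℂ, l ≤ w.re → D w ≠ 0 := fun w hw h => by
    have := hD1 w hw
    rw [h, norm_zero] at this
    linarith
  have hb : ∀ w : ℂ, l ≤ w.re → w.re ≤ u → ‖G w / D w‖ ≤ K * (Real.log (5 + |s.im|) + 1) := by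
    intro w hw hwu
    rw [norm_div, div_le_iff₀ (by linarith [hD1 w hw])]
    refine (hG w hw).trans ?_
    have h1 : ‖w‖ ≤ 3 + |w.im| := (Complex.norm_le_abs_re_add_abs_im w).trans (by
      rw [abs_of_nonneg (by linarith)]; linarith)
    have h2 : |w.im| ≤ |s.im| + |w.im - s.im| := by
      have := abs_add_le s.im (w.im - s.im)
      rwa [add_sub_cancel] at this
    have h3 : 2 + ‖w‖ ≤ (5 + |s.im|) * (1 + |w.im - s.im|) := by
      nlinarith [abs_nonneg s.im, abs_nonneg (w.im - s.im),
        mul_nonneg (abs_nonneg s.im) (abs_nonneg (w.im - s.im))]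
    have h4 : Real.log (2 + ‖w‖) ≤ Real.log (5 + |s.im|) + |w.im - s.im| := by
      refine (Real.log_le_log (by positivity) h3).trans ?_
      rw [Real.log_mul (by positivity) (by positivity)]
      have := Real.log_le_sub_one_of_pos (by positivity : 0 < 1 + |w.im - s.im|)
      linarith
    have h5 : |w.im - s.im| ≤ ‖D w‖ := by rw [← hDim]; exact Complex.abs_im_le_norm _
    have h6 : 0 ≤ Real.log (5 + |s.im|) := Real.log_nonneg (by linarith [abs_nonneg s.im])
    rw [mul_assoc]
    refine mul_le_mul_of_nonneg_left ?_ hK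
    nlinarith [hD1 w hw]
  have hstrip : ∀ w : ℂ, w ∈ Complex.HadamardThreeLines.verticalClosedStrip l u →
      l ≤ w.re ∧ w.re ≤ u := fun w hw => hw
  have hdiff : DifferentiableOn ℂ (fun w => G w / D w) {w | l - (l - 1 / 2) / 2 < w.re} := by
    intro w hw
    have hw' : l - (l - 1 / 2) / 2 < w.re := hw
    have hw2 : 1 / 2 < w.re := by linarith
    refine ((hGd.differentiableAt (isOpen_half_lt_re.mem_nhds hw2)).div
      (differentiableAt_id.add_const _) ?_).differentiableWithinAt
    intro h
    have := congrArg Complex.re h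
    change (D w).re = _ at this
    rw [hDre, Complex.zero_re] at this
    linarith
  have key := Complex.HadamardThreeLines.norm_le_interp_of_mem_verticalClosedStrip' (f := fun w => G w / D w)
    (z := s) (a := K * (Real.log (5 + |s.im|) + 1)) (b := M) hlu ⟨hs, hsu⟩ ?_ ?_ ?_ ?_
  · have hDs : ‖D s‖ ≤ 5 := by
      have : D s = ((s.re + 2 : ℝ) : ℂ) := by
        apply Complex.ext
        · rw [hDre, Complex.ofReal_re]
        · rw [hDim, Complex.ofReal_im, sub_self]
      rw [this, Complex.norm_real, Real.norm_of_nonneg (by linarith)]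
      linarith
    have e : G s = G s / D s * D s := by rw [div_mul_cancel₀ _ (hD0 s hs)]
    rw [e, norm_mul, mul_comm]
    exact mul_le_mul hDs key (norm_nonneg _) (by norm_num)
  · refine DifferentiableOn.diffContOnCl (hdiff.mono fun w hw => ?_)
    have hcl : closure (Complex.HadamardThreeLines.verticalStrip l u) ⊆
        Complex.HadamardThreeLines.verticalClosedStrip l u :=
      closure_minimal (fun w hw => ⟨hw.1.le, hw.2.le⟩)
        (isClosed_Icc.preimage Complex.continuous_re)
    have := (hstrip w (hcl hw)).1
    exact show l - (l - 1 / 2) / 2 < w.re by linarith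
  · refine ⟨K * (Real.log (5 + |s.im|) + 1), ?_⟩
    rintro _ ⟨w, hw, rfl⟩
    exact hb w (hstrip w hw).1 (hstrip w hw).2
  · intro w hw
    have hw' : w.re = l := hw
    exact hb w hw'.ge (by linarith)
  · intro w hw
    have hw' : w.re = u := hw
    rw [norm_div]
    exact div_le_of_le_mul₀ (norm_nonneg _) ((norm_nonneg _).trans (hM w hw'))
      ((hM w hw').trans (le_mul_of_one_le_right ((norm_nonneg _).trans (hM w hw'))
        (hD1 w (by linarith))))

/-- The simple pole of `ζ`: `log ζ(1 + x) = -log x + O(1)` for `0 < x ≤ 2`. -/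
theorem exists_abs_log_norm_zetaReg_le :
    ∃ C : ℝ, 0 < C ∧ ∀ x : ℝ, 0 < x → x ≤ 2 →
      |Real.log ‖riemannZeta (1 + x)‖ + Real.log x| ≤ C := by
  have hcont : ContinuousOn (fun x : ℝ => Real.log ‖zetaReg (1 + x)‖) (Set.Icc 0 2) := by
    refine ContinuousOn.log ?_ ?_
    · exact ((differentiable_zetaReg.continuous.comp
        (continuous_const.add Complex.continuous_ofReal)).norm).continuousOn
    · intro x hx
      rw [norm_ne_zero_iff]
      rcases eq_or_ne x 0 with rfl | h
      · simp [zetaReg_one]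
      · rw [zetaReg_of_ne_one (by simpa using h)]
        refine mul_ne_zero (by simpa using h) (riemannZeta_ne_zero_of_one_le_re ?_)
        simpa using hx.1
  obtain ⟨C, hC⟩ := isCompact_Icc.exists_bound_of_continuousOn hcont
  refine ⟨|C| + 1, by positivity, fun x hx hx2 => ?_⟩
  have h1 := hC x ⟨hx.le, hx2⟩
  have h2 : (x : ℂ) ≠ 0 := by exact_mod_cast hx.ne'
  have hz : riemannZeta (1 + x) ≠ 0 :=
    riemannZeta_ne_zero_of_one_le_re (by simpa using hx.le)
  rw [zetaReg_of_ne_one (by simpa using h2), add_sub_cancel_left, norm_mul, Complex.norm_real,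
    Real.norm_of_nonneg hx.le, Real.log_mul hx.ne' (norm_ne_zero_iff.2 hz), Real.norm_eq_abs] at h1
  rw [add_comm]
  linarith [le_abs_self C]

theorem logZeta_ofReal_re {x : ℝ} (hx : 1 < x) : (logZeta x).re = Real.log ‖riemannZeta x‖ := by
  rw [← exp_logZeta (by simpa using hx), Complex.norm_exp, Real.log_exp]

/-- The coefficients of `log ζ` are nonnegative, so it is largest on the real axis. -/
theorem norm_logZeta_le {s : ℂ} (hs : 1 < s.re) :
    ‖logZeta s‖ ≤ Real.log ‖riemannZeta s.re‖ := by
  have hs' : 1 < (s.re : ℂ).re := by simpa using hs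
  rw [← logZeta_ofReal_re hs, logZeta, LSeries, logZeta, LSeries,
    Complex.re_tsum (LSeriesSummable_logCoeff (fun n => by simp) hs')]
  have hsum : Summable fun n => ‖LSeries.term (logCoeff fun _ => 1) (s.re : ℂ) n‖ :=
    (LSeriesSummable_logCoeff (f := fun _ => 1) (fun n => by simp) hs').norm
  have hre : ∀ n, (LSeries.term (logCoeff fun _ => 1) (s.re : ℂ) n).re =
      ‖LSeries.term (logCoeff fun _ => 1) (s.re : ℂ) n‖ := fun n => by
    rcases eq_or_ne n 0 with rfl | hn
    · simp
    · have e : LSeries.term (logCoeff fun _ => 1) (s.re : ℂ) n =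
          ((ArithmeticFunction.vonMangoldt n / Real.log n / (n : ℝ) ^ s.re : ℝ) : ℂ) := by
        rw [LSeries.term_of_ne_zero hn, logCoeff, one_mul, Complex.ofReal_div,
          Complex.ofReal_cpow (Nat.cast_nonneg n)]
        simp
      rw [e, Complex.ofReal_re, Complex.norm_real, Real.norm_of_nonneg]
      have := ArithmeticFunction.vonMangoldt_nonneg (n := n)
      have := Real.log_natCast_nonneg n
      positivity
  simp only [hre]
  refine tsum_of_norm_bounded hsum.hasSum fun n => ?_
  exact LSeries.norm_term_le_of_re_le_re _ (by simp) n

/-! ### Consequences of the Riemann hypothesis for `ζ` -/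

/-- Weighted arithmetic-geometric mean: a power with exponent below `1` is at most `ε A + O(1)`. -/
theorem exists_mul_rpow_le {θ ε M : ℝ} (hθ : 0 < θ) (hθ1 : θ ≤ 1) (hε : 0 < ε) (hM : 0 ≤ M) :
    ∃ C : ℝ, 0 ≤ C ∧ ∀ A : ℝ, 0 ≤ A → M * A ^ (1 - θ) ≤ ε * A + C := by
  set c := (M * (ε ^ (1 - θ))⁻¹) ^ θ⁻¹ with hc
  have hc0 : 0 ≤ c := by positivity
  refine ⟨c, hc0, fun A hA => ?_⟩
  have h := Real.geom_mean_le_arith_mean2_weighted (w₁ := 1 - θ) (w₂ := θ) (p₁ := ε * A) (p₂ := c)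
    (by linarith) hθ.le (by positivity) hc0 (by ring)
  rw [hc, ← Real.rpow_mul (by positivity), inv_mul_cancel₀ hθ.ne', Real.rpow_one,
    Real.mul_rpow hε.le hA, ← hc] at h
  have he : ε ^ (1 - θ) ≠ 0 := (Real.rpow_pos_of_pos hε _).ne'
  have e : ε ^ (1 - θ) * A ^ (1 - θ) * (M * (ε ^ (1 - θ))⁻¹) = M * A ^ (1 - θ) := by
    field_simp
  rw [e] at h
  have h1 : (1 - θ) * (ε * A) ≤ ε * A := mul_le_of_le_one_left (by positivity) (by linarith)
  have h2 : θ * c ≤ c := mul_le_of_le_one_left hc0 hθ1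
  linarith

/-- Under RH, a logarithm of `ζ(s) (s - 1) / (s + 1)` on `Re s > 1/2`, where the factor
`(s - 1) / (s + 1)` removes the pole without affecting the size at large height. -/
theorem exists_log_zeta (hGRH : QuadraticGRH) :
    ∃ G : ℂ → ℂ, DifferentiableOn ℂ G {s | 1 / 2 < s.re} ∧
      (∀ s : ℂ, 1 / 2 < s.re → Complex.exp (G s) * (s + 1) = zetaReg s) ∧
      (∀ h : ℝ, 0 < h → h ≤ 1 → ∃ K : ℝ, 1 ≤ K ∧
        ∀ s : ℂ, 1 / 2 + h ≤ s.re → ‖G s‖ ≤ K * Real.log (2 + ‖s‖)) ∧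
      ∃ C : ℝ, 1 ≤ C ∧ ∀ s : ℂ, 1 < s.re → s.re ≤ 3 → ‖G s‖ ≤ 2 * Real.log (s.re - 1)⁻¹ + C := by
  obtain ⟨U, hUd, hexp, hU⟩ := exists_log_zetaReg hGRH
  obtain ⟨C, hC, hUC⟩ := exists_norm_log_zetaReg_le hU
  obtain ⟨C₁, hC₁, hz⟩ := exists_abs_log_norm_zetaReg_le
  have hne : ∀ s : ℂ, 1 / 2 < s.re → s + 1 ≠ 0 := fun s hs h => by
    have := congrArg Complex.re h
    simp at this
    linarith
  refine ⟨fun s => U s - Complex.log (s + 1), hUd.sub fun s hs => ?_, fun s hs => ?_,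
    fun h h0 h1 => ?_, Real.log 4 + C₁ + 2 * Real.pi, ?_, fun s hs hs3 => ?_⟩
  · have hs' : 1 / 2 < s.re := hs
    exact ((differentiableAt_id.add_const 1).clog
      (Or.inl (by simp; linarith))).differentiableWithinAt
  · rw [Complex.exp_sub, hexp s hs, Complex.exp_log (hne s hs), div_mul_cancel₀ _ (hne s hs)]
  · obtain ⟨K, hK, hUK⟩ := exists_norm_log_le hUd hexp exists_norm_zetaReg_le_pow ⟨C, hUC⟩ h0 h1
    have hπ : 0 ≤ Real.pi / Real.log 2 := div_nonneg Real.pi_pos.le (Real.log_pos one_lt_two).le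
    refine ⟨K + 3 * (1 + Real.pi / Real.log 2), by linarith, fun s hs => ?_⟩
    have h2 := norm_clog_sub_one_le (s := s + 2) (by simp; linarith)
    rw [show s + 2 - 1 = s + 1 by ring] at h2
    have h3 : Real.log (2 + ‖s + 2‖) ≤ 3 * Real.log (2 + ‖s‖) := by
      refine (Real.log_le_log (by positivity) (?_ : 2 + ‖s + 2‖ ≤ 2 + ‖s‖ + 2)).trans
        (log_two_add_add_le (norm_nonneg s) (by norm_num) (by norm_num))
      have := norm_add_le s 2
      rw [Complex.norm_ofNat] at this
      linarith
    have h4 := hUK s hs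
    have h5 : (1 + Real.pi / Real.log 2) * Real.log (2 + ‖s + 2‖) ≤
        (1 + Real.pi / Real.log 2) * (3 * Real.log (2 + ‖s‖)) := by gcongr
    refine (norm_sub_le _ _).trans ?_
    linarith
  · have := Real.log_nonneg (by norm_num : (1 : ℝ) ≤ 4)
    linarith [Real.pi_gt_three]
  · have h1 : 0 < s.re - 1 := by linarith
    have hr : s.re - 1 ≤ ‖s - 1‖ := by simpa using Complex.re_le_norm (s - 1)
    have hr0 : 0 < ‖s - 1‖ := by linarith
    have hre : ‖s - 1‖ ≤ ‖s + 1‖ := by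
      rw [Complex.norm_eq_sqrt_sq_add_sq, Complex.norm_eq_sqrt_sq_add_sq]
      apply Real.sqrt_le_sqrt
      simp
      nlinarith
    have hle : ‖s + 1‖ ≤ ‖s - 1‖ + 2 := by
      have e : s + 1 = (s - 1) + 2 := by ring
      rw [e]
      exact (norm_add_le _ _).trans (by rw [Complex.norm_ofNat])
    have h2 : ‖logZeta s‖ ≤ Real.log (s.re - 1)⁻¹ + C₁ := by
      refine (norm_logZeta_le hs).trans ?_
      have := (abs_le.1 (hz (s.re - 1) h1 (by linarith))).2
      rw [show (1 : ℂ) + (s.re - 1 : ℝ) = s.re by push_cast; ring] at this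
      rw [Real.log_inv]
      linarith
    have h3 : ‖Complex.log (s - 1) - Complex.log (s + 1)‖ ≤
        Real.log (s.re - 1)⁻¹ + Real.log 4 + 2 * Real.pi := by
      refine (Complex.norm_le_abs_re_add_abs_im _).trans (add_le_add ?_ ?_)
      · rw [Complex.sub_re, Complex.log_re, Complex.log_re, abs_sub_comm, abs_of_nonneg
          (sub_nonneg.2 (Real.log_le_log hr0 hre)), ← Real.log_div (by linarith) hr0.ne',
          ← Real.log_mul (inv_ne_zero h1.ne') (by norm_num)]
        refine Real.log_le_log (div_pos (by linarith) hr0) ?_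
        rw [div_le_iff₀ hr0, mul_assoc, inv_mul_eq_div, le_div_iff₀ h1]
        nlinarith
      · rw [Complex.sub_im, Complex.log_im, Complex.log_im]
        have a1 := Complex.abs_arg_le_pi (s - 1)
        have a2 := Complex.abs_arg_le_pi (s + 1)
        exact (abs_sub _ _).trans (by linarith)
    have e : U s - Complex.log (s + 1) = (Complex.log (s - 1) - Complex.log (s + 1)) + logZeta s := by
      rw [hU s hs]; ring
    change ‖U s - Complex.log (s + 1)‖ ≤ _
    rw [e]
    refine (norm_add_le _ _).trans ?_
    linarith

theorem log_le_two_mul_log {x : ℝ} (hx : 10 ≤ x) : Real.log (5 + x) ≤ 2 * Real.log x := by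
  rw [← Real.log_rpow (by linarith)]
  refine Real.log_le_log (by linarith) ?_
  norm_num
  nlinarith

theorem two_lt_log_ten : 2 < Real.log 10 := by
  rw [Real.lt_log_iff_exp_lt (by norm_num), show (2 : ℝ) = 1 + 1 by norm_num, Real.exp_add]
  have := Real.exp_one_lt_d9
  have h0 := Real.exp_pos 1
  nlinarith

/-- The Lindelöf bound for `ζ` to the right of the critical line, under RH. -/
theorem exists_norm_riemannZeta_le (hGRH : QuadraticGRH) {ε : ℝ} (hε : 0 < ε) :
    ∃ C : ℝ, 0 < C ∧ ∀ X : ℝ, 10 ≤ X → ∀ z : ℂ, 0 ≤ z.re → z.re ≤ 1 / Real.log X → |z.im| ≤ X →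
      ‖riemannZeta (1 / 2 + z)‖ ≤ C * X ^ ε := by
  obtain ⟨G, hGd, hGexp, hGK, C₁, hC₁, hGC⟩ := exists_log_zeta hGRH
  -- Moving from `s` to `s + 2 h` costs `h log T`, and the three lines theorem between the
  -- abscissas `1/2 + h` and `2` bounds `G(s + 2 h)` by a power of `log T` below the first.
  set h : ℝ := min (1 / 8) (ε / 4) with hh
  have h0 : 0 < h := lt_min (by norm_num) (by positivity)
  have h8 : h ≤ 1 / 8 := min_le_left _ _
  obtain ⟨K, hK, hGK⟩ := hGK h h0 (by linarith)
  obtain ⟨C₂, hC₂, hpow⟩ := exists_mul_rpow_le (θ := h / 2) (ε := h / K) (M := 5 * C₁) (by positivity)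
    (by linarith) (by positivity) (by linarith)
  set c : ℝ := 1 / 2 - 1 / Real.log 10 with hc
  have hc0 : 0 < c := by
    have := two_lt_log_ten
    rw [hc, sub_pos]
    exact one_div_lt_one_div_of_lt two_pos this
  refine ⟨Real.exp (14 * h + h + C₂) * (1 + 3 / c), by positivity, fun X hX z hz hz1 hzX => ?_⟩
  have hlX : Real.log 10 ≤ Real.log X := Real.log_le_log (by norm_num) hX
  have hz2 : z.re ≤ 1 / 2 - c := hz1.trans (by
    rw [hc, sub_sub_cancel]
    exact one_div_le_one_div_of_le (by linarith [two_lt_log_ten]) hlX)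
  set s : ℂ := 1 / 2 + z with hs
  have hsre : s.re = 1 / 2 + z.re := by simp [hs]
  have hsim : s.im = z.im := by simp [hs]
  have hs1 : c ≤ ‖s - 1‖ := by
    have h1 := Complex.abs_re_le_norm (s - 1)
    have h2 : (s - 1).re = -(1 / 2 - z.re) := by simp [hsre]; ring
    rw [h2, abs_neg, abs_of_nonneg (by linarith)] at h1
    linarith
  have hs10 : 0 < ‖s - 1‖ := by linarith
  have h1 := norm_zetaReg_le_exp_mul hGRH (δ := 2 * h) (by linarith) (by linarith) (s := s)
    (by linarith) (by linarith)
  set w : ℂ := s + (2 * h : ℝ) with hw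
  have hwre : w.re = 1 / 2 + z.re + 2 * h := by rw [hw, Complex.add_re, hsre, Complex.ofReal_re]
  have hwim : w.im = z.im := by rw [hw, Complex.add_im, hsim, Complex.ofReal_im, add_zero]
  have h2 := norm_le_of_log_growth (l := 1 / 2 + h) (u := 2) (K := K) (M := C₁) (by linarith)
    (by linarith) (by norm_num) (by linarith) hGd hGK (fun s hs => by
      have := hGC s (by linarith) (by linarith)
      rw [hs] at this
      norm_num at this
      linarith) (s := w) (by linarith) (by linarith)
  set L : ℝ := Real.log (5 + |w.im|) with hL
  have hL1 : 1 ≤ L := by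
    rw [hL, Real.le_log_iff_exp_le (by positivity)]
    linarith [Real.exp_one_lt_d9, abs_nonneg w.im]
  have hLX : L ≤ 2 * Real.log X := by
    refine (Real.log_le_log (by positivity) ?_).trans (log_le_two_mul_log hX)
    rw [hwim]; linarith
  set θ := (w.re - (1 / 2 + h)) / (2 - (1 / 2 + h)) with hθ
  have hθ0 : h / 2 ≤ θ := by
    rw [hθ, div_le_div_iff₀ two_pos (by linarith)]
    nlinarith
  have hθ1 : θ ≤ 1 := by
    rw [hθ, div_le_one (by linarith)]
    linarith
  have hA : 1 ≤ K * (L + 1) := by nlinarith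
  -- A power of `K (L + 1)` with exponent `1 - θ < 1` is at most `h / K` times it, up to a
  -- constant.
  have h3 : ‖G w‖ ≤ h * (L + 1) + C₂ := by
    refine h2.trans (le_trans ?_ ((hpow (K * (L + 1)) (by linarith)).trans (le_of_eq ?_)))
    · have e1 : (K * (L + 1)) ^ (1 - θ) ≤ (K * (L + 1)) ^ (1 - h / 2) :=
        Real.rpow_le_rpow_of_exponent_le hA (by linarith)
      have e2 : C₁ ^ θ ≤ C₁ := by
        conv_rhs => rw [← Real.rpow_one C₁]
        exact Real.rpow_le_rpow_of_exponent_le hC₁ hθ1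
      calc _ ≤ 5 * ((K * (L + 1)) ^ (1 - h / 2) * C₁) := by gcongr
        _ = _ := by ring
    · have : K ≠ 0 := by linarith
      field_simp
  have h4 : ‖zetaReg w‖ ≤ Real.exp (h * (L + 1) + C₂) * (‖s - 1‖ + 3) := by
    rw [← hGexp w (by linarith), norm_mul, Complex.norm_exp]
    refine mul_le_mul (Real.exp_le_exp.2 ((Complex.re_le_norm _).trans h3)) ?_ (norm_nonneg _)
      (Real.exp_pos _).le
    have e : w + 1 = (s - 1) + ((2 + 2 * h : ℝ) : ℂ) := by rw [hw]; push_cast; ring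
    rw [e]
    refine (norm_add_le _ _).trans ?_
    rw [Complex.norm_real, Real.norm_of_nonneg (by linarith)]
    linarith
  have h5 : Real.log (2 + |s.im|) ≤ L := by
    rw [hL, hwim, hsim]
    exact Real.log_le_log (by positivity) (by linarith)
  have h6 : zetaReg s = (s - 1) * riemannZeta s :=
    zetaReg_of_ne_one (sub_ne_zero.1 (norm_pos_iff.1 hs10))
  have h7 : ‖s - 1‖ * ‖riemannZeta s‖ ≤
      Real.exp (14 * h + h + C₂ + 2 * h * L) * (‖s - 1‖ + 3) := by
    rw [← norm_mul, ← h6]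
    refine h1.trans ?_
    calc _ ≤ Real.exp (2 * h * (7 + 1 / 2 * L)) *
          (Real.exp (h * (L + 1) + C₂) * (‖s - 1‖ + 3)) := by gcongr
      _ = _ := by rw [← mul_assoc, ← Real.exp_add]; ring_nf
  have h8 : ‖riemannZeta s‖ ≤ Real.exp (14 * h + h + C₂ + 2 * h * L) * (1 + 3 / c) := by
    rw [← le_div_iff₀' hs10] at h7
    refine h7.trans ?_
    rw [mul_div_assoc]
    gcongr
    rw [add_div, div_self hs10.ne']
    gcongr
  refine h8.trans ?_
  rw [Real.exp_add, mul_right_comm]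
  gcongr
  rw [Real.rpow_def_of_pos (by linarith), Real.exp_le_exp]
  have h9 : h ≤ ε / 4 := min_le_right _ _
  have : 0 ≤ Real.log X := by linarith [two_lt_log_ten]
  nlinarith

/-- Under RH, `log |ζ|` near the line `Re s = 1` is controlled by the pole, up to a triple logarithm.
The strip from `3/4` to `1 + 1 / log log T` is used in the three lines theorem. -/
theorem exists_log_norm_riemannZeta_le (hGRH : QuadraticGRH) :
    ∃ C : ℝ, 0 < C ∧ ∀ T : ℝ, 16 ≤ T → ∀ x t : ℝ, 0 < x → x ≤ 2 → |t| ≤ T →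
      Real.log ‖riemannZeta (1 + x + t * Complex.I)‖ ≤
        max 0 (-Real.log ‖(x + t * Complex.I : ℂ)‖) +
          C * (1 + Real.log (Real.log (Real.log T))) := by
  obtain ⟨G, hGd, hGexp, hGK, C₁, hC₁, hGC⟩ := exists_log_zeta hGRH
  obtain ⟨K, hK, hGK⟩ := hGK (1 / 4) (by norm_num) (by norm_num)
  set K' : ℝ := 3 * K with hK'
  set B : ℝ := 5 * (K' ^ 4 * Real.exp 4) with hB
  have hB1 : 1 ≤ B := by
    have h1 : 1 ≤ K' ^ 4 := one_le_pow₀ (by linarith)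
    have h2 : 1 ≤ Real.exp 4 := Real.one_le_exp (by norm_num)
    nlinarith
  refine ⟨B * (2 + C₁) + Real.log 3, ?_, fun T hT x t hx hx2 ht => ?_⟩
  · have := Real.log_nonneg (by norm_num : (1 : ℝ) ≤ 3)
    nlinarith
  have hl1 : Real.exp 1 ≤ Real.log T := by
    have h2 : Real.log 16 ≤ Real.log T := Real.log_le_log (by norm_num) hT
    have h3 : Real.log 16 = 4 * Real.log 2 := by
      rw [show (16 : ℝ) = 2 ^ 4 by norm_num, Real.log_pow]; norm_num
    linarith [Real.log_two_gt_d9, Real.exp_one_lt_d9]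
  have hl0 : 0 < Real.log T := (Real.exp_pos 1).trans_le hl1
  set ll := Real.log (Real.log T) with hll
  have hll1 : 1 ≤ ll := by rwa [hll, Real.le_log_iff_exp_le hl0]
  have hlll : 0 ≤ Real.log ll := Real.log_nonneg hll1
  set M : ℝ := 2 * Real.log ll + C₁ with hM
  have hM1 : 1 ≤ M := by linarith
  have hGC' : ∀ s : ℂ, 1 + ll⁻¹ ≤ s.re → s.re ≤ 3 → ‖G s‖ ≤ M := fun s hs hs3 => by
    have hp : 0 < ll⁻¹ := by positivity
    refine (hGC s (by linarith) hs3).trans ?_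
    rw [hM]
    gcongr
    · exact inv_pos.2 (by linarith)
    · rw [inv_le_comm₀ (by linarith) (by linarith)]
      linarith
  have hη : ll⁻¹ ≤ 1 := inv_le_one_of_one_le₀ hll1
  have hη0 : 0 < ll⁻¹ := by positivity
  set s : ℂ := 1 + x + t * Complex.I with hs
  have hsre : s.re = 1 + x := by simp [hs]
  have hsim : s.im = t := by simp [hs]
  -- Close to the line `Re s = 1` the three lines theorem applies. The weight of the left edge is
  -- at most `4 / log log T`, and `(log T) ^ (4 / log log T) = e ^ 4`.
  have hG : ‖G s‖ ≤ B * M := by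
    rcases le_total ll⁻¹ x with h | h
    · exact (hGC' s (by linarith) (by linarith)).trans (le_mul_of_one_le_left (by linarith) hB1)
    · have h2 := norm_le_of_log_growth (l := 3 / 4) (u := 1 + ll⁻¹) (K := K) (M := M) (by norm_num)
        (by linarith) (by linarith) (by linarith) hGd (fun s hs => hGK s (by linarith))
        (fun s hs => hGC' s hs.ge (by linarith)) (s := s) (by linarith) (by linarith)
      set θ := (s.re - 3 / 4) / (1 + ll⁻¹ - 3 / 4) with hθ
      have hd : 0 < 1 + ll⁻¹ - 3 / 4 := by linarith
      have hθ0 : 0 ≤ θ := div_nonneg (by linarith) hd.le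
      have hθ1 : θ ≤ 1 := by rw [hθ, div_le_one hd]; linarith
      have hθ2 : 1 - θ ≤ 4 * ll⁻¹ := by
        have : 1 - θ = (ll⁻¹ - x) / (1 + ll⁻¹ - 3 / 4) := by
          rw [hθ, hsre, eq_div_iff hd.ne', sub_mul, div_mul_cancel₀ _ hd.ne']; ring
        rw [this, div_le_iff₀ hd]
        nlinarith
      have hL : Real.log (5 + |s.im|) + 1 ≤ 3 * Real.log T := by
        have : Real.log (5 + |s.im|) ≤ 2 * Real.log T := by
          refine (Real.log_le_log (by positivity) ?_).trans (log_le_two_mul_log (by linarith))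
          rw [hsim]; linarith
        linarith [Real.exp_one_gt_d9]
      have hL0 : 0 ≤ Real.log (5 + |s.im|) := Real.log_nonneg (by linarith [abs_nonneg s.im])
      have e1 : (K * (Real.log (5 + |s.im|) + 1)) ^ (1 - θ) ≤ K' ^ 4 * Real.exp 4 := by
        have a1 : K * (Real.log (5 + |s.im|) + 1) ≤ K' * Real.log T := by
          rw [hK']; nlinarith
        have a2 : 1 ≤ K' * Real.log T := by
          have := Real.exp_one_gt_d9
          nlinarith
        have hlT : Real.log T ^ (4 * ll⁻¹) = Real.exp 4 := by
          rw [Real.rpow_def_of_pos hl0, ← hll]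
          congr 1
          have : ll ≠ 0 := by linarith
          field_simp
        calc _ ≤ (K' * Real.log T) ^ (1 - θ) :=
              Real.rpow_le_rpow (by positivity) a1 (by linarith)
          _ ≤ (K' * Real.log T) ^ (4 * ll⁻¹) := Real.rpow_le_rpow_of_exponent_le a2 hθ2
          _ = K' ^ (4 * ll⁻¹) * Real.exp 4 := by
              rw [Real.mul_rpow (by linarith) hl0.le, hlT]
          _ ≤ K' ^ (4 : ℝ) * Real.exp 4 := by
              gcongr
              · linarith
              · linarith
          _ = _ := by norm_cast
      have e2 : M ^ θ ≤ M := by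
        conv_rhs => rw [← Real.rpow_one M]
        exact Real.rpow_le_rpow_of_exponent_le hM1 hθ1
      refine h2.trans ?_
      calc _ ≤ 5 * (K' ^ 4 * Real.exp 4 * M) := by gcongr
        _ = _ := by rw [hB]; ring
  -- Return from `G` to `log |ζ|`.
  set r := ‖(x + t * Complex.I : ℂ)‖ with hr
  have hs1 : s - 1 = x + t * Complex.I := by rw [hs]; ring
  have hr0 : 0 < r := by
    rw [hr, norm_pos_iff, ← hs1, sub_ne_zero]
    intro h
    rw [h] at hsre
    simp at hsre
    linarith
  have hzeta : r * ‖riemannZeta s‖ = Real.exp (G s).re * ‖s + 1‖ := by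
    have h1 := hGexp s (by linarith)
    rw [zetaReg_of_ne_one (by rw [← sub_ne_zero, hs1]; exact norm_pos_iff.1 hr0), hs1] at h1
    have h2 := congrArg norm h1
    rw [norm_mul, norm_mul, Complex.norm_exp] at h2
    rw [← h2]
  have hz0 : 0 < ‖riemannZeta s‖ := norm_pos_iff.2
    (riemannZeta_ne_zero_of_one_le_re (by linarith))
  have hsle : ‖s + 1‖ ≤ r + 2 := by
    have e : s + 1 = (s - 1) + 2 := by ring
    rw [e, hr, ← hs1]
    exact (norm_add_le _ _).trans (by rw [Complex.norm_ofNat])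
  have hs0 : 0 < ‖s + 1‖ := norm_pos_iff.2 fun h => by
    have := congrArg Complex.re h
    simp [hsre] at this
    linarith
  have hlog := congrArg Real.log hzeta
  rw [Real.log_mul hr0.ne' hz0.ne', Real.log_mul (Real.exp_pos _).ne' hs0.ne', Real.log_exp] at hlog
  have hGre : (G s).re ≤ B * M := (Complex.re_le_norm _).trans hG
  have hBM : B * M + Real.log 3 ≤ (B * (2 + C₁) + Real.log 3) * (1 + Real.log ll) := by
    have := Real.log_nonneg (by norm_num : (1 : ℝ) ≤ 3)
    have h1 : M ≤ (2 + C₁) * (1 + Real.log ll) := by rw [hM]; nlinarith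
    have h2 : B * M ≤ B * ((2 + C₁) * (1 + Real.log ll)) := by gcongr
    nlinarith
  rcases le_total r 1 with h | h
  · have h3 : Real.log ‖s + 1‖ ≤ Real.log 3 := Real.log_le_log hs0 (by linarith)
    have := le_max_right 0 (-Real.log r)
    linarith
  · have h3 : Real.log ‖s + 1‖ ≤ Real.log 3 + Real.log r := by
      rw [← Real.log_mul (by norm_num) hr0.ne']
      exact Real.log_le_log hs0 (by linarith)
    have := le_max_left 0 (-Real.log r)
    linarith

/-! ### Sums over primes -/

/-- The primes up to a real bound. -/
noncomputable def primesUpTo (y : ℝ) : Finset ℕ := (Finset.range (⌊y⌋₊ + 1)).filter Nat.Prime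

theorem mem_primesUpTo {y : ℝ} {p : ℕ} (hy : 0 ≤ y) : p ∈ primesUpTo y ↔ p.Prime ∧ (p : ℝ) ≤ y := by
  rw [primesUpTo, Finset.mem_filter, Finset.mem_range, Nat.lt_succ_iff, Nat.le_floor_iff hy, and_comm]

theorem prime_of_mem_primesUpTo {y : ℝ} {p : ℕ} (h : p ∈ primesUpTo y) : p.Prime :=
  (Finset.mem_filter.1 h).2

/-- The Dirichlet series `∑_p c(p) p ^ (-1 - η)`. -/
noncomputable def primeTerm (c : ℕ → ℝ) (η : ℝ) (n : ℕ) : ℝ :=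
  if n.Prime then c n * (n : ℝ) ^ (-(1 + η)) else 0

theorem abs_primeTerm_le {c : ℕ → ℝ} (hc : ∀ n, |c n| ≤ 1) (η : ℝ) (n : ℕ) :
    |primeTerm c η n| ≤ (n : ℝ) ^ (-(1 + η)) := by
  rw [primeTerm]
  have h := Real.rpow_nonneg (Nat.cast_nonneg (α := ℝ) n) (-(1 + η))
  split_ifs
  · rw [abs_mul, abs_of_nonneg h]
    exact mul_le_of_le_one_left h (hc n)
  · simpa using h

theorem summable_primeTerm {c : ℕ → ℝ} (hc : ∀ n, |c n| ≤ 1) {η : ℝ} (hη : 0 < η) :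
    Summable (primeTerm c η) :=
  Summable.of_norm_bounded (g := fun n : ℕ => (n : ℝ) ^ (-(1 + η)))
    (Real.summable_nat_rpow.2 (by linarith)) fun n => abs_primeTerm_le hc η n

theorem natCast_cpow_re {n : ℕ} (hn : 0 < n) (σ t : ℝ) :
    ((n : ℂ) ^ (-(σ + t * Complex.I))).re = Real.cos (t * Real.log n) * (n : ℝ) ^ (-σ) := by
  have hn0 : (n : ℂ) ≠ 0 := by exact_mod_cast hn.ne'
  rw [Complex.cpow_def_of_ne_zero hn0, Complex.exp_re, Complex.natCast_log.symm,
    Real.rpow_def_of_pos (by exact_mod_cast hn)]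
  have h1 : ((Real.log n : ℂ) * -(σ + t * Complex.I)).re = Real.log n * -σ := by
    rw [Complex.re_ofReal_mul]; simp
  have h2 : ((Real.log n : ℂ) * -(σ + t * Complex.I)).im = -(t * Real.log n) := by
    rw [Complex.im_ofReal_mul]; simp; ring
  rw [h1, h2, Real.cos_neg, mul_comm]

/-- Prime powers contribute `O(1)` to `log |ζ|`. -/
theorem exists_abs_log_norm_riemannZeta_sub_le :
    ∃ C : ℝ, 0 < C ∧ ∀ η θ : ℝ, 0 < η →
      |Real.log ‖riemannZeta (1 + η + θ * Complex.I)‖ -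
        ∑' n, primeTerm (fun n => Real.cos (θ * Real.log n)) η n| ≤ C := by
  have hsum2 : Summable fun p : Nat.Primes => ((p : ℝ) ^ (-2 : ℝ)) :=
    Nat.Primes.summable_rpow.2 (by norm_num)
  refine ⟨(∑' p : Nat.Primes, ((p : ℝ) ^ (-2 : ℝ))) + 1, by positivity, fun η θ hη => ?_⟩
  set s : ℂ := 1 + η + θ * Complex.I with hs
  have hsre : s.re = 1 + η := by simp [hs]
  have hs1 : 1 < s.re := by linarith
  have hnorm : ∀ p : Nat.Primes, ‖(p : ℂ) ^ (-s)‖ = (p : ℝ) ^ (-(1 + η)) := fun p => by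
    rw [Complex.norm_natCast_cpow_of_pos p.2.pos, Complex.neg_re, hsre]
  have hlt : ∀ p : Nat.Primes, ‖(p : ℂ) ^ (-s)‖ ≤ (p : ℝ) ^ (-1 : ℝ) := fun p => by
    rw [hnorm]
    exact Real.rpow_le_rpow_of_exponent_le (by exact_mod_cast p.2.one_lt.le) (by linarith)
  have hhalf : ∀ p : Nat.Primes, ‖(p : ℂ) ^ (-s)‖ ≤ 1 / 2 := fun p => by
    refine (hlt p).trans ?_
    rw [Real.rpow_neg_one, one_div]
    exact inv_anti₀ two_pos (by exact_mod_cast p.2.two_le)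
  have hw : Summable fun p : Nat.Primes => (p : ℂ) ^ (-s) := by
    refine Summable.of_norm ?_
    simp only [hnorm]
    exact Nat.Primes.summable_rpow.2 (by linarith)
  have hbd : ∀ p : Nat.Primes, ‖-Complex.log (1 - (p : ℂ) ^ (-s)) - (p : ℂ) ^ (-s)‖ ≤
      (p : ℝ) ^ (-2 : ℝ) := fun p => by
    have h1 := Complex.norm_log_one_add_sub_self_le (z := -(p : ℂ) ^ (-s))
      (by rw [norm_neg]; linarith [hhalf p])
    rw [norm_neg] at h1
    have e : -Complex.log (1 - (p : ℂ) ^ (-s)) - (p : ℂ) ^ (-s) =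
        -(Complex.log (1 + -(p : ℂ) ^ (-s)) - -(p : ℂ) ^ (-s)) := by ring_nf
    rw [e, norm_neg]
    refine h1.trans ?_
    have h2 : (1 - ‖(p : ℂ) ^ (-s)‖)⁻¹ ≤ 2 := by
      rw [inv_le_comm₀ (by linarith [hhalf p]) two_pos]
      linarith [hhalf p]
    have h3 : ‖(p : ℂ) ^ (-s)‖ ^ 2 ≤ (p : ℝ) ^ (-2 : ℝ) := by
      calc _ ≤ ((p : ℝ) ^ (-1 : ℝ)) ^ 2 := by gcongr; exact hlt p
        _ = _ := by
          rw [← Real.rpow_natCast, ← Real.rpow_mul (Nat.cast_nonneg _)]; norm_num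
    nlinarith [sq_nonneg ‖(p : ℂ) ^ (-s)‖]
  have hlog : ∑' p : Nat.Primes, -Complex.log (1 - (p : ℂ) ^ (-s)) = logZeta s := by
    have := DirichletCharacter.eulerProduct_log_eq_LSeries (1 : DirichletCharacter ℂ 1) hs1
    rw [logZeta]
    convert this using 3
    · rw [MulChar.one_apply (isUnit_of_subsingleton _), one_mul]
    · rw [logCoeff, MulChar.one_apply (isUnit_of_subsingleton _)]
  have hd : Summable fun p : Nat.Primes => -Complex.log (1 - (p : ℂ) ^ (-s)) - (p : ℂ) ^ (-s) :=
    Summable.of_norm_bounded hsum2 hbd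
  have h1 : ‖logZeta s - ∑' p : Nat.Primes, (p : ℂ) ^ (-s)‖ ≤
      ∑' p : Nat.Primes, ((p : ℝ) ^ (-2 : ℝ)) := by
    have hl : Summable fun p : Nat.Primes => -Complex.log (1 - (p : ℂ) ^ (-s)) := by
      simpa using hd.add hw
    rw [← hlog, ← hl.tsum_sub hw]
    exact tsum_of_norm_bounded hsum2.hasSum hbd
  have h2 : (∑' p : Nat.Primes, (p : ℂ) ^ (-s)).re =
      ∑' n, primeTerm (fun n => Real.cos (θ * Real.log n)) η n := by
    rw [Complex.re_tsum hw]
    have e : primeTerm (fun n => Real.cos (θ * Real.log n)) η =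
        Set.indicator {p : ℕ | p.Prime} (fun n : ℕ => ((n : ℂ) ^ (-s)).re) := by
      funext n
      rw [primeTerm, Set.indicator_apply]
      by_cases hn : n.Prime
      · rw [if_pos hn, if_pos (show n ∈ {p : ℕ | p.Prime} from hn), hs,
          show ((1 : ℂ) + η) = ((1 + η : ℝ) : ℂ) by push_cast; rfl, natCast_cpow_re hn.pos]
      · rw [if_neg hn, if_neg (show n ∉ {p : ℕ | p.Prime} from hn)]
    rw [e, ← tsum_subtype]
    rfl
  have h3 : (logZeta s).re = Real.log ‖riemannZeta s‖ := by
    rw [← exp_logZeta hs1, Complex.norm_exp, Real.log_exp]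
  rw [← h2, ← h3, ← Complex.sub_re]
  linarith [Complex.abs_re_le_norm (logZeta s - ∑' p : Nat.Primes, (p : ℂ) ^ (-s))]

/-- The prime zeta function near `1`. -/
theorem exists_tsum_primeTerm_sub_le :
    ∃ C : ℝ, 0 < C ∧ ∀ η : ℝ, 0 < η → η ≤ 2 →
      |∑' n, primeTerm (fun _ => 1) η n + Real.log η| ≤ C := by
  obtain ⟨C₁, hC₁, h1⟩ := exists_abs_log_norm_riemannZeta_sub_le
  obtain ⟨C₂, hC₂, h2⟩ := exists_abs_log_norm_zetaReg_le
  refine ⟨C₁ + C₂, by positivity, fun η hη hη2 => ?_⟩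
  have a1 := h1 η 0 hη
  have a2 := h2 η hη hη2
  simp only [Complex.ofReal_zero, zero_mul, add_zero, Real.cos_zero] at a1
  rw [abs_le] at a1 a2 ⊢
  constructor <;> linarith

/-- Truncating `∑_p c(p) / p` at `y` is the same, up to `O(1)`, as shifting the exponent to
`1 + 1 / log y`. The error is dominated by `∑_p p ^ (-1 - η) (1 - p ^ (-η))`, a difference of two
values of `log ζ`. -/
theorem exists_abs_sum_primesUpTo_sub_le :
    ∃ C : ℝ, 0 < C ∧ ∀ y : ℝ, 3 ≤ y → ∀ c : ℕ → ℝ, (∀ n, |c n| ≤ 1) →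
      |∑ p ∈ primesUpTo y, c p / p - ∑' n, primeTerm c (Real.log y)⁻¹ n| ≤ C ∧
      |∑ p ∈ primesUpTo y, c p * (Real.log p / p)| ≤ C * Real.log y := by
  obtain ⟨C₁, hC₁, h1⟩ := exists_tsum_primeTerm_sub_le
  have he1 := Real.exp_one_gt_d9
  have hC0 : 0 < Real.exp 1 * (2 * C₁ + Real.log 2) :=
    mul_pos (Real.exp_pos _) (by linarith [Real.log_pos one_lt_two])
  refine ⟨2 * (Real.exp 1 * (2 * C₁ + Real.log 2)), by linarith, fun y hy c hc => ?_⟩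
  have hly : 1 < Real.log y := by
    rw [Real.lt_log_iff_exp_lt (by linarith)]
    linarith [Real.exp_one_lt_d9]
  set η := (Real.log y)⁻¹ with hη
  have hη0 : 0 < η := by positivity
  have hη1 : η ≤ 1 := inv_le_one_of_one_le₀ hly.le
  have hone : ∀ n : ℕ, |(fun _ : ℕ => (1 : ℝ)) n| ≤ 1 := fun n => by simp
  -- Nonnegative, with a bounded sum, and dominating all the errors.
  set D : ℕ → ℝ := fun n => primeTerm (fun _ => 1) η n - primeTerm (fun _ => 1) (2 * η) n with hD
  have hDs : Summable D := (summable_primeTerm hone hη0).sub (summable_primeTerm hone (by positivity))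
  have hDsum : ∑' n, D n ≤ 2 * C₁ + Real.log 2 := by
    rw [hD, (summable_primeTerm hone hη0).tsum_sub (summable_primeTerm hone (by positivity))]
    have a1 := abs_le.1 (h1 η hη0 (by linarith))
    have a2 := abs_le.1 (h1 (2 * η) (by positivity) (by linarith))
    rw [Real.log_mul two_ne_zero hη0.ne'] at a2
    linarith
  have hDprime : ∀ n : ℕ, n.Prime → D n = (n : ℝ) ^ (-(1 + η)) * (1 - (n : ℝ) ^ (-η)) := fun n hn => by
    have hn0 : (0 : ℝ) < n := by exact_mod_cast hn.pos
    simp only [hD, primeTerm, if_pos hn, one_mul]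
    rw [mul_sub, mul_one, ← Real.rpow_add hn0]
    ring_nf
  have hD0 : ∀ n, 0 ≤ D n := fun n => by
    by_cases hn : n.Prime
    · rw [hDprime n hn]
      refine mul_nonneg (Real.rpow_nonneg (Nat.cast_nonneg _) _) (sub_nonneg.2 ?_)
      exact Real.rpow_le_one_of_one_le_of_nonpos (by exact_mod_cast hn.one_lt.le) (by linarith)
    · simp [hD, primeTerm, hn]
  have hsmall : ∀ n : ℕ, n.Prime → (n : ℝ) ≤ y →
      (n : ℝ)⁻¹ * (1 - (n : ℝ) ^ (-η)) ≤ Real.exp 1 * D n := fun n hn hny => by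
    have hn0 : (0 : ℝ) < n := by exact_mod_cast hn.pos
    have h2 : (n : ℝ) ^ η ≤ Real.exp 1 := by
      rw [Real.rpow_def_of_pos hn0, Real.exp_le_exp, hη, ← div_eq_mul_inv, div_le_one (by linarith)]
      exact Real.log_le_log hn0 hny
    have h3 : (n : ℝ)⁻¹ = (n : ℝ) ^ η * (n : ℝ) ^ (-(1 + η)) := by
      rw [← Real.rpow_add hn0, ← Real.rpow_neg_one]; ring_nf
    have h4 := hD0 n
    rw [hDprime n hn] at h4 ⊢
    rw [h3, mul_assoc]
    exact mul_le_mul_of_nonneg_right h2 h4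
  constructor
  · set e : ℕ → ℝ := fun n => (if n ∈ primesUpTo y then c n / n else 0) - primeTerm c η n with he
    have hfin : Summable fun n => if n ∈ primesUpTo y then c n / n else 0 :=
      summable_of_ne_finset_zero (s := primesUpTo y) fun n hn => by simp [hn]
    have e1 : ∑ p ∈ primesUpTo y, c p / p - ∑' n, primeTerm c η n = ∑' n, e n := by
      have e2 : ∑' n, (if n ∈ primesUpTo y then c n / n else 0) = ∑ p ∈ primesUpTo y, c p / p := by
        rw [tsum_eq_sum (s := primesUpTo y) fun n hn => if_neg hn]
        exact Finset.sum_congr rfl fun n hn => if_pos hn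
      rw [he, hfin.tsum_sub (summable_primeTerm hc hη0), e2]
    have hbd : ∀ n, ‖e n‖ ≤ Real.exp 1 * D n := fun n => by
      by_cases hn : n.Prime
      · have hn0 : (0 : ℝ) < n := by exact_mod_cast hn.pos
        have hr0 : 0 ≤ (n : ℝ) ^ (-(1 + η)) := Real.rpow_nonneg hn0.le _
        by_cases hny : (n : ℝ) ≤ y
        · have hm : n ∈ primesUpTo y := (mem_primesUpTo (by linarith)).2 ⟨hn, hny⟩
          have h3 : (n : ℝ) ^ (-(1 + η)) = (n : ℝ)⁻¹ * (n : ℝ) ^ (-η) := by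
            rw [← Real.rpow_neg_one, ← Real.rpow_add hn0]; ring_nf
          have h4 : e n = c n * ((n : ℝ)⁻¹ * (1 - (n : ℝ) ^ (-η))) := by
            simp only [he, if_pos hm, primeTerm, if_pos hn, h3]
            ring
          have h5 : 0 ≤ (n : ℝ)⁻¹ * (1 - (n : ℝ) ^ (-η)) := by
            refine mul_nonneg (by positivity) (sub_nonneg.2 ?_)
            exact Real.rpow_le_one_of_one_le_of_nonpos (by exact_mod_cast hn.one_lt.le)
              (by linarith)
          rw [h4, Real.norm_eq_abs, abs_mul, abs_of_nonneg h5]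
          exact (mul_le_of_le_one_left h5 (hc n)).trans (hsmall n hn hny)
        · have hm : n ∉ primesUpTo y := fun h => hny ((mem_primesUpTo (by linarith)).1 h).2
          have h4 : e n = -(c n * (n : ℝ) ^ (-(1 + η))) := by
            simp [he, if_neg hm, primeTerm, if_pos hn]
          have h5 : (n : ℝ) ^ (-η) ≤ (Real.exp 1)⁻¹ := by
            rw [Real.rpow_neg hn0.le]
            refine inv_anti₀ (Real.exp_pos 1) ?_
            rw [Real.rpow_def_of_pos hn0, Real.exp_le_exp, hη, ← div_eq_mul_inv,
              one_le_div (by linarith)]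
            exact Real.log_le_log (by linarith) (not_le.1 hny).le
          have h6 : 1 ≤ Real.exp 1 * (1 - (n : ℝ) ^ (-η)) := by
            have h7 : Real.exp 1 * (n : ℝ) ^ (-η) ≤ 1 := by
              rw [← le_div_iff₀' (Real.exp_pos 1), one_div]; exact h5
            linarith
          rw [h4, norm_neg, Real.norm_eq_abs, abs_mul, abs_of_nonneg hr0, hDprime n hn]
          have h8 := mul_le_of_le_one_left hr0 (hc n)
          nlinarith
      · have hm : n ∉ primesUpTo y := fun h => hn (prime_of_mem_primesUpTo h)
        have : e n = 0 := by simp [he, hm, primeTerm, hn]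
        rw [this, norm_zero]
        have := hD0 n
        positivity
    rw [e1, ← Real.norm_eq_abs]
    refine (tsum_of_norm_bounded (hDs.mul_left _).hasSum hbd).trans ?_
    rw [tsum_mul_left]
    have : Real.exp 1 * ∑' n, D n ≤ Real.exp 1 * (2 * C₁ + Real.log 2) := by gcongr
    linarith
  · have hb : ∀ p ∈ primesUpTo y, |c p * (Real.log p / p)| ≤
        2 * (Real.exp 1 * Real.log y) * D p := fun p hp => by
      obtain ⟨hp1, hpy⟩ := (mem_primesUpTo (by linarith)).1 hp
      have hp0 : (0 : ℝ) < p := by exact_mod_cast hp1.pos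
      have hlp : 0 ≤ Real.log p := Real.log_natCast_nonneg p
      have hlp2 : Real.log p ≤ Real.log y := Real.log_le_log hp0 hpy
      -- `x ≤ 2 (1 - exp (-x))` on `[0, 1]`.
      have h2 : Real.log p * η ≤ 2 * (1 - (p : ℝ) ^ (-η)) := by
        rw [Real.rpow_def_of_pos hp0]
        set x := Real.log p * η with hx
        have hx0 : 0 ≤ x := by positivity
        have hx1 : x ≤ 1 := by
          rw [hx, hη, ← div_eq_mul_inv]
          exact div_le_one_of_le₀ hlp2 (by linarith)
        have h3 : Real.exp (-x) ≤ (1 + x)⁻¹ := by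
          rw [Real.exp_neg]
          exact inv_anti₀ (by linarith) (by linarith [Real.add_one_le_exp x])
        have h4 : (1 + x)⁻¹ ≤ 1 - x / 2 := by
          rw [inv_le_iff_one_le_mul₀ (by linarith)]
          nlinarith
        rw [mul_neg, ← hx]
        linarith
      have h3 : Real.log p = Real.log p * η * Real.log y := by
        rw [hη, mul_assoc, inv_mul_cancel₀ (by linarith), mul_one]
      have h4 : 0 ≤ Real.log p / p := by positivity
      rw [abs_mul, abs_of_nonneg h4]
      calc _ ≤ Real.log p / p := mul_le_of_le_one_left h4 (hc p)
        _ = Real.log y * ((p : ℝ)⁻¹ * (Real.log p * η)) := by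
          conv_lhs => rw [h3]
          ring
        _ ≤ Real.log y * ((p : ℝ)⁻¹ * (2 * (1 - (p : ℝ) ^ (-η)))) := by gcongr
        _ = 2 * Real.log y * ((p : ℝ)⁻¹ * (1 - (p : ℝ) ^ (-η))) := by ring
        _ ≤ 2 * Real.log y * (Real.exp 1 * D p) :=
          mul_le_mul_of_nonneg_left (hsmall p hp1 hpy) (by linarith)
        _ = _ := by ring
    refine (Finset.abs_sum_le_sum_abs _ _).trans ((Finset.sum_le_sum hb).trans ?_)
    rw [← Finset.mul_sum]
    have h2 : ∑ p ∈ primesUpTo y, D p ≤ ∑' n, D n := hDs.sum_le_tsum _ fun n _ => hD0 n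
    calc _ ≤ 2 * (Real.exp 1 * Real.log y) * (2 * C₁ + Real.log 2) := by
          gcongr
          exact h2.trans hDsum
      _ = _ := by ring

theorem sum_primesUpTo_log_div_le : ∃ C : ℝ, 0 < C ∧ ∀ y : ℝ, 3 ≤ y →
    ∑ p ∈ primesUpTo y, Real.log p / p ≤ C * Real.log y := by
  obtain ⟨C, hC, h⟩ := exists_abs_sum_primesUpTo_sub_le
  refine ⟨C, hC, fun y hy => ?_⟩
  have := (abs_le.1 (h y hy (fun _ => 1) (fun _ => by simp)).2).2
  simpa using this

/-- Mertens' second theorem with an unspecified bounded error. -/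
theorem abs_sum_primesUpTo_inv_sub_le : ∃ C : ℝ, 0 < C ∧ ∀ y : ℝ, 3 ≤ y →
    |∑ p ∈ primesUpTo y, (1 : ℝ) / p - Real.log (Real.log y)| ≤ C := by
  obtain ⟨C, hC, h⟩ := exists_abs_sum_primesUpTo_sub_le
  obtain ⟨C₁, hC₁, h1⟩ := exists_tsum_primeTerm_sub_le
  refine ⟨C + C₁, by positivity, fun y hy => ?_⟩
  have hly : 1 < Real.log y := by
    rw [Real.lt_log_iff_exp_lt (by linarith)]
    linarith [Real.exp_one_lt_d9]
  have a1 := abs_le.1 (h y hy (fun _ => 1) (fun _ => by simp)).1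
  have a2 := abs_le.1 (h1 (Real.log y)⁻¹ (by positivity) ((inv_le_one_of_one_le₀ hly.le).trans
    (by norm_num)))
  rw [Real.log_inv] at a2
  rw [abs_le]
  constructor <;> linarith

/-- Under RH, `∑_{p ≤ y} cos (θ log p) / p` exceeds the contribution of the pole of `ζ` by at most a
triple logarithm of the height. -/
theorem sum_primesUpTo_cos_le (hGRH : QuadraticGRH) : ∃ C : ℝ, 0 < C ∧ ∀ T : ℝ, 16 ≤ T →
    ∀ y θ : ℝ, 3 ≤ y → |θ| ≤ T → ∑ p ∈ primesUpTo y, Real.cos (θ * Real.log p) / p ≤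
      max 0 (-Real.log ‖(((Real.log y)⁻¹ : ℝ) + θ * Complex.I : ℂ)‖) +
        C * (1 + Real.log (Real.log (Real.log T))) := by
  obtain ⟨C, hC, h⟩ := exists_abs_sum_primesUpTo_sub_le
  obtain ⟨C₁, hC₁, h1⟩ := exists_abs_log_norm_riemannZeta_sub_le
  obtain ⟨C₂, hC₂, h2⟩ := exists_log_norm_riemannZeta_le hGRH
  refine ⟨C + C₁ + C₂, by positivity, fun T hT y θ hy hθ => ?_⟩
  have hly : 1 < Real.log y := by
    rw [Real.lt_log_iff_exp_lt (by linarith)]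
    linarith [Real.exp_one_lt_d9]
  have a1 := abs_le.1 (h y hy (fun n => Real.cos (θ * Real.log n))
    (fun n => Real.abs_cos_le_one _)).1
  have a2 := abs_le.1 (h1 (Real.log y)⁻¹ θ (by positivity))
  have a3 := h2 T hT (Real.log y)⁻¹ θ (by positivity)
    ((inv_le_one_of_one_le₀ hly.le).trans (by norm_num)) hθ
  have hT1 : 0 ≤ Real.log (Real.log (Real.log T)) := by
    have h3 : Real.log 16 = 4 * Real.log 2 := by
      rw [show (16 : ℝ) = 2 ^ 4 by norm_num, Real.log_pow]; norm_num
    have h2 : Real.log 16 ≤ Real.log T := Real.log_le_log (by norm_num) hT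
    have h4 : Real.exp 1 ≤ Real.log T := by linarith [Real.log_two_gt_d9, Real.exp_one_lt_d9]
    refine Real.log_nonneg ?_
    rwa [Real.le_log_iff_exp_le ((Real.exp_pos 1).trans_le h4)]
  nlinarith

/-! ### The functions `ℒ`, `ℳ`, `𝒱` and the variance -/

section ShiftL

variable {X : ℝ} (hX : 10 ≤ X)
include hX

theorem two_lt_log : 2 < Real.log X :=
  two_lt_log_ten.trans_le (Real.log_le_log (by norm_num) hX)

theorem log_log_pos : 0 < Real.log (Real.log X) :=
  Real.log_pos (by linarith [two_lt_log hX])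

theorem shiftL_nonneg (z : ℂ) : 0 ≤ shiftL z X := by
  have h1 := two_lt_log hX
  have h2 := log_log_pos hX
  rw [shiftL]
  split_ifs with h h'
  · exact h2.le
  · have h3 : 0 < ‖z‖ := lt_trans (by positivity) (not_le.1 h)
    linarith [Real.log_nonpos h3.le h']
  · exact le_rfl

theorem shiftL_le (z : ℂ) : shiftL z X ≤ Real.log (Real.log X) := by
  have h1 := two_lt_log hX
  have h2 := log_log_pos hX
  rw [shiftL]
  split_ifs with h h'
  · exact le_rfl
  · rw [← Real.log_inv]
    have h3 : 0 < (Real.log X)⁻¹ := by positivity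
    exact Real.log_le_log (inv_pos.2 (h3.trans (not_le.1 h)))
      (inv_le_of_inv_le₀ (by linarith) (not_le.1 h).le)
  · exact h2.le

/-- The function `ℒ` is antitone in `|z|`. -/
theorem shiftL_anti {z w : ℂ} (hzw : ‖z‖ ≤ ‖w‖) : shiftL w X ≤ shiftL z X := by
  by_cases hz : ‖z‖ ≤ (Real.log X)⁻¹
  · have : shiftL z X = Real.log (Real.log X) := by rw [shiftL, if_pos hz]
    rw [this]; exact shiftL_le hX w
  · have hw : ¬ ‖w‖ ≤ (Real.log X)⁻¹ := fun h => hz (hzw.trans h)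
    by_cases hw1 : ‖w‖ ≤ 1
    · rw [shiftL, if_neg hw, if_pos hw1, shiftL, if_neg hz, if_pos (hzw.trans hw1)]
      have h3 : 0 < (Real.log X)⁻¹ := by have := two_lt_log hX; positivity
      linarith [Real.log_le_log (h3.trans (not_le.1 hz)) hzw]
    · rw [shiftL, if_neg hw, if_neg hw1]
      exact shiftL_nonneg hX z

theorem shiftM_nonneg (z₁ z₂ : ℂ) : 0 ≤ shiftM z₁ z₂ X := by
  have h1 := shiftL_nonneg hX z₁
  have h2 := shiftL_nonneg hX z₂
  rw [shiftM]; linarith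

theorem shiftM_le (z₁ z₂ : ℂ) : shiftM z₁ z₂ X ≤ Real.log (Real.log X) := by
  have h1 := shiftL_le hX z₁
  have h2 := shiftL_le hX z₂
  rw [shiftM]; linarith

theorem shiftV_nonneg (z₁ z₂ : ℂ) : 0 ≤ shiftV z₁ z₂ X := by
  have h := shiftL_nonneg hX
  have h1 := h (2 * z₁)
  have h2 := h (2 * z₂)
  have h3 := h ((2 * z₁.re : ℝ) : ℂ)
  have h4 := h ((2 * z₂.re : ℝ) : ℂ)
  have h5 := h (z₁ + z₂)
  have h6 := h (z₁ + conj z₂)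
  rw [shiftV]; linarith

/-- The pole of `ζ` seen at distance `1 / log y` is at most the truncated logarithm `ℒ`. -/
theorem max_neg_log_le_shiftL {y : ℝ} (hy : 3 ≤ y) (hyX : y ≤ X) {z : ℂ}
    (hz : |z.re| ≤ 2 / Real.log X) :
    max 0 (-Real.log ‖(((Real.log y)⁻¹ : ℝ) + z.im * Complex.I : ℂ)‖) ≤
      shiftL z X + Real.log 3 := by
  have hlX := two_lt_log hX
  have hly : 0 < Real.log y := Real.log_pos (by linarith)
  have hlyX : Real.log y ≤ Real.log X := Real.log_le_log (by linarith) hyX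
  have hl3 : 0 ≤ Real.log 3 := Real.log_nonneg (by norm_num)
  set w : ℂ := ((Real.log y)⁻¹ : ℝ) + z.im * Complex.I with hw
  have hwre : w.re = (Real.log y)⁻¹ := by rw [hw]; simp
  have hwim : w.im = z.im := by rw [hw]; simp
  have hinv : (Real.log X)⁻¹ ≤ (Real.log y)⁻¹ := inv_anti₀ hly hlyX
  have h1 : (Real.log y)⁻¹ ≤ ‖w‖ := by
    have := Complex.re_le_norm w
    rwa [hwre] at this
  have hX0 : 0 < (Real.log X)⁻¹ := by positivity
  have hw0 : 0 < ‖w‖ := by linarith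
  have h2 : ‖z‖ ≤ 3 * ‖w‖ := by
    have a1 := Complex.norm_le_abs_re_add_abs_im z
    have a2 := Complex.abs_im_le_norm w
    rw [hwim] at a2
    rw [div_eq_mul_inv] at hz
    linarith
  have h3 := shiftL_nonneg hX z
  refine max_le (by linarith) ?_
  by_cases hz1 : ‖z‖ ≤ (Real.log X)⁻¹
  · rw [shiftL, if_pos hz1]
    have : -Real.log ‖w‖ ≤ Real.log (Real.log X) := by
      rw [← Real.log_inv]
      exact Real.log_le_log (inv_pos.2 hw0) (inv_le_of_inv_le₀ (by linarith) (by linarith))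
    linarith
  · have hz0 : 0 < ‖z‖ := hX0.trans (not_le.1 hz1)
    have h4 : Real.log ‖z‖ ≤ Real.log 3 + Real.log ‖w‖ := by
      rw [← Real.log_mul (by norm_num) hw0.ne']
      exact Real.log_le_log hz0 h2
    by_cases hz2 : ‖z‖ ≤ 1
    · rw [shiftL, if_neg hz1, if_pos hz2]
      linarith
    · have := Real.log_pos (not_le.1 hz2)
      linarith

end ShiftL

theorem log_le_mul_sub {ε u : ℝ} (hε : 0 < ε) (hu : 0 < u) : Real.log u ≤ ε * u - Real.log ε := by
  have h := Real.log_le_sub_one_of_pos (mul_pos hε hu)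
  rw [Real.log_mul hε.ne' hu.ne'] at h
  linarith

theorem log_log_two_mul_le {X : ℝ} (hX : 10 ≤ X) :
    Real.log (Real.log (2 * X)) ≤ Real.log (Real.log X) + Real.log 2 := by
  have hlX := two_lt_log hX
  rw [← Real.log_mul (by linarith) two_ne_zero]
  refine Real.log_le_log (Real.log_pos (by linarith)) ?_
  rw [Real.log_mul two_ne_zero (by linarith)]
  linarith [Real.log_two_lt_d9]

/-- Prime sums twisted by `p ^ (-it)` are at most `ℒ`, up to `ε log log X + O(1)`. -/
theorem sum_cos_le_shiftL (hGRH : QuadraticGRH) {ε : ℝ} (hε : 0 < ε) :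
    ∃ C : ℝ, 0 < C ∧ ∀ X : ℝ, 10 ≤ X → ∀ y : ℝ, 3 ≤ y → y ≤ X → ∀ z : ℂ,
      |z.re| ≤ 2 / Real.log X → |z.im| ≤ 2 * X →
      ∑ p ∈ primesUpTo y, Real.cos (z.im * Real.log p) / p ≤
        shiftL z X + ε * Real.log (Real.log X) + C := by
  obtain ⟨C, hC, h⟩ := sum_primesUpTo_cos_le hGRH
  refine ⟨Real.log 3 + C * (1 + |ε / C * Real.log 2 - Real.log (ε / C)|), ?_,
    fun X hX y hy hyX z hz hz2 => ?_⟩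
  · have := Real.log_pos (by norm_num : (1 : ℝ) < 3)
    positivity
  · have h1 := h (2 * X) (by linarith) y z.im hy hz2
    have h2 := max_neg_log_le_shiftL hX hy hyX hz
    have hlX := two_lt_log hX
    have h3 : 0 < Real.log (Real.log (2 * X)) := by
      refine Real.log_pos ?_
      have : Real.log X ≤ Real.log (2 * X) := Real.log_le_log (by linarith) (by linarith)
      linarith
    have h4 := log_le_mul_sub (div_pos hε hC) h3
    have h5 := log_log_two_mul_le hX
    have h6 : ε / C * Real.log (Real.log (2 * X)) ≤
        ε / C * (Real.log (Real.log X) + Real.log 2) := by gcongr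
    have h7 : C * Real.log (Real.log (Real.log (2 * X))) ≤
        C * (ε / C * Real.log (Real.log X) + |ε / C * Real.log 2 - Real.log (ε / C)|) := by
      gcongr
      have := le_abs_self (ε / C * Real.log 2 - Real.log (ε / C))
      linarith
    have h8 : C * (ε / C * Real.log (Real.log X)) = ε * Real.log (Real.log X) := by field_simp
    rw [mul_add, h8] at h7
    linarith

/-- The real part of `p ^ (-z)`. -/
noncomputable def shiftCos (z : ℂ) (p : ℕ) : ℝ := (p : ℝ) ^ (-z.re) * Real.cos (z.im * Real.log p)

theorem one_sub_rpow_neg_le {p : ℕ} (hp : 0 < p) (x : ℝ) : 1 - (p : ℝ) ^ (-x) ≤ x * Real.log p := by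
  rw [Real.rpow_def_of_pos (by exact_mod_cast hp)]
  linarith [Real.add_one_le_exp (Real.log p * -x)]

theorem rpow_neg_le_one {p : ℕ} (hp : 0 < p) {x : ℝ} (hx : 0 ≤ x) : (p : ℝ) ^ (-x) ≤ 1 :=
  Real.rpow_le_one_of_one_le_of_nonpos (by exact_mod_cast hp) (by linarith)

theorem abs_shiftCos_le_one {p : ℕ} (hp : 0 < p) {z : ℂ} (hz : 0 ≤ z.re) : |shiftCos z p| ≤ 1 := by
  have h0 := Real.rpow_nonneg (Nat.cast_nonneg (α := ℝ) p) (-z.re)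
  rw [shiftCos, abs_mul, abs_of_nonneg h0]
  exact mul_le_one₀ (rpow_neg_le_one hp hz) (abs_nonneg _) (Real.abs_cos_le_one _)

theorem abs_shiftCos_sub_le {p : ℕ} (hp : 0 < p) {z : ℂ} (hz : 0 ≤ z.re) :
    |shiftCos z p - Real.cos (z.im * Real.log p)| ≤ z.re * Real.log p := by
  have e : shiftCos z p - Real.cos (z.im * Real.log p) =
      -((1 - (p : ℝ) ^ (-z.re)) * Real.cos (z.im * Real.log p)) := by rw [shiftCos]; ring
  have h0 : 0 ≤ 1 - (p : ℝ) ^ (-z.re) := sub_nonneg.2 (rpow_neg_le_one hp hz)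
  rw [e, abs_neg, abs_mul, abs_of_nonneg h0]
  exact (mul_le_of_le_one_right h0 (Real.abs_cos_le_one _)).trans (one_sub_rpow_neg_le hp _)

/-- The variance `∑ (Re p^(-z₁) + Re p^(-z₂))² / p` of the Dirichlet polynomial is at most `𝒱`. -/
theorem sum_sq_shiftCos_le_shiftV (hGRH : QuadraticGRH) {ε : ℝ} (hε : 0 < ε) :
    ∃ C : ℝ, 0 < C ∧ ∀ X : ℝ, 10 ≤ X → ∀ y : ℝ, 3 ≤ y → y ≤ X → ∀ z₁ z₂ : ℂ,
      0 ≤ z₁.re → z₁.re ≤ 1 / Real.log X → 0 ≤ z₂.re → z₂.re ≤ 1 / Real.log X →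
      |z₁.im| ≤ X → |z₂.im| ≤ X →
      ∑ p ∈ primesUpTo y, (shiftCos z₁ p + shiftCos z₂ p) ^ 2 / p ≤
        shiftV z₁ z₂ X + ε * Real.log (Real.log X) + C := by
  obtain ⟨C₁, hC₁, h1⟩ := sum_cos_le_shiftL hGRH (ε := ε / 4) (by positivity)
  obtain ⟨C₂, hC₂, h2⟩ := sum_primesUpTo_log_div_le
  refine ⟨4 * C₁ + 8 * C₂, by positivity, fun X hX y hy hyX z₁ z₂ hz1 hz1' hz2 hz2' ht1 ht2 => ?_⟩
  have hlX := two_lt_log hX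
  have hlX0 : 0 < Real.log X := by linarith
  have hly : Real.log y ≤ Real.log X := Real.log_le_log (by linarith) hyX
  have hdiv : 2 / Real.log X = 1 / Real.log X + 1 / Real.log X := by ring
  have hpt : ∀ p ∈ primesUpTo y, (shiftCos z₁ p + shiftCos z₂ p) ^ 2 / p ≤
      (1 / 2 * (Real.cos ((((2 * z₁.re : ℝ) : ℂ)).im * Real.log p) / p) +
       1 / 2 * (Real.cos ((((2 * z₂.re : ℝ) : ℂ)).im * Real.log p) / p) +
       1 / 2 * (Real.cos ((2 * z₁).im * Real.log p) / p) +
       1 / 2 * (Real.cos ((2 * z₂).im * Real.log p) / p) +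
       Real.cos ((z₁ + z₂).im * Real.log p) / p +
       Real.cos ((z₁ + conj z₂).im * Real.log p) / p) +
       8 / Real.log X * (Real.log p / p) := fun p hp => by
    have hpp := (prime_of_mem_primesUpTo hp).pos
    have hp0 : (0 : ℝ) < p := by exact_mod_cast hpp
    set l := Real.log p with hl
    have hl0 : 0 ≤ l := Real.log_natCast_nonneg p
    have a1 := abs_shiftCos_sub_le hpp hz1
    have a2 := abs_shiftCos_sub_le hpp hz2
    have b1 := abs_shiftCos_le_one hpp hz1
    have b2 := abs_shiftCos_le_one hpp hz2
    have c1 := Real.abs_cos_le_one (z₁.im * l)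
    have c2 := Real.abs_cos_le_one (z₂.im * l)
    have m1 : z₁.re * l ≤ 1 / Real.log X * l := by gcongr
    have m2 : z₂.re * l ≤ 1 / Real.log X * l := by gcongr
    rw [← hl] at a1 a2
    set u := shiftCos z₁ p
    set v := shiftCos z₂ p
    set α := z₁.im * l with hα
    set β := z₂.im * l with hβ
    have e1 : (2 * z₁).im * l = 2 * α := by rw [hα]; simp; ring
    have e2 : (2 * z₂).im * l = 2 * β := by rw [hβ]; simp; ring
    have e3 : (z₁ + z₂).im * l = α + β := by rw [hα, hβ]; simp; ring
    have e4 : (z₁ + conj z₂).im * l = α - β := by rw [hα, hβ]; simp; ring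
    rw [Complex.ofReal_im, Complex.ofReal_im, e1, e2, e3, e4, zero_mul, Real.cos_zero,
      Real.cos_two_mul, Real.cos_two_mul, Real.cos_add, Real.cos_sub]
    -- Removing the real parts of the shifts, at most `1 / log X`, has a bounded total cost. Then
    -- `(cos α + cos β)²` is `(1 + cos 2α) / 2 + (1 + cos 2β) / 2 + cos (α + β) + cos (α - β)`.
    -- These are the six frequencies in `𝒱`: the constants come from the real shifts `2 Re z₁` and
    -- `2 Re z₂`, whose imaginary part is `0`.
    have key : (u + v) ^ 2 ≤ (Real.cos α + Real.cos β) ^ 2 + 8 / Real.log X * l := by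
      rw [abs_le] at a1 a2 b1 b2 c1 c2
      have e8 : 8 / Real.log X * l = 8 * (1 / Real.log X * l) := by ring
      rw [e8]
      have hd : |(u + v) - (Real.cos α + Real.cos β)| ≤ 2 * (1 / Real.log X * l) := by
        rw [abs_le]; constructor <;> linarith
      have hs : |(u + v) + (Real.cos α + Real.cos β)| ≤ 4 := by
        rw [abs_le]; constructor <;> linarith
      have hprod : ((u + v) - (Real.cos α + Real.cos β)) * ((u + v) + (Real.cos α + Real.cos β)) ≤
          2 * (1 / Real.log X * l) * 4 := by
        refine (le_abs_self _).trans ?_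
        rw [abs_mul]
        exact mul_le_mul hd hs (abs_nonneg _) ((abs_nonneg _).trans hd)
      linarith
    calc (u + v) ^ 2 / p ≤ ((Real.cos α + Real.cos β) ^ 2 + 8 / Real.log X * l) / p := by gcongr
      _ = _ := by ring
  refine (Finset.sum_le_sum hpt).trans ?_
  simp only [Finset.sum_add_distrib, ← Finset.mul_sum]
  have hre : ∀ z : ℂ, (2 * z).re = 2 * z.re := fun z => by simp
  have him : ∀ z : ℂ, (2 * z).im = 2 * z.im := fun z => by simp
  have h2X : ∀ z : ℂ, |z.im| ≤ X → |(2 * z).im| ≤ 2 * X := fun z hz => by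
    rw [him, abs_mul, abs_two]; linarith
  have h2re : ∀ z : ℂ, 0 ≤ z.re → z.re ≤ 1 / Real.log X → |(2 * z).re| ≤ 2 / Real.log X :=
    fun z h0 hz => by rw [hre, abs_of_nonneg (by linarith), hdiv]; linarith
  have k1 := h1 X hX y hy hyX (2 * z₁) (h2re _ hz1 hz1') (h2X _ ht1)
  have k2 := h1 X hX y hy hyX (2 * z₂) (h2re _ hz2 hz2') (h2X _ ht2)
  have k3 := h1 X hX y hy hyX ((2 * z₁.re : ℝ) : ℂ)
    (by rw [Complex.ofReal_re, abs_of_nonneg (by linarith), hdiv]; linarith)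
    (by rw [Complex.ofReal_im, abs_zero]; linarith)
  have k4 := h1 X hX y hy hyX ((2 * z₂.re : ℝ) : ℂ)
    (by rw [Complex.ofReal_re, abs_of_nonneg (by linarith), hdiv]; linarith)
    (by rw [Complex.ofReal_im, abs_zero]; linarith)
  have k5 := h1 X hX y hy hyX (z₁ + z₂)
    (by rw [Complex.add_re, abs_of_nonneg (by linarith), hdiv]; linarith)
    (by rw [Complex.add_im]; exact (abs_add_le _ _).trans (by linarith))
  have k6 := h1 X hX y hy hyX (z₁ + conj z₂)
    (by rw [Complex.add_re, Complex.conj_re, abs_of_nonneg (by linarith), hdiv]; linarith)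
    (by rw [Complex.add_im, Complex.conj_im]; exact (abs_add_le _ _).trans
          (by rw [abs_neg]; linarith))
  have k7 : 8 / Real.log X * ∑ p ∈ primesUpTo y, Real.log p / p ≤ 8 * C₂ := by
    have h3 := h2 y hy
    calc _ ≤ 8 / Real.log X * (C₂ * Real.log X) := by
          gcongr
          exact h3.trans (by gcongr)
      _ = _ := by field_simp
  rw [shiftV]
  linarith

/-! ### Primes, squares of primes and higher powers in the Riesz mean -/

/-- `∑_{p ∣ m} 1 / p` is at most of triple logarithmic size: the primes beyond `log X` are too few
to matter. -/
theorem sum_primeFactors_inv_le {ε : ℝ} (hε : 0 < ε) :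
    ∃ C : ℝ, 0 < C ∧ ∀ X : ℝ, 10 ≤ X → ∀ m : ℕ, 0 < m → (m : ℝ) ≤ X →
      ∑ p ∈ m.primeFactors, (1 : ℝ) / p ≤ ε * Real.log (Real.log X) + C := by
  obtain ⟨C₁, hC₁, h1⟩ := abs_sum_primesUpTo_inv_sub_le
  refine ⟨C₁ + |ε * Real.log 2 - Real.log ε| + 2, by positivity, fun X hX m hm hmX => ?_⟩
  have hlX := two_lt_log hX
  -- At most `2 log X` primes divide `m`, so those above `Y` contribute at most `1`.
  set Y := 2 * Real.log X with hY
  have hY3 : 3 ≤ Y := by linarith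
  have hlY : 1 < Real.log Y := by
    rw [Real.lt_log_iff_exp_lt (by linarith)]
    linarith [Real.exp_one_lt_d9]
  have hlY2 : Real.log Y = Real.log 2 + Real.log (Real.log X) := by
    rw [hY, Real.log_mul two_ne_zero (by linarith)]
  rw [← Finset.sum_filter_add_sum_filter_not m.primeFactors fun p => (p : ℝ) ≤ Y]
  have a1 : ∑ p ∈ m.primeFactors with ((p : ℕ) : ℝ) ≤ Y, (1 : ℝ) / p ≤
      ∑ p ∈ primesUpTo Y, (1 : ℝ) / p := by
    refine Finset.sum_le_sum_of_subset_of_nonneg (fun p hp => ?_) fun p _ _ => by positivity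
    rw [Finset.mem_filter] at hp
    exact (mem_primesUpTo (by linarith)).2 ⟨Nat.prime_of_mem_primeFactors hp.1, hp.2⟩
  have a2 : ∑ p ∈ m.primeFactors with ¬ ((p : ℕ) : ℝ) ≤ Y, (1 : ℝ) / p ≤
      (m.primeFactors.card : ℝ) / Y := by
    calc _ ≤ ∑ p ∈ m.primeFactors with ¬ ((p : ℕ) : ℝ) ≤ Y, 1 / Y := by
          refine Finset.sum_le_sum fun p hp => ?_
          rw [Finset.mem_filter, not_le] at hp
          exact one_div_le_one_div_of_le (by linarith) hp.2.le
      _ ≤ ∑ p ∈ m.primeFactors, 1 / Y :=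
          Finset.sum_le_sum_of_subset_of_nonneg (Finset.filter_subset _ _)
            fun p _ _ => by positivity
      _ = _ := by rw [Finset.sum_const, nsmul_eq_mul]; ring
  have hcard : (m.primeFactors.card : ℝ) ≤ 2 * Real.log X := by
    have b1 : 2 ^ m.primeFactors.card ≤ m := by
      calc 2 ^ m.primeFactors.card = ∏ p ∈ m.primeFactors, 2 := by rw [Finset.prod_const]
        _ ≤ ∏ p ∈ m.primeFactors, p := Finset.prod_le_prod (fun _ _ => by norm_num)
            fun p hp => (Nat.prime_of_mem_primeFactors hp).two_le
        _ ≤ m := Nat.le_of_dvd hm (Nat.prod_primeFactors_dvd m)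
    have b2 : (2 : ℝ) ^ m.primeFactors.card ≤ X := le_trans (by exact_mod_cast b1) hmX
    have b3 := Real.log_le_log (by positivity) b2
    rw [Real.log_pow] at b3
    have := Real.log_two_gt_d9
    have b4 : (0 : ℝ) ≤ m.primeFactors.card := Nat.cast_nonneg _
    nlinarith
  have a3 : (m.primeFactors.card : ℝ) / Y ≤ 1 := div_le_one_of_le₀ hcard (by linarith)
  have a4 := (abs_le.1 (h1 Y hY3)).2
  have a5 := log_le_mul_sub hε (by linarith : 0 < Real.log Y)
  rw [hlY2] at a5
  have a6 := le_abs_self (ε * Real.log 2 - Real.log ε)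
  rw [hlY2] at a4
  linarith

open Classical in
/-- Higher prime powers contribute `O(1)` even on the critical line. -/
theorem sum_prime_powers_le : ∃ C : ℝ, 0 < C ∧ ∀ N : ℕ,
    ∑ n ∈ Finset.range N with (∃ p k : ℕ, p.Prime ∧ 3 ≤ k ∧ n = p ^ k),
      (n : ℝ) ^ (-(1 / 2) : ℝ) ≤ C := by
  classical
  have hs : Summable fun n : ℕ => (n : ℝ) ^ (-(3 / 2) : ℝ) := Real.summable_nat_rpow.2 (by norm_num)
  refine ⟨4 * (∑' n : ℕ, (n : ℝ) ^ (-(3 / 2) : ℝ)) + 1, by positivity, fun N => ?_⟩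
  set P := (Finset.range N).filter Nat.Prime
  have hnn : ∀ n : ℕ, 0 ≤ (n : ℝ) ^ (-(1 / 2) : ℝ) := fun n => Real.rpow_nonneg (Nat.cast_nonneg n) _
  have h1 : ((Finset.range N).filter fun n => ∃ p k : ℕ, p.Prime ∧ 3 ≤ k ∧ n = p ^ k) ⊆
      (P ×ˢ Finset.range N).image fun q => q.1 ^ (q.2 + 3) := by
    intro n hn
    rw [Finset.mem_filter, Finset.mem_range] at hn
    obtain ⟨hnN, p, k, hp, hk, rfl⟩ := hn
    refine Finset.mem_image.2 ⟨(p, k - 3), Finset.mem_product.2 ⟨Finset.mem_filter.2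
      ⟨Finset.mem_range.2 ?_, hp⟩, Finset.mem_range.2 ?_⟩, ?_⟩
    · exact (Nat.le_self_pow (by omega) p).trans_lt hnN
    · have := Nat.lt_pow_self hp.one_lt (n := k)
      simp only
      omega
    · simp only
      congr 1
      omega
  have h2 : ∀ p ∈ P, ∑ k ∈ Finset.range N, ((p ^ (k + 3) : ℕ) : ℝ) ^ (-(1 / 2) : ℝ) ≤
      4 * (p : ℝ) ^ (-(3 / 2) : ℝ) := fun p hp => by
    have hp' : p.Prime := (Finset.mem_filter.1 hp).2
    have hp0 : (0 : ℝ) < p := by exact_mod_cast hp'.pos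
    set r := (p : ℝ) ^ (-(1 / 2) : ℝ) with hr
    have hr0 : 0 ≤ r := hnn p
    have hr2 : r ^ 2 ≤ 1 / 2 := by
      have e : r ^ 2 = (p : ℝ)⁻¹ := by
        rw [hr, ← Real.rpow_natCast, ← Real.rpow_mul hp0.le, ← Real.rpow_neg_one]; norm_num
      rw [e, one_div]
      exact inv_anti₀ two_pos (by exact_mod_cast hp'.two_le)
    have hr1 : r ≤ 3 / 4 := by nlinarith
    have e1 : ∀ k : ℕ, ((p ^ (k + 3) : ℕ) : ℝ) ^ (-(1 / 2) : ℝ) = r ^ 3 * r ^ k := fun k => by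
      rw [hr, ← pow_add, Nat.cast_pow, ← Real.rpow_natCast, ← Real.rpow_natCast,
        ← Real.rpow_mul hp0.le, ← Real.rpow_mul hp0.le]
      congr 1
      push_cast; ring
    have e2 : (p : ℝ) ^ (-(3 / 2) : ℝ) = r ^ 3 := by
      rw [hr, ← Real.rpow_natCast, ← Real.rpow_mul hp0.le]; norm_num
    simp only [e1]
    rw [← Finset.mul_sum, e2, mul_comm]
    refine mul_le_mul_of_nonneg_right ?_ (by positivity)
    refine ((summable_geometric_of_lt_one hr0 (by linarith)).sum_le_tsum _
      fun k _ => by positivity).trans ?_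
    rw [tsum_geometric_of_lt_one hr0 (by linarith), inv_le_comm₀ (by linarith) (by norm_num)]
    linarith
  calc _ ≤ ∑ n ∈ (P ×ˢ Finset.range N).image fun q : ℕ × ℕ => q.1 ^ (q.2 + 3), ((n : ℕ) : ℝ) ^ (-(1 / 2) : ℝ) :=
        Finset.sum_le_sum_of_subset_of_nonneg h1 fun n _ _ => hnn n
    _ ≤ ∑ q ∈ P ×ˢ Finset.range N, ((q.1 ^ (q.2 + 3) : ℕ) : ℝ) ^ (-(1 / 2) : ℝ) :=
        Finset.sum_image_le_of_nonneg fun n _ => hnn n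
    _ = ∑ p ∈ P, ∑ k ∈ Finset.range N, ((p ^ (k + 3) : ℕ) : ℝ) ^ (-(1 / 2) : ℝ) :=
        Finset.sum_product _ _ _
    _ ≤ ∑ p ∈ P, 4 * (p : ℝ) ^ (-(3 / 2) : ℝ) := Finset.sum_le_sum h2
    _ ≤ 4 * ∑' n : ℕ, (n : ℝ) ^ (-(3 / 2) : ℝ) := by
        rw [← Finset.mul_sum]
        gcongr
        exact hs.sum_le_tsum _ fun n _ => Real.rpow_nonneg (Nat.cast_nonneg n) _
    _ ≤ _ := by linarith

/-- The coefficient of `log L(s, χ_d)` at a prime power. -/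
theorem quadCoeff_pow (d : FundamentalDiscriminant) {p k : ℕ} (hp : p.Prime) (hk : k ≠ 0) :
    quadCoeff d (p ^ k) = (((kroneckerSym d.1 p : ℝ) ^ k / k : ℝ) : ℂ) := by
  have hl : (Real.log p : ℂ) ≠ 0 := by
    exact_mod_cast (Real.log_pos (by exact_mod_cast hp.one_lt : (1 : ℝ) < p)).ne'
  have hk0 : (k : ℂ) ≠ 0 := by exact_mod_cast hk
  rw [quadCoeff, logCoeff, ArithmeticFunction.vonMangoldt_apply_pow hk,
    ArithmeticFunction.vonMangoldt_apply_prime hp]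
  push_cast
  rw [map_pow, kroneckerChar_natCast]
  have : ((Real.log ((p : ℝ) ^ k) : ℝ) : ℂ) = k * Real.log p := by
    rw [Real.log_pow]; push_cast; rfl
  rw [this, ← Complex.natCast_log]
  field_simp

/-- The real part of a prime power term of the Dirichlet series of `log L(1/2 + z, χ_d)`. -/
theorem term_quadCoeff_pow_re (d : FundamentalDiscriminant) {p k : ℕ} (hp : p.Prime) (hk : k ≠ 0)
    (z : ℂ) : (LSeries.term (quadCoeff d) (1 / 2 + z) (p ^ k)).re =
      (kroneckerSym d.1 p : ℝ) ^ k / k * (Real.cos (k * (z.im * Real.log p)) *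
        (p : ℝ) ^ (-(k * (1 / 2 + z.re)))) := by
  have hpos : 0 < p ^ k := pow_pos hp.pos k
  have hs : (1 / 2 + z : ℂ) = ((1 / 2 + z.re : ℝ) : ℂ) + (z.im : ℂ) * Complex.I := by
    apply Complex.ext <;> simp
  rw [LSeries.term_of_ne_zero hpos.ne', quadCoeff_pow d hp hk, div_eq_mul_inv, ← Complex.cpow_neg,
    Complex.re_ofReal_mul, hs, natCast_cpow_re hpos]
  congr 2
  · rw [Nat.cast_pow, Real.log_pow]; ring_nf
  · rw [Nat.cast_pow, ← Real.rpow_natCast, ← Real.rpow_mul (Nat.cast_nonneg p)]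
    ring_nf

theorem kroneckerSym_sq_of_not_dvd (d : FundamentalDiscriminant) {p : ℕ} (hp : p.Prime)
    (h : ¬ p ∣ d.1.natAbs) : (kroneckerSym d.1 p : ℝ) ^ 2 = 1 := by
  have h1 : IsUnit (p : ZMod d.1.natAbs) :=
    (ZMod.isUnit_iff_coprime _ _).2 ((Nat.Prime.coprime_iff_not_dvd hp).2 h)
  have h2 := h1.map (kroneckerChar d)
  rw [kroneckerChar_natCast] at h2
  rcases kroneckerSym_trichotomy d.1 p with h3 | h3 | h3
  · rw [h3] at h2; simp at h2
  · rw [h3]; norm_num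
  · rw [h3]; norm_num

/-- The prime part of the Riesz mean of length `e ^ R` of `log L(1/2 + z, χ_d)`. -/
noncomputable def primePart (d : FundamentalDiscriminant) (R : ℝ) (z : ℂ) : ℝ :=
  ∑ p ∈ primesUpTo (Real.exp R),
    (kroneckerSym d.1 p : ℝ) * (shiftCos z p * fejerWeight R p ^ 2 / Real.sqrt p)

/-- Separating primes, squares of primes and higher powers in the Riesz mean. -/
theorem exists_re_sum_le : ∃ C : ℝ, 0 < C ∧ ∀ (d : FundamentalDiscriminant) (R : ℝ) (z : ℂ),
    3 ≤ R → 0 ≤ z.re → z.re * R ≤ 1 →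
    (∑ n ∈ Finset.range (⌊Real.exp R⌋₊ + 1),
        LSeries.term (quadCoeff d) (1 / 2 + z) n * (fejerWeight R n ^ 2 : ℝ)).re ≤
      primePart d R z + 1 / 2 * ∑ p ∈ primesUpTo (Real.exp (R / 2)),
        Real.cos ((2 * z).im * Real.log p) / p + ∑ p ∈ d.1.natAbs.primeFactors, (1 : ℝ) / p + C := by
  classical
  obtain ⟨C₁, hC₁, h1⟩ := sum_prime_powers_le
  obtain ⟨C₂, hC₂, h2⟩ := sum_primesUpTo_log_div_le
  refine ⟨C₁ + 2 * C₂, by positivity, fun d R z hR hz hzR => ?_⟩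
  have hR0 : 0 < R := by linarith
  set N := ⌊Real.exp R⌋₊ + 1 with hN
  set g : ℕ → ℝ := fun n => (LSeries.term (quadCoeff d) (1 / 2 + z) n).re * fejerWeight R n ^ 2 with hg
  have hgre : (∑ n ∈ Finset.range N,
      LSeries.term (quadCoeff d) (1 / 2 + z) n * (fejerWeight R n ^ 2 : ℝ)).re =
      ∑ n ∈ Finset.range N, g n := by
    rw [Complex.re_sum]
    exact Finset.sum_congr rfl fun n _ => Complex.re_mul_ofReal _ _
  have hw0 : ∀ n, 0 ≤ fejerWeight R n ^ 2 := fun n => sq_nonneg _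
  have hw1 : ∀ n, fejerWeight R n ^ 2 ≤ 1 := fun n =>
    pow_le_one₀ (fejerWeight_nonneg R n) (fejerWeight_le_one hR0 n)
  set Y := Real.exp (R / 2) with hY
  have hY3 : 3 ≤ Y := by
    have := Real.quadratic_le_exp_of_nonneg (by linarith : 0 ≤ R / 2)
    nlinarith
  have hYY : Y ^ 2 = Real.exp R := by rw [hY, ← Real.exp_nat_mul]; congr 1; push_cast; ring
  -- The primes.
  have hA : ∑ n ∈ (Finset.range N).filter Nat.Prime, g n = primePart d R z := by
    refine Finset.sum_congr rfl fun p hp => ?_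
    have hp' : p.Prime := (Finset.mem_filter.1 hp).2
    have hp0 : (0 : ℝ) < p := by exact_mod_cast hp'.pos
    have := term_quadCoeff_pow_re d hp' one_ne_zero z
    rw [pow_one] at this
    simp only [hg, this, shiftCos, Nat.cast_one, one_mul, pow_one, div_one]
    rw [neg_add, Real.rpow_add hp0, Real.rpow_neg hp0.le (1 / 2), ← Real.sqrt_eq_rpow]
    ring
  -- The squares of primes.
  have hBsub : (primesUpTo Y).image (fun p => p ^ 2) ⊆ (Finset.range N).filter fun n => ¬ n.Prime := by
    intro n hn
    obtain ⟨p, hp, rfl⟩ := Finset.mem_image.1 hn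
    obtain ⟨hp1, hp2⟩ := (mem_primesUpTo (by linarith)).1 hp
    refine Finset.mem_filter.2 ⟨Finset.mem_range.2 (Nat.lt_succ_of_le (Nat.le_floor ?_)), ?_⟩
    · rw [← hYY, Nat.cast_pow]
      exact pow_le_pow_left₀ (Nat.cast_nonneg p) hp2 2
    · exact Nat.Prime.not_prime_pow le_rfl
  have hBval : ∑ n ∈ (primesUpTo Y).image (fun p => p ^ 2), g n ≤
      1 / 2 * ∑ p ∈ primesUpTo Y, Real.cos ((2 * z).im * Real.log p) / p +
        ∑ p ∈ d.1.natAbs.primeFactors, (1 : ℝ) / p + 2 * C₂ := by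
    rw [Finset.sum_image fun p _ q _ h => Nat.pow_left_injective two_ne_zero h]
    have hpt : ∀ p ∈ primesUpTo Y, g (p ^ 2) ≤ 1 / 2 * (Real.cos ((2 * z).im * Real.log p) / p) +
        (if p ∣ d.1.natAbs then (1 : ℝ) / p else 0) + (z.re + 2 / R) * (Real.log p / p) :=
        fun p hp => by
      obtain ⟨hp1, hp2⟩ := (mem_primesUpTo (by linarith)).1 hp
      have hp0 : (0 : ℝ) < p := by exact_mod_cast hp1.pos
      set l := Real.log p with hl
      have hl0 : 0 ≤ l := Real.log_natCast_nonneg p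
      have hlR : l ≤ R / 2 := by
        rw [hl, Real.log_le_iff_le_exp hp0]; exact hp2
      set κ := (kroneckerSym d.1 p : ℝ) ^ 2 with hκ
      have hκ1 : 1 - κ ≤ if p ∣ d.1.natAbs then 1 else 0 := by
        split_ifs with h
        · linarith [sq_nonneg (kroneckerSym d.1 p : ℝ)]
        · rw [hκ, kroneckerSym_sq_of_not_dvd d hp1 h, sub_self]
      have hκ0 : 0 ≤ κ := sq_nonneg _
      have hκ2 : κ ≤ 1 := by
        rcases kroneckerSym_trichotomy d.1 p with h | h | h <;> rw [hκ, h] <;> norm_num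
      set ω := fejerWeight R (p ^ 2) ^ 2 with hω
      have hω1 : 1 - ω ≤ 4 / R * l := by
        have e : fejerWeight R (p ^ 2) = 1 - 2 * l / R := by
          rw [fejerWeight, Nat.cast_pow, Real.log_pow, ← hl, max_eq_right]
          · norm_num
          · rw [sub_nonneg, div_le_one hR0]
            push_cast; linarith
        rw [hω, e]
        have : 4 / R * l = 2 * (2 * l / R) := by ring
        rw [this]
        nlinarith [sq_nonneg (2 * l / R)]
      set ρ := (p : ℝ) ^ (-(2 * z.re)) with hρ
      have hρ1 : 1 - ρ ≤ 2 * z.re * l := one_sub_rpow_neg_le hp1.pos _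
      have hρ2 : ρ ≤ 1 := rpow_neg_le_one hp1.pos (by linarith)
      have hρ0 : 0 ≤ ρ := Real.rpow_nonneg hp0.le _
      set c := Real.cos ((2 * z).im * l) with hc
      have hc1 := abs_le.1 (Real.abs_cos_le_one ((2 * z).im * l))
      have e1 : g (p ^ 2) = κ / 2 * (c * (ρ / p)) * ω := by
        have e3 : (p : ℝ) ^ (-((2 : ℕ) * (1 / 2 + z.re))) = ρ / p := by
          rw [hρ, ← Real.rpow_sub_one hp0.ne']
          congr 1; push_cast; ring
        have e4 : ((2 : ℕ) : ℝ) * (z.im * l) = (2 * z).im * l := by simp; ring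
        simp only [hg, term_quadCoeff_pow_re d hp1 two_ne_zero z, e3, ← hl, e4, ← hω, ← hκ, ← hc]
        norm_num
      -- Replacing by `1` each of the factors: the character value `κ`, which is `1` unless `p ∣
      -- d`; `ρ`, from the real part of the shift; and the weight `ω`.
      have e2 : κ * ρ * ω * c ≤ c + (1 - κ) + (1 - ρ) + (1 - ω) := by
        have f1 : 0 ≤ ω := hw0 _
        have f2 : ω ≤ 1 := hw1 _
        have f3 : 0 ≤ κ * ρ := by positivity
        have f4 : κ * ρ ≤ 1 := mul_le_one₀ hκ2 hρ0 hρ2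
        have f5 : 1 - κ * ρ ≤ (1 - κ) + (1 - ρ) := by nlinarith
        have f6 : 1 - κ * ρ * ω ≤ (1 - κ * ρ) + (1 - ω) := by nlinarith
        have f7 : κ * ρ * ω ≤ 1 := mul_le_one₀ f4 f1 f2
        nlinarith
      rw [e1]
      have e5 : κ / 2 * (c * (ρ / p)) * ω = 1 / 2 * (κ * ρ * ω * c) / p := by ring
      rw [e5, div_le_iff₀ hp0]
      have e6 : (1 / 2 * (c / p) + (if p ∣ d.1.natAbs then (1 : ℝ) / p else 0) +
          (z.re + 2 / R) * (l / p)) * p =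
          1 / 2 * c + (if p ∣ d.1.natAbs then 1 else 0) + (z.re + 2 / R) * l := by
        split_ifs
        · field_simp
        · field_simp; ring
      rw [e6]
      have e7 : (z.re + 2 / R) * l = 1 / 2 * (2 * z.re * l + 4 / R * l) := by ring
      rw [e7]
      have e8 : (0 : ℝ) ≤ if p ∣ d.1.natAbs then 1 else 0 := by split_ifs <;> norm_num
      linarith
    refine (Finset.sum_le_sum hpt).trans ?_
    rw [Finset.sum_add_distrib, Finset.sum_add_distrib, ← Finset.mul_sum, ← Finset.mul_sum]
    have k1 : ∑ p ∈ primesUpTo Y, (if p ∣ d.1.natAbs then (1 : ℝ) / p else 0) ≤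
        ∑ p ∈ d.1.natAbs.primeFactors, (1 : ℝ) / p := by
      rw [← Finset.sum_filter]
      refine Finset.sum_le_sum_of_subset_of_nonneg (fun p hp => ?_) fun p _ _ => by positivity
      rw [Finset.mem_filter] at hp
      exact Nat.mem_primeFactors.2 ⟨prime_of_mem_primesUpTo hp.1, hp.2, NeZero.ne _⟩
    have k2 : (z.re + 2 / R) * ∑ p ∈ primesUpTo Y, Real.log p / p ≤ 2 * C₂ := by
      have h3 := h2 Y hY3
      rw [hY, Real.log_exp, ← hY] at h3
      calc _ ≤ (z.re + 2 / R) * (C₂ * (R / 2)) := by gcongr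
        _ = C₂ / 2 * (z.re * R) + C₂ := by field_simp
        _ ≤ C₂ / 2 * 1 + C₂ := by gcongr
        _ ≤ _ := by linarith
    linarith
  -- The higher powers.
  have hrest : ∑ n ∈ ((Finset.range N).filter fun n => ¬ n.Prime) \
      (primesUpTo Y).image (fun p => p ^ 2), g n ≤ C₁ := by
    refine le_trans ?_ (h1 N)
    rw [Finset.sum_filter, ← Finset.sum_sdiff (s₁ := ((Finset.range N).filter fun n => ¬ n.Prime) \
      (primesUpTo Y).image (fun p => p ^ 2)) (s₂ := Finset.range N)
      (fun n hn => (Finset.mem_filter.1 (Finset.mem_sdiff.1 hn).1).1)]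
    have hnn : ∀ n : ℕ, 0 ≤ if (∃ p k : ℕ, p.Prime ∧ 3 ≤ k ∧ n = p ^ k) then
        (n : ℝ) ^ (-(1 / 2) : ℝ) else 0 := fun n => by
      split_ifs
      · exact Real.rpow_nonneg (Nat.cast_nonneg n) _
      · exact le_rfl
    refine le_trans (Finset.sum_le_sum fun n hn => ?_)
      (le_add_of_nonneg_left (Finset.sum_nonneg fun n _ => hnn n))
    rw [Finset.mem_sdiff, Finset.mem_filter, Finset.mem_range] at hn
    obtain ⟨⟨hnN, hnp⟩, hnsq⟩ := hn
    by_cases hpp : IsPrimePow n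
    · obtain ⟨p, k, hp, hk, rfl⟩ := (isPrimePow_nat_iff n).1 hpp
      have hk3 : 3 ≤ k := by
        by_contra hcon
        have : k = 1 ∨ k = 2 := by omega
        rcases this with rfl | rfl
        · exact hnp (by rwa [pow_one])
        · refine hnsq (Finset.mem_image.2 ⟨p, (mem_primesUpTo (by linarith)).2 ⟨hp, ?_⟩, rfl⟩)
          have h3 : ((p ^ 2 : ℕ) : ℝ) ≤ Real.exp R :=
            (Nat.le_floor_iff (Real.exp_pos R).le).1 (Nat.lt_succ_iff.1 hnN)
          rw [← hYY, Nat.cast_pow] at h3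
          exact le_of_pow_le_pow_left₀ two_ne_zero (by linarith) h3
      rw [if_pos ⟨p, k, hp, hk3, rfl⟩]
      have hp0 : (0 : ℝ) < p := by exact_mod_cast hp.pos
      have e3 : ((p ^ k : ℕ) : ℝ) ^ (-(1 / 2) : ℝ) = (p : ℝ) ^ (-(k * (1 / 2) : ℝ)) := by
        rw [Nat.cast_pow, ← Real.rpow_natCast, ← Real.rpow_mul hp0.le]; ring_nf
      simp only [hg, term_quadCoeff_pow_re d hp hk.ne' z]
      rw [e3]
      refine (le_abs_self _).trans ?_
      rw [abs_mul, abs_of_nonneg (hw0 _)]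
      refine (mul_le_of_le_one_right (abs_nonneg _) (hw1 _)).trans ?_
      rw [abs_mul, abs_mul, abs_of_nonneg (Real.rpow_nonneg hp0.le _)]
      have k1 : |(kroneckerSym d.1 p : ℝ) ^ k / k| ≤ 1 := by
        rw [abs_div, abs_pow, Nat.abs_cast]
        refine div_le_one_of_le₀ ?_ (Nat.cast_nonneg k)
        refine le_trans (pow_le_one₀ (abs_nonneg _) ?_) (by exact_mod_cast hk)
        rcases kroneckerSym_trichotomy d.1 p with h | h | h <;> rw [h] <;> norm_num
      have k2 : (p : ℝ) ^ (-(k * (1 / 2 + z.re) : ℝ)) ≤ (p : ℝ) ^ (-(k * (1 / 2) : ℝ)) := by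
        refine Real.rpow_le_rpow_of_exponent_le (by exact_mod_cast hp.one_lt.le) ?_
        have : (0 : ℝ) ≤ k := Nat.cast_nonneg k
        nlinarith
      have k3 := Real.abs_cos_le_one (k * (z.im * Real.log p))
      have k4 : 0 ≤ (p : ℝ) ^ (-(k * (1 / 2 + z.re) : ℝ)) := Real.rpow_nonneg hp0.le _
      calc _ ≤ 1 * (1 * (p : ℝ) ^ (-(k * (1 / 2 + z.re) : ℝ))) := by gcongr
        _ ≤ _ := by linarith
    · have h0 : g n = 0 := by
        simp only [hg]
        have : quadCoeff d n = 0 := by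
          rw [quadCoeff, logCoeff, ArithmeticFunction.vonMangoldt_eq_zero_iff.2 hpp]; simp
        rcases eq_or_ne n 0 with rfl | hn0
        · simp
        · rw [LSeries.term_of_ne_zero hn0, this]; simp
      rw [h0]; exact hnn n
  rw [hgre, ← Finset.sum_filter_add_sum_filter_not (Finset.range N) Nat.Prime, hA,
    ← Finset.sum_sdiff hBsub]
  linarith

/-! ### A prime sum bound for the product of two values -/

/-- The odd primes `p ≤ y`. -/
noncomputable def oddPrimesUpTo (y : ℝ) : Finset ℕ :=
  (primesUpTo y).erase 2

theorem mem_oddPrimesUpTo {y : ℝ} (hy : 0 ≤ y) {p : ℕ} :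
    p ∈ oddPrimesUpTo y ↔ p.Prime ∧ p ≠ 2 ∧ (p : ℝ) ≤ y := by
  rw [oddPrimesUpTo, Finset.mem_erase, mem_primesUpTo hy]
  tauto

/-- The coefficients, at primes, of the Riesz mean of length `e ^ R` of
`log L(1/2 + z₁, χ_d) L(1/2 + z₂, χ_d)`. -/
noncomputable def rieszCoeff (R : ℝ) (z₁ z₂ : ℂ) (p : ℕ) : ℝ :=
  (shiftCos z₁ p + shiftCos z₂ p) * fejerWeight R p ^ 2 / Real.sqrt p

/-- The character sum `∑_{p ∈ S} b_p (n / p)`. -/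
def primeCharSum (S : Finset ℕ) (b : ℕ → ℝ) (n : ℤ) : ℝ :=
  ∑ p ∈ S, b p * J(n | p)

/-- In place of the Kronecker symbol at odd primes stands the Jacobi symbol, defined for all
integers; the prime `2` contributes at most `2`. -/
theorem primePart_add_le (d : FundamentalDiscriminant) {R : ℝ} (hR : 0 < R) {z₁ z₂ : ℂ}
    (h₁ : 0 ≤ z₁.re) (h₂ : 0 ≤ z₂.re) : primePart d R z₁ + primePart d R z₂ ≤
      primeCharSum (oddPrimesUpTo (Real.exp R)) (rieszCoeff R z₁ z₂) d.1 + 2 := by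
  have e : primePart d R z₁ + primePart d R z₂ =
      ∑ p ∈ primesUpTo (Real.exp R), rieszCoeff R z₁ z₂ p * kroneckerSym d.1 p := by
    rw [primePart, primePart, ← Finset.sum_add_distrib]
    refine Finset.sum_congr rfl fun p _ => ?_
    rw [rieszCoeff]; ring
  have e2 : ∑ p ∈ oddPrimesUpTo (Real.exp R), rieszCoeff R z₁ z₂ p * kroneckerSym d.1 p =
      primeCharSum (oddPrimesUpTo (Real.exp R)) (rieszCoeff R z₁ z₂) d.1 := by
    refine Finset.sum_congr rfl fun p hp => ?_
    obtain ⟨hp1, hp2, -⟩ := (mem_oddPrimesUpTo (Real.exp_pos R).le).1 hp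
    rw [kroneckerSym_odd (hp1.odd_of_ne_two hp2)]
  rw [e, ← e2, oddPrimesUpTo]
  by_cases h : 2 ∈ primesUpTo (Real.exp R)
  · rw [← Finset.sum_erase_add _ _ h]
    gcongr
    refine (le_abs_self _).trans ?_
    have a1 := abs_shiftCos_le_one (p := 2) two_pos h₁
    have a2 := abs_shiftCos_le_one (p := 2) two_pos h₂
    have a3 : |(kroneckerSym d.1 2 : ℝ)| ≤ 1 := by
      rcases kroneckerSym_trichotomy d.1 2 with h | h | h <;> rw [h] <;> norm_num
    have a4 : fejerWeight R 2 ^ 2 ≤ 1 :=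
      pow_le_one₀ (fejerWeight_nonneg R 2) (fejerWeight_le_one hR 2)
    have a5 : (1 : ℝ) ≤ Real.sqrt (2 : ℕ) := by
      rw [Real.one_le_sqrt]; norm_num
    rw [abs_mul, rieszCoeff, abs_div, abs_mul, abs_of_nonneg (Real.sqrt_nonneg _),
      abs_of_nonneg (sq_nonneg (fejerWeight R 2))]
    have a6 : |shiftCos z₁ 2 + shiftCos z₂ 2| ≤ 2 := (abs_add_le _ _).trans (by linarith)
    calc _ ≤ 2 * 1 / 1 * (1 : ℝ) := by gcongr
      _ = 2 := by norm_num
  · rw [Finset.erase_eq_of_notMem h]; linarith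

/-- Upper bound for `|L(1/2 + z₁, χ_d) L(1/2 + z₂, χ_d)|` by a short sum over primes, for a
nontrivial character. The squares of primes produce `ℳ(z₁, z₂, X)`. -/
theorem exists_norm_mul_LFunction_le (hGRH : QuadraticGRH) {ε : ℝ} (hε : 0 < ε) :
    ∃ C : ℝ, 0 < C ∧ ∀ X : ℝ, 10 ≤ X → ∀ d : FundamentalDiscriminant, d.1 ≠ 1 →
      |(d.1 : ℝ)| ≤ X → ∀ z₁ z₂ : ℂ, 0 ≤ z₁.re → z₁.re ≤ 1 / Real.log X →
      0 ≤ z₂.re → z₂.re ≤ 1 / Real.log X → |z₁.im| ≤ X → |z₂.im| ≤ X →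
      ∀ R : ℝ, 3 ≤ R → R ≤ Real.log X →
      ‖(kroneckerChar d).LFunction (1 / 2 + z₁) * (kroneckerChar d).LFunction (1 / 2 + z₂)‖ ≤
        Real.exp (primeCharSum (oddPrimesUpTo (Real.exp R)) (rieszCoeff R z₁ z₂) d.1 +
          shiftM z₁ z₂ X + ε * Real.log (Real.log X) + C * Real.log X / R) := by
  obtain ⟨C₁, hC₁, h1⟩ := exists_re_sum_le
  obtain ⟨C₂, hC₂, h2⟩ := sum_cos_le_shiftL hGRH (by positivity : 0 < ε / 3)
  obtain ⟨C₃, hC₃, h3⟩ := sum_primeFactors_inv_le (by positivity : 0 < ε / 3)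
  have hF := fejerLogMoment_nonneg
  set F := fejerLogMoment
  refine ⟨2 + 2 * C₁ + C₂ + 2 * C₃ + 2 * (2 * (3 / 2 + 7 + F)), by positivity,
    fun X hX d hd hdX z₁ z₂ hz₁ hz₁' hz₂ hz₂' hi₁ hi₂ R hR hRX => ?_⟩
  have hlX := two_lt_log hX
  have hL2 := log_log_pos hX
  have hR0 : 0 < R := by linarith
  have hdpos : (0 : ℝ) < (d.1.natAbs : ℝ) := by exact_mod_cast Nat.pos_of_ne_zero (NeZero.ne _)
  have hdX' : (d.1.natAbs : ℝ) ≤ X := by rwa [Nat.cast_natAbs, Int.cast_abs]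
  have one : ∀ z : ℂ, 0 ≤ z.re → z.re ≤ 1 / Real.log X → |z.im| ≤ X →
      ‖(kroneckerChar d).LFunction (1 / 2 + z)‖ ≤ Real.exp (primePart d R z + 1 / 2 * shiftL z X +
        ε / 2 * Real.log (Real.log X) + (C₁ + C₂ / 2 + C₃) + 2 * (3 / 2 + 7 + F) * Real.log X / R) := by
    intro z hz hz' hi
    have hz2 : z.re < 1 / 2 :=
      hz'.trans_lt (one_div_lt_one_div_of_lt two_pos hlX)
    have k1 := norm_LFunction_le_riesz_sum hd hGRH (by linarith : 1 ≤ R)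
      (N := ⌊Real.exp R⌋₊ + 1) (by push_cast; exact (Nat.lt_floor_add_one _).le)
      (s := 1 / 2 + z) (by simpa using hz) (by simp; linarith)
    refine k1.trans (Real.exp_le_exp.2 ?_)
    have hzR : z.re * R ≤ 1 := by
      calc z.re * R ≤ 1 / Real.log X * Real.log X := by gcongr
        _ = 1 := by field_simp
    have k2 := h1 d R z hR hz hzR
    have hY3 : 3 ≤ Real.exp (R / 2) := by
      have := Real.quadratic_le_exp_of_nonneg (by linarith : 0 ≤ R / 2)
      nlinarith
    have hYX : Real.exp (R / 2) ≤ X := by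
      rw [← Real.le_log_iff_exp_le (by linarith)]; linarith
    have k3 := h2 X hX (Real.exp (R / 2)) hY3 hYX (2 * z)
      (by
        have : (2 * z).re = 2 * z.re := by simp
        rw [this, abs_of_nonneg (by linarith)]
        calc 2 * z.re ≤ 2 * (1 / Real.log X) := by gcongr
          _ = _ := by ring)
      (by
        have : (2 * z).im = 2 * z.im := by simp
        rw [this, abs_mul, abs_two]; linarith)
    have k4 : shiftL (2 * z) X ≤ shiftL z X := by
      refine shiftL_anti hX ?_
      rw [norm_mul, Complex.norm_two]; linarith [norm_nonneg z]
    have k5 := h3 X hX d.1.natAbs (by exact_mod_cast hdpos) hdX'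
    have k6 : Real.log d.1.natAbs ≤ Real.log X := Real.log_le_log hdpos hdX'
    have k7 : Real.log (2 + |(1 / 2 + z).im|) ≤ 2 * Real.log X := by
      refine le_trans (Real.log_le_log (by positivity) ?_) (log_le_two_mul_log hX)
      have : (1 / 2 + z).im = z.im := by simp
      rw [this]; linarith
    have k8 : 2 * ((Real.log d.1.natAbs / 2 + 7) + 1 / 2 * (Real.log (2 + |(1 / 2 + z).im|) + F)) / R ≤
        2 * (3 / 2 + 7 + F) * Real.log X / R := by
      refine div_le_div_of_nonneg_right ?_ hR0.le
      have : (7 + F / 2) * 2 ≤ (7 + F / 2) * Real.log X := by gcongr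
      nlinarith
    linarith
  have a1 := one z₁ hz₁ hz₁' hi₁
  have a2 := one z₂ hz₂ hz₂' hi₂
  rw [norm_mul]
  refine (mul_le_mul a1 a2 (norm_nonneg _) (Real.exp_pos _).le).trans ?_
  rw [← Real.exp_add]
  refine Real.exp_le_exp.2 ?_
  have a3 := primePart_add_le d hR0 hz₁ hz₂
  have a4 : 1 ≤ Real.log X / R := by rw [one_le_div hR0]; exact hRX
  have a5 : 2 + 2 * C₁ + C₂ + 2 * C₃ ≤ (2 + 2 * C₁ + C₂ + 2 * C₃) * (Real.log X / R) :=
    le_mul_of_one_le_right (by positivity) a4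
  have a6 : (2 + 2 * C₁ + C₂ + 2 * C₃ + 2 * (2 * (3 / 2 + 7 + F))) * Real.log X / R =
    (2 + 2 * C₁ + C₂ + 2 * C₃) * (Real.log X / R) + 2 * (2 * (3 / 2 + 7 + F) * Real.log X / R) := by
    ring
  rw [a6, shiftM]
  linarith

/-! ### Moments of sums over primes -/

/-- For odd `m` that is not a square, a nonresidue modulo a prime of odd multiplicity gives a value
`-1` of `(· / m)`. -/
theorem exists_jacobiSym_eq_neg_one_of_odd_factorization {m p : ℕ} (hm : Odd m) (hp : p.Prime)
    (h : Odd (m.factorization p)) : ∃ r : ℕ, J(r | m) = -1 := by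
  have hm0 : m ≠ 0 := by rintro rfl; simp at hm
  have hpm : p ∣ m := by
    by_contra hcon
    rw [Nat.factorization_eq_zero_of_not_dvd hcon] at h
    simp at h
  have hp2 : p ≠ 2 := by
    rintro rfl
    exact (Nat.not_even_iff_odd.2 hm) (even_iff_two_dvd.2 hpm)
  obtain ⟨r, hr⟩ := exists_jacobiSym_eq_neg_one hp hp2
  have hcop : Nat.Coprime (m / p ^ m.factorization p) p := (Nat.coprime_ordCompl hp hm0).symm
  obtain ⟨n, hn1, hn2⟩ := Nat.chineseRemainder hcop 1 r
  refine ⟨n, ?_⟩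
  have h1 := jacobiSym.mul_right' (n : ℤ) (pow_ne_zero (m.factorization p) hp.ne_zero)
    (Nat.ordCompl_pos p hm0).ne'
  rw [Nat.ordProj_mul_ordCompl_eq_self] at h1
  rw [h1, jacobiSym.pow_right, jacobiSym_eq_of_modEq hn1, jacobiSym_eq_of_modEq hn2, hr,
    h.neg_one_pow]
  simp

theorem abs_jacobiSym_le_one (a : ℤ) (m : ℕ) : |(J(a | m) : ℝ)| ≤ 1 := by
  rcases jacobiSym.trichotomy a m with h | h | h <;> rw [h] <;> norm_num

theorem sum_Icc_neg_eq_sum_range {M : Type*} [AddCommMonoid M] (N : ℕ) (f : ℤ → M) :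
    ∑ n ∈ Finset.Icc (-N : ℤ) N, f n = ∑ i ∈ Finset.range (2 * N + 1), f (i - N) := by
  symm
  refine Finset.sum_bij (fun i _ => (i : ℤ) - N) (fun i hi => ?_) (fun i _ j _ h => by simpa using h)
    (fun n hn => ?_) fun _ _ => rfl
  · rw [Finset.mem_range] at hi
    rw [Finset.mem_Icc]; omega
  · rw [Finset.mem_Icc] at hn
    exact ⟨(n + N).toNat, Finset.mem_range.2 (by omega), by omega⟩

/-- Orthogonality: for odd nonsquare `m` the character `(· / m)` is nontrivial. -/
theorem abs_sum_jacobiSym_le {m p : ℕ} (hm : Odd m) (hp : p.Prime)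
    (h : Odd (m.factorization p)) (N : ℕ) :
    |∑ n ∈ Finset.Icc (-N : ℤ) N, (J(n | m) : ℝ)| ≤ m := by
  have hm0 : m ≠ 0 := by rintro rfl; simp at hm
  have : NeZero m := ⟨hm0⟩
  obtain ⟨r, hr⟩ := exists_jacobiSym_eq_neg_one_of_odd_factorization hm hp h
  set G : ZMod m → ℝ := fun a => (J((a.val : ℤ) | m) : ℝ) with hG
  have hGint : ∀ n : ℤ, (J(n | m) : ℝ) = G n := fun n => by
    simp only [hG]
    rw [ZMod.val_intCast, ← jacobiSym.mod_left]
  have hru : IsUnit (r : ZMod m) := by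
    rw [ZMod.isUnit_iff_coprime]
    by_contra hcop
    have := (jacobiSym.eq_zero_iff_not_coprime (a := r) (b := m)).2 hcop
    rw [hr] at this; norm_num at this
  have hGr : ∀ a : ZMod m, G (r * a) = - G a := fun a => by
    have e : (r : ZMod m) * a = ((r * (a.val : ℤ) : ℤ) : ZMod m) := by simp
    rw [e, ← hGint, jacobiSym.mul_left, hr]
    simp [hG]
  have hsum : ∑ a, G a = 0 := by
    have e : ∑ a, G (r * a) = ∑ a, G a := (Units.mulLeft_bijective hru.unit).sum_comp G
    simp only [hGr, Finset.sum_neg_distrib] at e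
    linarith
  rw [sum_Icc_neg_eq_sum_range, ← Real.norm_eq_abs]
  refine norm_sum_range_le_of_periodic (Nat.pos_of_ne_zero hm0) (fun n => ?_) ?_
    (fun n => abs_jacobiSym_le_one _ _) _
  · rw [hGint, hGint]; congr 1; push_cast; simp
  · have e : ∀ i : ℕ, (J((i : ℤ) - N | m) : ℝ) = (fun a : ZMod m => G (a - N)) i := fun i => by
      rw [hGint]; simp
    simp only [e]
    rw [sum_range_natCast_zmod fun a : ZMod m => G (a - N)]
    exact ((Equiv.subRight (N : ZMod m)).sum_comp G).trans hsum

theorem jacobiSym_prod_pow_right (n : ℤ) (S : Finset ℕ) (hS : ∀ p ∈ S, p ≠ 0) (k : ℕ → ℕ) :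
    J(n | ∏ p ∈ S, p ^ k p) = ∏ p ∈ S, J(n | p) ^ k p := by
  classical
  induction S using Finset.induction_on with
  | empty => simp
  | insert a s ha ih =>
    rw [Finset.prod_insert ha, Finset.prod_insert ha, jacobiSym.mul_right', jacobiSym.pow_right,
      ih fun p hp => hS p (Finset.mem_insert_of_mem hp)]
    · exact pow_ne_zero _ (hS a (Finset.mem_insert_self _ _))
    · exact Finset.prod_ne_zero_iff.2 fun p hp =>
        pow_ne_zero _ (hS p (Finset.mem_insert_of_mem hp))

/-- The number `(2ℓ)! / (2 ^ ℓ ℓ!)` of perfect matchings of `2ℓ` points, i.e. the moment of order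
`2ℓ` of a standard Gaussian. -/
noncomputable def gaussianMoment (l : ℕ) : ℝ :=
  (2 * l).factorial / (2 ^ l * l.factorial)

theorem one_le_gaussianMoment (l : ℕ) : 1 ≤ gaussianMoment l := by
  rw [gaussianMoment, one_le_div (by positivity)]
  exact_mod_cast Nat.two_pow_mul_factorial_le_factorial_two_mul l

/-- The crude bound used for tail estimates. -/
theorem gaussianMoment_le (l : ℕ) : gaussianMoment l ≤ (l : ℝ) ^ l := by
  rw [gaussianMoment, div_le_iff₀ (by positivity)]
  have := Nat.factorial_two_mul_le l
  have h : ((2 * l).factorial : ℝ) ≤ (2 * l : ℝ) ^ l * l.factorial := by exact_mod_cast this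
  rw [mul_pow] at h
  linarith

/-- The diagonal terms of the multinomial expansion are dominated by Gaussian moments. -/
theorem sum_even_piAntidiag_le (S : Finset ℕ) (b : ℕ → ℝ) (l : ℕ) :
    ∑ k ∈ (Finset.piAntidiag S (2 * l)).filter (fun k => ∀ p ∈ S, 2 ∣ k p),
      (Nat.multinomial S k : ℝ) * ∏ p ∈ S, |b p| ^ k p ≤
    gaussianMoment l * (∑ p ∈ S, b p ^ 2) ^ l := by
  rw [← Finset.map_nsmul_piAntidiag S l two_ne_zero, Finset.sum_map,
    Finset.sum_pow_eq_sum_piAntidiag, Finset.mul_sum]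
  refine Finset.sum_le_sum fun j hj => ?_
  obtain ⟨hj, -⟩ := Finset.mem_piAntidiag.1 hj
  simp only [Function.Embedding.coeFn_mk, Pi.smul_apply, smul_eq_mul]
  have e : ∏ p ∈ S, |b p| ^ (2 * j p) = ∏ p ∈ S, (b p ^ 2) ^ j p :=
    Finset.prod_congr rfl fun p _ => by rw [pow_mul, sq_abs]
  rw [e, ← mul_assoc]
  refine mul_le_mul_of_nonneg_right ?_ (Finset.prod_nonneg fun p _ => by positivity)
  have h1 := Nat.multinomial_spec S j
  have h2 := Nat.multinomial_spec S (2 • j)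
  simp only [Pi.smul_apply, smul_eq_mul, ← Finset.mul_sum, hj] at h1 h2
  have h3 : (∏ p ∈ S, (2 ^ j p * (j p).factorial)) ≤ ∏ p ∈ S, (2 * j p).factorial :=
    Finset.prod_le_prod' fun p _ => Nat.two_pow_mul_factorial_le_factorial_two_mul (j p)
  rw [Finset.prod_mul_distrib, Finset.prod_pow_eq_pow_sum, hj] at h3
  have hpos : 0 < ∏ p ∈ S, (j p).factorial := Finset.prod_pos fun p _ => Nat.factorial_pos _
  rw [gaussianMoment, div_mul_eq_mul_div, le_div_iff₀ (by positivity)]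
  have h4 : Nat.multinomial S (2 • j) * (2 ^ l * l.factorial) ≤
      (2 * l).factorial * Nat.multinomial S j := by
    rw [← h1, ← h2]
    calc _ = (2 ^ l * ∏ p ∈ S, (j p).factorial) *
          (Nat.multinomial S (2 • j) * Nat.multinomial S j) := by ring
      _ ≤ (∏ p ∈ S, (2 * j p).factorial) *
          (Nat.multinomial S (2 • j) * Nat.multinomial S j) := Nat.mul_le_mul_right _ h3
      _ = _ := by ring
  exact_mod_cast h4

/-- The moment of order `2ℓ` of a sum over primes twisted by Jacobi symbols is at most a Gaussian
moment, up to the contribution of nonsquare moduli. -/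
theorem sum_Icc_primeCharSum_pow_le {S : Finset ℕ} {y : ℝ} (hy : 0 ≤ y)
    (hS : ∀ p ∈ S, p.Prime ∧ p ≠ 2 ∧ (p : ℝ) ≤ y) (b : ℕ → ℝ) (l N : ℕ) :
    ∑ n ∈ Finset.Icc (-N : ℤ) N, primeCharSum S b n ^ (2 * l) ≤
      (2 * N + 1) * (gaussianMoment l * (∑ p ∈ S, b p ^ 2) ^ l) +
        y ^ (2 * l) * (∑ p ∈ S, |b p|) ^ (2 * l) := by
  have hexp : ∀ n : ℤ, primeCharSum S b n ^ (2 * l) = ∑ k ∈ Finset.piAntidiag S (2 * l),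
      (Nat.multinomial S k : ℝ) * (∏ p ∈ S, b p ^ k p) * J(n | ∏ p ∈ S, p ^ k p) := fun n => by
    rw [primeCharSum, Finset.sum_pow_eq_sum_piAntidiag]
    refine Finset.sum_congr rfl fun k _ => ?_
    rw [jacobiSym_prod_pow_right n S (fun p hp => (hS p hp).1.ne_zero)]
    push_cast
    rw [mul_assoc, ← Finset.prod_mul_distrib]
    simp only [mul_pow]
  simp only [hexp]
  rw [Finset.sum_comm]
  simp only [← Finset.mul_sum]
  have hcard : ((Finset.Icc (-N : ℤ) N).card : ℝ) = 2 * N + 1 := by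
    rw [Int.card_Icc]
    have : ((N : ℤ) + 1 - -N).toNat = 2 * N + 1 := by omega
    rw [this]; push_cast; rfl
  have habs : ∀ k : ℕ → ℕ, |∏ p ∈ S, b p ^ k p| = ∏ p ∈ S, |b p| ^ k p := fun k => by
    rw [Finset.abs_prod]
    simp only [abs_pow]
  have hnn : ∀ k : ℕ → ℕ, 0 ≤ (Nat.multinomial S k : ℝ) * ∏ p ∈ S, |b p| ^ k p := fun k =>
    mul_nonneg (Nat.cast_nonneg _) (Finset.prod_nonneg fun p _ => by positivity)
  -- Exponent vectors with all entries even correspond to square moduli and give the diagonal.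
  rw [← Finset.sum_filter_add_sum_filter_not (Finset.piAntidiag S (2 * l))
    (fun k => ∀ p ∈ S, 2 ∣ k p)]
  refine add_le_add ?_ ?_
  · refine le_trans ?_ (mul_le_mul_of_nonneg_left (sum_even_piAntidiag_le S b l)
      (by positivity : (0 : ℝ) ≤ 2 * N + 1))
    rw [Finset.mul_sum]
    refine Finset.sum_le_sum fun k _ => ?_
    have h1 : |∑ n ∈ Finset.Icc (-N : ℤ) N, (J(n | ∏ p ∈ S, p ^ k p) : ℝ)| ≤ 2 * N + 1 := by
      refine (Finset.abs_sum_le_sum_abs _ _).trans ?_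
      refine (Finset.sum_le_sum fun n _ => abs_jacobiSym_le_one n _).trans ?_
      rw [Finset.sum_const, nsmul_eq_mul, hcard, mul_one]
    refine (le_abs_self _).trans ?_
    rw [abs_mul, abs_mul, habs, Nat.abs_cast, mul_comm]
    exact mul_le_mul_of_nonneg_right h1 (hnn k)
  · have hy' : 0 ≤ y ^ (2 * l) := by positivity
    rw [Finset.sum_pow_eq_sum_piAntidiag, Finset.mul_sum]
    refine le_trans ?_ (Finset.sum_le_sum_of_subset_of_nonneg (Finset.filter_subset
      (fun k => ¬ ∀ p ∈ S, 2 ∣ k p) _) fun k _ _ => mul_nonneg hy' (hnn k))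
    refine Finset.sum_le_sum fun k hk => ?_
    obtain ⟨hk1, hk2⟩ := Finset.mem_filter.1 hk
    obtain ⟨hk3, -⟩ := Finset.mem_piAntidiag.1 hk1
    push Not at hk2
    obtain ⟨q, hqS, hq⟩ := hk2
    -- The modulus is odd and not a square, since the prime `q` has odd multiplicity.
    set m := ∏ p ∈ S, p ^ k p with hm
    have hmodd : Odd m := Finset.prod_induction _ Odd (fun _ _ => Odd.mul) odd_one fun p hp =>
      ((hS p hp).1.odd_of_ne_two (hS p hp).2.1).pow
    have hfac : m.factorization q = k q := by
      rw [hm, Nat.factorization_prod fun p hp => pow_ne_zero _ (hS p hp).1.ne_zero,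
        Finset.sum_apply', Finset.sum_eq_single q]
      · rw [(hS q hqS).1.factorization_pow]; simp
      · intro p hp hpq
        rw [(hS p hp).1.factorization_pow, Finsupp.single_eq_of_ne hpq.symm]
      · exact fun h => absurd hqS h
    have h1 := abs_sum_jacobiSym_le hmodd (hS q hqS).1
      (by rw [hfac]; rwa [← Nat.not_even_iff_odd, even_iff_two_dvd]) N
    have h2 : (m : ℝ) ≤ y ^ (2 * l) := by
      rw [hm, ← hk3, ← Finset.prod_pow_eq_pow_sum]
      push_cast
      exact Finset.prod_le_prod (fun p _ => by positivity) fun p hp =>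
        pow_le_pow_left₀ (Nat.cast_nonneg p) (hS p hp).2.2 _
    refine (le_abs_self _).trans ?_
    rw [abs_mul, abs_mul, habs, Nat.abs_cast, mul_comm]
    exact mul_le_mul_of_nonneg_right (h1.trans h2) (hnn k)

theorem card_primes_le {S : Finset ℕ} {y : ℝ} (hy : 0 ≤ y)
    (hS : ∀ p ∈ S, p.Prime ∧ p ≠ 2 ∧ (p : ℝ) ≤ y) : (S.card : ℝ) ≤ y := by
  have h : S ⊆ Finset.Icc 1 ⌊y⌋₊ := fun p hp =>
    Finset.mem_Icc.2 ⟨(hS p hp).1.one_lt.le, Nat.le_floor (hS p hp).2.2⟩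
  have h2 := Finset.card_le_card h
  rw [Nat.card_Icc, Nat.add_sub_cancel] at h2
  exact (Nat.cast_le.2 h2).trans (Nat.floor_le hy)

/-- For nonnegative functions the sum over fundamental discriminants is extended to all integers. -/
theorem sum_fundamentalDiscriminants_le {X : ℝ} (hX : 0 ≤ X) {f : ℤ → ℝ} (hf : ∀ n, 0 ≤ f n) :
    ∑ d ∈ fundamentalDiscriminants X, f d.1 ≤ ∑ n ∈ Finset.Icc (-⌊X⌋₊ : ℤ) ⌊X⌋₊, f n := by
  classical
  rw [fundamentalDiscriminants, Finset.sum_subtype_eq_sum_filter, Int.natCast_floor_eq_floor hX]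
  exact Finset.sum_le_sum_of_subset_of_nonneg (Finset.filter_subset _ _) fun n _ _ => hf n

/-- Gaussian bound for the moments of a short sum over primes, over fundamental discriminants. -/
theorem sum_primeCharSum_pow_le {S : Finset ℕ} {X y : ℝ} {l : ℕ} (hX : 1 ≤ X) (hy : 0 ≤ y)
    (hS : ∀ p ∈ S, p.Prime ∧ p ≠ 2 ∧ (p : ℝ) ≤ y) (h : y ^ (3 * l) ≤ X) (b : ℕ → ℝ) :
    ∑ d ∈ fundamentalDiscriminants X, primeCharSum S b d.1 ^ (2 * l) ≤
      4 * X * (gaussianMoment l * (∑ p ∈ S, b p ^ 2) ^ l) := by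
  refine (sum_fundamentalDiscriminants_le (by linarith)
    (f := fun n => primeCharSum S b n ^ (2 * l)) fun n => (even_two_mul l).pow_nonneg _).trans ?_
  refine (sum_Icc_primeCharSum_pow_le hy hS b l _).trans ?_
  set σ := ∑ p ∈ S, b p ^ 2
  have hσ : 0 ≤ σ := Finset.sum_nonneg fun p _ => sq_nonneg _
  -- By Cauchy–Schwarz; this and the size of the moduli account for the condition `y ^ (3 l) ≤ X`.
  have h1 : (∑ p ∈ S, |b p|) ^ (2 * l) ≤ (y * σ) ^ l := by
    rw [pow_mul]
    refine pow_le_pow_left₀ (sq_nonneg _) ?_ _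
    refine sq_sum_le_card_mul_sum_sq.trans ?_
    simp only [sq_abs]
    gcongr
    exact card_primes_le hy hS
  have h2 : y ^ (2 * l) * (∑ p ∈ S, |b p|) ^ (2 * l) ≤ X * (gaussianMoment l * σ ^ l) := by
    calc _ ≤ y ^ (2 * l) * (y * σ) ^ l := by gcongr
      _ = y ^ (3 * l) * (1 * σ ^ l) := by ring
      _ ≤ X * (gaussianMoment l * σ ^ l) := by
          gcongr
          exact one_le_gaussianMoment l
  have h3 : (⌊X⌋₊ : ℝ) ≤ X := Nat.floor_le (by linarith)
  have h4 : 0 ≤ gaussianMoment l * σ ^ l :=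
    mul_nonneg (by linarith [one_le_gaussianMoment l]) (by positivity)
  have h5 : (2 * ⌊X⌋₊ + 1) * (gaussianMoment l * σ ^ l) ≤ 3 * X * (gaussianMoment l * σ ^ l) := by
    gcongr
    linarith
  linarith

/-! ### Tails, truncated exponential moments and variances -/

/-- On `[0, ℓ]` the exponential function is dominated by the partial sum of order `2ℓ` of the
hyperbolic cosine, which involves even powers only. -/
theorem exp_le_four_mul_sum {v : ℝ} {l : ℕ} (hv : 0 ≤ v) (hvl : v ≤ l) :
    Real.exp v ≤ 4 * ∑ j ∈ Finset.range (l + 1), v ^ (2 * j) / (2 * j).factorial := by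
  set t : ℕ → ℝ := fun j => v ^ (2 * j) / (2 * j).factorial with ht
  have ht0 : ∀ j, 0 ≤ t j := fun j => by simp only [ht]; positivity
  -- Beyond the index `l` each term is at most half of the preceding one.
  have hstep : ∀ n, l ≤ n → 2 * t (n + 1) ≤ t n := fun n hn => by
    have hn' : v ≤ n := hvl.trans (by exact_mod_cast hn)
    have e : t (n + 1) = t n * (v ^ 2 / ((2 * n + 1) * (2 * n + 2))) := by
      simp only [ht]
      rw [show 2 * (n + 1) = 2 * n + 1 + 1 by ring, Nat.factorial_succ, Nat.factorial_succ]
      push_cast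
      field_simp
      ring
    have e2 : v ^ 2 / ((2 * n + 1) * (2 * n + 2)) ≤ 1 / 2 := by
      rw [div_le_div_iff₀ (by positivity) two_pos]
      nlinarith
    rw [e]
    nlinarith [ht0 n]
  have hind : ∀ n, l ≤ n → ∑ j ∈ Finset.range (n + 1), t j + t n ≤
      2 * ∑ j ∈ Finset.range (l + 1), t j := fun n hn => by
    induction n, hn using Nat.le_induction with
    | base =>
      have := Finset.single_le_sum (f := t) (fun j _ => ht0 j) (Finset.self_mem_range_succ l)
      linarith
    | succ n hn ih =>
      rw [Finset.sum_range_succ]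
      linarith [hstep n hn]
  have hcosh : Real.cosh v ≤ 2 * ∑ j ∈ Finset.range (l + 1), t j := by
    have h := (Real.hasSum_cosh v).tendsto_sum_nat
    refine le_of_tendsto h (Filter.eventually_atTop.2 ⟨l + 1, fun n hn => ?_⟩)
    obtain ⟨n, rfl⟩ : ∃ m, n = m + 1 := ⟨n - 1, by omega⟩
    exact le_trans (le_add_of_nonneg_right (ht0 n)) (hind n (by omega))
  have := Real.cosh_eq v
  linarith [Real.exp_pos (-v)]

/-- Tail bound from a single moment. -/
theorem sum_primeCharSum_div_pow_le {S : Finset ℕ} {X y : ℝ} {l : ℕ} (hX : 1 ≤ X) (hy : 0 ≤ y)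
    (hS : ∀ p ∈ S, p.Prime ∧ p ≠ 2 ∧ (p : ℝ) ≤ y) (h : y ^ (3 * l) ≤ X) (b : ℕ → ℝ) {t c : ℝ}
    (ht : 0 < t) (hc : l * ∑ p ∈ S, b p ^ 2 ≤ Real.exp (-c) * t ^ 2) :
    ∑ d ∈ fundamentalDiscriminants X, (primeCharSum S b d.1 / t) ^ (2 * l) ≤
      4 * X * Real.exp (-(c * l)) := by
  simp only [div_pow]
  rw [← Finset.sum_div, div_le_iff₀ (by positivity)]
  refine (sum_primeCharSum_pow_le hX hy hS h b).trans ?_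
  have hσ : 0 ≤ ∑ p ∈ S, b p ^ 2 := Finset.sum_nonneg fun p _ => sq_nonneg _
  rw [mul_assoc (4 * X)]
  refine mul_le_mul_of_nonneg_left ?_ (by linarith)
  calc _ ≤ (l : ℝ) ^ l * (∑ p ∈ S, b p ^ 2) ^ l := by
        gcongr
        exact gaussianMoment_le l
    _ = (l * ∑ p ∈ S, b p ^ 2) ^ l := (mul_pow _ _ _).symm
    _ ≤ (Real.exp (-c) * t ^ 2) ^ l := by gcongr
    _ = _ := by
        rw [mul_pow, ← Real.exp_nat_mul, ← pow_mul]
        ring_nf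

/-- Truncated exponential moment of a sum over primes that is short enough. -/
theorem sum_truncated_cosh_le {S : Finset ℕ} {X y : ℝ} {l : ℕ} (hX : 1 ≤ X) (hy : 1 ≤ y)
    (hS : ∀ p ∈ S, p.Prime ∧ p ≠ 2 ∧ (p : ℝ) ≤ y) (h : y ^ (3 * l) ≤ X) (b : ℕ → ℝ) (k : ℝ) :
    ∑ d ∈ fundamentalDiscriminants X, ∑ j ∈ Finset.range (l + 1),
      (k * primeCharSum S b d.1) ^ (2 * j) / (2 * j).factorial ≤
      4 * X * Real.exp (k ^ 2 / 2 * ∑ p ∈ S, b p ^ 2) := by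
  set σ := ∑ p ∈ S, b p ^ 2
  have hσ : 0 ≤ σ := Finset.sum_nonneg fun p _ => sq_nonneg _
  rw [Finset.sum_comm]
  refine le_trans (Finset.sum_le_sum (g := fun j => 4 * X * ((k ^ 2 / 2 * σ) ^ j / j.factorial))
    fun j hj => ?_) ?_
  · have hj' : j ≤ l := Nat.lt_succ_iff.1 (Finset.mem_range.1 hj)
    have h1 := sum_primeCharSum_pow_le (l := j) hX (by linarith) hS
      ((pow_le_pow_right₀ hy (by omega)).trans h) b
    simp only [mul_pow k, mul_div_right_comm]
    rw [← Finset.mul_sum]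
    refine (mul_le_mul_of_nonneg_left h1 (by
      have : 0 ≤ k ^ (2 * j) := (even_two_mul j).pow_nonneg k
      positivity)).trans_eq ?_
    rw [gaussianMoment, pow_mul, mul_pow (k ^ 2 / 2), div_pow]
    field_simp
    rfl
  · rw [← Finset.mul_sum]
    gcongr
    exact Real.sum_le_exp_of_nonneg (by positivity) _

/-- The range of shifts: `0 ≤ Re z ≤ 1 / log X` and `|Im z| ≤ X`. -/
def IsAdmissibleShift (X : ℝ) (z : ℂ) : Prop :=
  0 ≤ z.re ∧ z.re ≤ 1 / Real.log X ∧ |z.im| ≤ X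

theorem rieszCoeff_sq_le {R : ℝ} (hR : 0 < R) (z₁ z₂ : ℂ) (p : ℕ) :
    rieszCoeff R z₁ z₂ p ^ 2 ≤ (shiftCos z₁ p + shiftCos z₂ p) ^ 2 / p := by
  rw [rieszCoeff, div_pow, Real.sq_sqrt (Nat.cast_nonneg p), mul_pow]
  gcongr
  exact mul_le_of_le_one_right (sq_nonneg _)
    (pow_le_one₀ (sq_nonneg _) (pow_le_one₀ (fejerWeight_nonneg R p) (fejerWeight_le_one hR p)))

theorem rieszCoeff_sq_le_four_div {R X : ℝ} (hR : 0 < R) {z₁ z₂ : ℂ} (h₁ : IsAdmissibleShift X z₁)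
    (h₂ : IsAdmissibleShift X z₂) {p : ℕ} (hp : 0 < p) :
    rieszCoeff R z₁ z₂ p ^ 2 ≤ 4 * (1 / p) := by
  refine (rieszCoeff_sq_le hR z₁ z₂ p).trans ?_
  rw [mul_one_div]
  gcongr
  have a1 := abs_le.1 (abs_shiftCos_le_one hp h₁.1)
  have a2 := abs_le.1 (abs_shiftCos_le_one hp h₂.1)
  nlinarith

theorem oddPrimesUpTo_subset (y : ℝ) : oddPrimesUpTo y ⊆ primesUpTo y := Finset.erase_subset _ _

/-- The variance of the sum over primes up to `y` is at most `𝒱`, up to `ε log log X + O(1)`. -/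
theorem exists_sum_rieszCoeff_sq_le_shiftV (hGRH : QuadraticGRH) {ε : ℝ} (hε : 0 < ε) :
    ∃ C : ℝ, 0 < C ∧ ∀ X : ℝ, 10 ≤ X → ∀ y : ℝ, 3 ≤ y → y ≤ X → ∀ R : ℝ, 0 < R → ∀ z₁ z₂ : ℂ,
      IsAdmissibleShift X z₁ → IsAdmissibleShift X z₂ →
      ∑ p ∈ oddPrimesUpTo y, rieszCoeff R z₁ z₂ p ^ 2 ≤
        shiftV z₁ z₂ X + ε * Real.log (Real.log X) + C := by
  obtain ⟨C, hC, h⟩ := sum_sq_shiftCos_le_shiftV hGRH hε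
  refine ⟨C, hC, fun X hX y hy hyX R hR z₁ z₂ h₁ h₂ => ?_⟩
  refine le_trans ?_ (h X hX y hy hyX z₁ z₂ h₁.1 h₁.2.1 h₂.1 h₂.2.1 h₁.2.2 h₂.2.2)
  exact (Finset.sum_le_sum fun p _ => rieszCoeff_sq_le hR z₁ z₂ p).trans
    (Finset.sum_le_sum_of_subset_of_nonneg (oddPrimesUpTo_subset y) fun p _ _ => by positivity)

/-- The variance of the whole sum over primes is at most `4 log log X + O(1)`, whatever the
shifts. -/
theorem exists_sum_rieszCoeff_sq_le_log_log :
    ∃ C : ℝ, 0 < C ∧ ∀ X : ℝ, ∀ y : ℝ, 3 ≤ y → y ≤ X → ∀ R : ℝ, 0 < R → ∀ z₁ z₂ : ℂ,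
      IsAdmissibleShift X z₁ → IsAdmissibleShift X z₂ →
      ∑ p ∈ oddPrimesUpTo y, rieszCoeff R z₁ z₂ p ^ 2 ≤ 4 * Real.log (Real.log X) + C := by
  obtain ⟨C, hC, h⟩ := abs_sum_primesUpTo_inv_sub_le
  refine ⟨4 * C, by positivity, fun X y hy hyX R hR z₁ z₂ h₁ h₂ => ?_⟩
  have a1 := (abs_le.1 (h y hy)).2
  have a2 : Real.log (Real.log y) ≤ Real.log (Real.log X) :=
    Real.log_le_log (Real.log_pos (by linarith)) (Real.log_le_log (by linarith) hyX)
  calc _ ≤ ∑ p ∈ oddPrimesUpTo y, 4 * ((1 : ℝ) / p) := Finset.sum_le_sum fun p hp =>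
        rieszCoeff_sq_le_four_div hR h₁ h₂ (prime_of_mem_primesUpTo (oddPrimesUpTo_subset y hp)).pos
    _ ≤ ∑ p ∈ primesUpTo y, 4 * ((1 : ℝ) / p) :=
        Finset.sum_le_sum_of_subset_of_nonneg (oddPrimesUpTo_subset y) fun p _ _ => by positivity
    _ ≤ _ := by rw [← Finset.mul_sum]; linarith

/-- Primes between `y₁` and `y₂` contribute little to the variance when `log y₂ / log y₁` is a
power of `log log X`. -/
theorem exists_sum_rieszCoeff_sq_sdiff_le :
    ∃ C : ℝ, 0 < C ∧ ∀ X y₁ y₂ : ℝ, 3 ≤ y₁ → y₁ ≤ y₂ → ∀ R : ℝ, 0 < R → ∀ z₁ z₂ : ℂ,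
      IsAdmissibleShift X z₁ → IsAdmissibleShift X z₂ →
      ∑ p ∈ oddPrimesUpTo y₂ \ oddPrimesUpTo y₁, rieszCoeff R z₁ z₂ p ^ 2 ≤
        4 * (Real.log (Real.log y₂) - Real.log (Real.log y₁)) + C := by
  obtain ⟨C, hC, h⟩ := abs_sum_primesUpTo_inv_sub_le
  refine ⟨8 * C, by positivity, fun X y₁ y₂ hy₁ hy R hR z₁ z₂ h₁ h₂ => ?_⟩
  have a1 := (abs_le.1 (h y₁ hy₁)).1
  have a2 := (abs_le.1 (h y₂ (hy₁.trans hy))).2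
  have hsub : primesUpTo y₁ ⊆ primesUpTo y₂ := fun p hp => by
    rw [mem_primesUpTo (by linarith)] at hp ⊢
    exact ⟨hp.1, hp.2.trans hy⟩
  have hsub2 : oddPrimesUpTo y₂ \ oddPrimesUpTo y₁ ⊆ primesUpTo y₂ \ primesUpTo y₁ := fun p hp => by
    simp only [oddPrimesUpTo, Finset.mem_sdiff, Finset.mem_erase] at hp ⊢
    tauto
  calc _ ≤ ∑ p ∈ oddPrimesUpTo y₂ \ oddPrimesUpTo y₁, 4 * ((1 : ℝ) / p) :=
        Finset.sum_le_sum fun p hp => rieszCoeff_sq_le_four_div hR h₁ h₂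
          (prime_of_mem_primesUpTo (oddPrimesUpTo_subset y₂ (Finset.mem_sdiff.1 hp).1)).pos
    _ ≤ ∑ p ∈ primesUpTo y₂ \ primesUpTo y₁, 4 * ((1 : ℝ) / p) :=
        Finset.sum_le_sum_of_subset_of_nonneg hsub2 fun p _ _ => by positivity
    _ ≤ _ := by
        rw [← Finset.mul_sum]
        have := Finset.sum_sdiff (f := fun p : ℕ => (1 : ℝ) / p) hsub
        linarith

/-! ### Large values -/

open Filter

/-- A positive multiple of `u` eventually dominates `log u` and constants. -/
theorem eventually_log_add_le {a b δ : ℝ} (hδ : 0 < δ) :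
    ∀ᶠ u : ℝ in atTop, a * Real.log u + b ≤ δ * u := by
  have h : (fun u : ℝ => a * Real.log u + b) =o[atTop] fun u => u :=
    (Real.isLittleO_log_id_atTop.const_mul_left a).add (Asymptotics.isLittleO_const_id_atTop b)
  filter_upwards [h.bound hδ, eventually_ge_atTop 0] with u hu hu0
  rw [Real.norm_of_nonneg hu0] at hu
  exact (le_abs_self _).trans hu

theorem tendsto_log_log_atTop : Tendsto (fun X => Real.log (Real.log X)) atTop atTop :=
  Real.tendsto_log_atTop.comp Real.tendsto_log_atTop

/-- The shortest admissible sum, `R = 3`, is bounded; it gives the pointwise bound for `L`. -/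
theorem abs_primeCharSum_rieszCoeff_three_le {X : ℝ} {z₁ z₂ : ℂ} (h₁ : IsAdmissibleShift X z₁)
    (h₂ : IsAdmissibleShift X z₂) (n : ℤ) :
    |primeCharSum (oddPrimesUpTo (Real.exp 3)) (rieszCoeff 3 z₁ z₂) n| ≤ 2 * Real.exp 3 := by
  have hS : ∀ p ∈ oddPrimesUpTo (Real.exp 3), p.Prime ∧ p ≠ 2 ∧ (p : ℝ) ≤ Real.exp 3 := fun p hp =>
    (mem_oddPrimesUpTo (Real.exp_pos _).le).1 hp
  rw [primeCharSum]
  refine (Finset.abs_sum_le_sum_abs _ _).trans ?_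
  refine (Finset.sum_le_card_nsmul _ _ 2 fun p hp => ?_).trans ?_
  · have hp1 : (1 : ℝ) ≤ p := by exact_mod_cast (hS p hp).1.one_lt.le
    have a1 := rieszCoeff_sq_le_four_div three_pos h₁ h₂ (hS p hp).1.pos
    have a2 : |rieszCoeff 3 z₁ z₂ p| ≤ 2 := by
      refine abs_le_of_sq_le_sq (a1.trans ?_) two_pos.le
      have : (1 : ℝ) / p ≤ 1 := by rw [div_le_one (by linarith)]; exact hp1
      linarith
    rw [abs_mul]
    calc _ ≤ 2 * (1 : ℝ) := by
          gcongr
          exact abs_jacobiSym_le_one n p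
      _ = 2 := by norm_num
  · rw [nsmul_eq_mul]
    have := card_primes_le (Real.exp_pos 3).le hS
    linarith

/-- The discriminants for which `|L(1/2 + z₁, χ_d) L(1/2 + z₂, χ_d)|` exceeds a high power of
`log X`. When the product has size `e ^ m`, a prime sum of length `exp (K log X / m)` has size
at least `m / 4`, and its moment of order about `m / K` shows that this is rare. -/
theorem exists_sum_large_values_le (hGRH : QuadraticGRH) {k : ℝ} (hk : 0 < k) :
    ∃ M : ℝ, 0 < M ∧ ∀ᶠ X : ℝ in atTop, ∀ z₁ z₂ : ℂ, IsAdmissibleShift X z₁ →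
      IsAdmissibleShift X z₂ → ∀ T : FundamentalDiscriminant → ℝ,
      (T = fun d => ‖(kroneckerChar d).LFunction (1 / 2 + z₁) *
        (kroneckerChar d).LFunction (1 / 2 + z₂)‖) →
      ∑ d ∈ (fundamentalDiscriminants X).filter
          (fun d => d.1 ≠ 1 ∧ Real.exp (M * Real.log (Real.log X)) < T d), T d ^ k ≤ 8 * X := by
  obtain ⟨C, hC, hS⟩ := exists_norm_mul_LFunction_le hGRH one_pos
  obtain ⟨C', hC', hvar⟩ := exists_sum_rieszCoeff_sq_le_log_log
  -- With `R = K log X / m` the error `C log X / R` is `m / 4`. The moment of order at least `m /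
  -- (3 K)` has to beat `e ^ ((k + 1) m)`, which fixes `c`, and `M` makes `m` large compared with
  -- the variance times `e ^ c`.
  set K := 4 * C with hK
  have hK0 : 0 < K := by positivity
  set c := 6 * K * (k + 1) with hc
  set M := 8 + 80 / (3 * K) * Real.exp c with hM
  have hM8 : 8 ≤ M := by
    have : 0 ≤ 80 / (3 * K) * Real.exp c := by positivity
    linarith
  refine ⟨M, by linarith, ?_⟩
  filter_upwards [eventually_ge_atTop 10, tendsto_log_log_atTop.eventually_ge_atTop C',
    tendsto_log_log_atTop.eventually_ge_atTop (6 * K), tendsto_log_log_atTop.eventually_ge_atTop 1,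
    Real.tendsto_log_atTop.eventually (eventually_log_add_le (a := 2) (b := 2 * Real.exp 3 + 1)
      hC), Real.tendsto_log_atTop.eventually_ge_atTop 3]
    with X hX hu1 hu2 hu3 hu4 hL3 z₁ z₂ h₁ h₂ T hT
  set L := Real.log X with hL
  set u := Real.log L with hu
  have hX1 : 1 ≤ X := by linarith
  -- The short sum of length `R m` that detects size `e ^ m`.
  set R : ℕ → ℝ := fun m => K * L / m with hR
  set l : ℕ → ℕ := fun m => ⌊m / (3 * K)⌋₊ with hl
  set P : ℕ → ℤ → ℝ := fun m n =>
    primeCharSum (oddPrimesUpTo (Real.exp (R m))) (rieszCoeff (R m) z₁ z₂) n with hP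
  set F := (Finset.range (⌊K * L / 3⌋₊ + 1)).filter fun m : ℕ => M * u ≤ m with hF
  have hbound : ∀ d : FundamentalDiscriminant, d.1 ≠ 1 → |(d.1 : ℝ)| ≤ X → ∀ r, 3 ≤ r → r ≤ L →
      T d ≤ Real.exp (primeCharSum (oddPrimesUpTo (Real.exp r)) (rieszCoeff r z₁ z₂) d.1 +
          2 * u + C * L / r) := fun d hd hdX r hr hrL => by
    have := hS X hX d hd hdX z₁ z₂ h₁.1 h₁.2.1 h₂.1 h₂.2.1 h₁.2.2 h₂.2.2 r hr hrL
    rw [hT]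
    refine this.trans (Real.exp_le_exp.2 ?_)
    have hM1 := shiftM_le hX (z₁ := z₁) (z₂ := z₂)
    linarith
  have hpt : ∀ d ∈ (fundamentalDiscriminants X).filter
      (fun d => d.1 ≠ 1 ∧ Real.exp (M * u) < T d), T d ^ k ≤
      ∑ m ∈ F, Real.exp (k * m) * (P m d.1 / (m / 4)) ^ (2 * l m) := by
    intro d hd
    obtain ⟨hdX, hd1, hdT⟩ := Finset.mem_filter.1 hd
    rw [mem_fundamentalDiscriminants] at hdX
    have hT0 : 0 < T d := (Real.exp_pos _).trans hdT
    have hlog : M * u < Real.log (T d) := (Real.lt_log_iff_exp_lt hT0).2 hdT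
    set m := ⌈Real.log (T d)⌉₊ with hm
    have hm1 : Real.log (T d) ≤ m := Nat.le_ceil _
    have hm2 : (m : ℝ) < Real.log (T d) + 1 := Nat.ceil_lt_add_one (by nlinarith)
    have hMm : M * u ≤ m := hlog.le.trans hm1
    have hm8 : 8 * u ≤ m := by nlinarith
    have hmpos : (0 : ℝ) < m := by linarith
    -- The bound with `R = 3` limits the range of `m`, so that `R m ≥ 3`.
    have hmK : (m : ℝ) ≤ K * L / 3 := by
      have a1 := hbound d hd1 hdX 3 le_rfl hL3
      rw [← Real.log_le_iff_le_exp hT0] at a1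
      have a2 := (abs_le.1 (abs_primeCharSum_rieszCoeff_three_le h₁ h₂ d.1)).2
      have a3 : K * L / 3 = C * L + C * L / 3 := by rw [hK]; ring
      linarith
    have hmF : m ∈ F := Finset.mem_filter.2 ⟨Finset.mem_range.2 (Nat.lt_succ_of_le
      (Nat.le_floor hmK)), hMm⟩
    refine le_trans ?_ (Finset.single_le_sum (fun m _ => mul_nonneg (Real.exp_pos _).le
      ((even_two_mul _).pow_nonneg _)) hmF)
    have hR3 : 3 ≤ R m := by
      simp only [hR]
      rw [le_div_iff₀ hmpos]; linarith
    have hRL : R m ≤ L := by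
      simp only [hR]
      rw [div_le_iff₀ hmpos, mul_comm]
      exact mul_le_mul_of_nonneg_left (by linarith) (by linarith)
    have b1 := hbound d hd1 hdX (R m) hR3 hRL
    rw [← Real.log_le_iff_le_exp hT0] at b1
    have b2 : C * L / R m = m / 4 := by
      simp only [hR, hK]; field_simp
    have b3 : 1 ≤ P m d.1 / (m / 4) := by
      rw [one_le_div (by positivity)]
      simp only [hP]
      linarith
    have b4 : T d ^ k ≤ Real.exp (k * m) := by
      rw [Real.rpow_def_of_pos hT0, mul_comm]
      exact Real.exp_le_exp.2 (by gcongr)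
    exact b4.trans (le_mul_of_one_le_right (Real.exp_pos _).le (one_le_pow₀ b3))
  refine (Finset.sum_le_sum hpt).trans ?_
  refine (Finset.sum_le_sum_of_subset_of_nonneg (Finset.filter_subset _ _) fun d _ _ =>
    Finset.sum_nonneg fun m _ => mul_nonneg (Real.exp_pos _).le
      ((even_two_mul _).pow_nonneg _)).trans ?_
  rw [Finset.sum_comm]
  have hterm : ∀ m ∈ F, ∑ d ∈ fundamentalDiscriminants X,
      Real.exp (k * m) * (P m d.1 / (m / 4)) ^ (2 * l m) ≤ 4 * X * Real.exp (-1) ^ m := by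
    intro m hm
    obtain ⟨hm1, hMm⟩ := Finset.mem_filter.1 hm
    have hm8 : 8 * u ≤ m := by nlinarith
    have hmpos : (0 : ℝ) < m := by linarith
    have hmK : (m : ℝ) ≤ K * L / 3 := (Nat.le_floor_iff (by positivity)).1
      (Nat.lt_succ_iff.1 (Finset.mem_range.1 hm1))
    have hR3 : 3 ≤ R m := by
      simp only [hR]
      rw [le_div_iff₀ hmpos]; linarith
    have hRL : R m ≤ L := by
      simp only [hR]
      rw [div_le_iff₀ hmpos, mul_comm]
      exact mul_le_mul_of_nonneg_left (by linarith) (by linarith)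
    have hl1 : (l m : ℝ) ≤ m / (3 * K) := Nat.floor_le (by positivity)
    have hl2 : (m : ℝ) / (6 * K) ≤ l m := by
      have a1 := Nat.lt_floor_add_one ((m : ℝ) / (3 * K))
      have a2 : 1 ≤ (m : ℝ) / (6 * K) := by
        rw [one_le_div (by positivity)]; linarith
      have a3 : (m : ℝ) / (3 * K) = m / (6 * K) + m / (6 * K) := by field_simp; norm_num
      simp only [hl]
      linarith
    have hy : Real.exp (R m) ^ (3 * l m) ≤ X := by
      rw [← Real.exp_nat_mul, ← Real.le_log_iff_exp_le (by linarith)]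
      push_cast
      calc 3 * (l m : ℝ) * R m ≤ 3 * (m / (3 * K)) * R m := by gcongr
        _ = L := by simp only [hR]; field_simp
    have hy3 : 3 ≤ Real.exp (R m) := by linarith [Real.add_one_le_exp (R m)]
    have hyX : Real.exp (R m) ≤ X := (Real.le_log_iff_exp_le (by linarith)).1 hRL
    have hσ := hvar X (Real.exp (R m)) hy3 hyX (R m) (by linarith) z₁ z₂ h₁ h₂
    have hcond : (l m : ℝ) * ∑ p ∈ oddPrimesUpTo (Real.exp (R m)), rieszCoeff (R m) z₁ z₂ p ^ 2 ≤
        Real.exp (-c) * (m / 4) ^ 2 := by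
      calc _ ≤ m / (3 * K) * (5 * u) := by
            gcongr
            linarith
        _ ≤ Real.exp (-c) * (m / 4) ^ 2 := by
            have a1 : 80 / (3 * K) * Real.exp c * u ≤ m := by
              refine le_trans ?_ hMm
              gcongr
              linarith
            have a2 : 80 / (3 * K) * u ≤ Real.exp (-c) * m := by
              rw [Real.exp_neg, inv_mul_eq_div, le_div_iff₀ (Real.exp_pos c)]
              linarith
            have a3 : (m : ℝ) / (3 * K) * (5 * u) = m / 16 * (80 / (3 * K) * u) := by ring
            have a4 : Real.exp (-c) * (m / 4 : ℝ) ^ 2 = m / 16 * (Real.exp (-c) * m) := by ring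
            rw [a3, a4]
            gcongr
    have h3 := sum_primeCharSum_div_pow_le hX1 (Real.exp_pos (R m)).le
      (fun p hp => (mem_oddPrimesUpTo (Real.exp_pos _).le).1 hp) hy (rieszCoeff (R m) z₁ z₂)
      (by positivity : (0 : ℝ) < m / 4) hcond
    rw [← Finset.mul_sum]
    calc _ ≤ Real.exp (k * m) * (4 * X * Real.exp (-(c * l m))) := by gcongr
      _ = 4 * X * Real.exp (k * m - c * l m) := by
          rw [Real.exp_sub, Real.exp_neg]; ring
      _ ≤ 4 * X * Real.exp (m * (-1)) := by
          gcongr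
          have : (k + 1) * m ≤ c * l m := by
            calc (k + 1) * m = c * (m / (6 * K)) := by rw [hc]; field_simp
              _ ≤ c * l m := by gcongr
          linarith
      _ = _ := by rw [Real.exp_nat_mul]
  refine (Finset.sum_le_sum hterm).trans ?_
  refine (Finset.sum_le_sum_of_subset_of_nonneg (Finset.filter_subset _ _)
    fun m _ _ => by positivity).trans ?_
  rw [← Finset.mul_sum]
  have he : Real.exp (-1) ≤ 1 / 2 := by
    rw [Real.exp_neg, one_div]
    exact inv_anti₀ two_pos (by linarith [Real.add_one_le_exp 1])
  have hgeo : ∑ m ∈ Finset.range (⌊K * L / 3⌋₊ + 1), Real.exp (-1) ^ m ≤ 2 := by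
    refine ((summable_geometric_of_lt_one (Real.exp_pos _).le (by linarith)).sum_le_tsum _
      fun m _ => by positivity).trans ?_
    rw [tsum_geometric_of_lt_one (Real.exp_pos _).le (by linarith), inv_le_comm₀ (by linarith)
      two_pos]
    linarith
  nlinarith

/-! ### Moderate values -/

theorem primeCharSum_add_sdiff {S S' : Finset ℕ} (h : S ⊆ S') (b : ℕ → ℝ) (n : ℤ) :
    primeCharSum S b n + primeCharSum (S' \ S) b n = primeCharSum S' b n := by
  rw [primeCharSum, primeCharSum, primeCharSum, add_comm, Finset.sum_sdiff h]

/-- Pointwise input for values of at most polylogarithmic size: split the prime sum into a part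
`a` over small primes and a part `b` over larger ones. Either `b` is atypically large, or the
truncated hyperbolic cosine of `k a` controls the value. -/
theorem rpow_le_of_le_exp {t k a b E G W : ℝ} {l l' : ℕ} (hk : 0 < k) (ht : 0 ≤ t) (hE : 0 ≤ E)
    (hG : 0 < G) (hl : k * W ≤ l) (htW : t ≤ Real.exp W)
    (hab : t ≤ Real.exp (a + b + E)) :
    t ^ k ≤ 4 * Real.exp (k * (E + G)) * ∑ j ∈ Finset.range (l + 1),
        (k * a) ^ (2 * j) / (2 * j).factorial + Real.exp (k * W) * (b / G) ^ (2 * l') := by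
  set c := ∑ j ∈ Finset.range (l + 1), (k * a) ^ (2 * j) / ((2 * j).factorial : ℝ) with hc
  have hterm : ∀ j, 0 ≤ (k * a) ^ (2 * j) / ((2 * j).factorial : ℝ) := fun j =>
    div_nonneg ((even_two_mul j).pow_nonneg _) (by positivity)
  have hc1 : 1 ≤ c := by
    have := Finset.single_le_sum (f := fun j => (k * a) ^ (2 * j) / ((2 * j).factorial : ℝ))
      (fun j _ => hterm j) (Finset.mem_range.2 (Nat.succ_pos l))
    simpa using this
  have hp : 0 ≤ (b / G) ^ (2 * l') := (even_two_mul _).pow_nonneg _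
  rcases le_or_gt b G with hb | hb
  · refine le_add_of_le_of_nonneg ?_ (mul_nonneg (Real.exp_pos _).le hp)
    have h1 : t ≤ Real.exp (min a W + (E + G)) := by
      rcases le_total a W with h | h
      · rw [min_eq_left h]
        exact hab.trans (Real.exp_le_exp.2 (by linarith))
      · rw [min_eq_right h]
        exact htW.trans (Real.exp_le_exp.2 (by linarith))
    have h2 : t ^ k ≤ Real.exp (k * (E + G)) * Real.exp (k * min a W) := by
      rw [← Real.exp_add, ← mul_add, add_comm (E + G), mul_comm k, Real.exp_mul]
      exact Real.rpow_le_rpow ht h1 hk.le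
    have h3 : Real.exp (k * min a W) ≤ 4 * c := by
      rcases le_or_gt (k * min a W) 0 with hv | hv
      · linarith [Real.exp_le_one_iff.2 hv]
      · refine (exp_le_four_mul_sum hv.le ((mul_le_mul_of_nonneg_left (min_le_right a W)
          hk.le).trans hl)).trans ?_
        rw [hc]
        gcongr
        exact min_le_left a W
    calc _ ≤ Real.exp (k * (E + G)) * (4 * c) := h2.trans (by gcongr)
      _ = _ := by ring
  · have h1 : 1 ≤ (b / G) ^ (2 * l') := one_le_pow₀ ((one_le_div hG).2 hb.le)
    have h2 : t ^ k ≤ Real.exp (k * W) := by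
      rw [mul_comm, Real.exp_mul]
      exact Real.rpow_le_rpow ht htW hk.le
    refine (h2.trans (le_mul_of_one_le_right (Real.exp_pos _).le h1)).trans
      (le_add_of_nonneg_left (by positivity))

/-- The discriminants for which `|L(1/2 + z₁, χ_d) L(1/2 + z₂, χ_d)|` is at most a fixed power of
`log X`. Primes up to `exp (log X / (log log X) ^ 2)` behave like independent random signs for
moments of order up to `(log log X) ^ 2`, and the remaining primes are negligible because their
variance is only `O(log log log X)`. -/
theorem exists_sum_moderate_values_le (hGRH : QuadraticGRH) {k M η : ℝ} (hk : 0 < k) (hM : 0 < M)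
    (hη : 0 < η) : ∃ C : ℝ, 0 < C ∧ ∀ᶠ X : ℝ in atTop, ∀ z₁ z₂ : ℂ, IsAdmissibleShift X z₁ →
      IsAdmissibleShift X z₂ → ∀ T : FundamentalDiscriminant → ℝ,
      (T = fun d => ‖(kroneckerChar d).LFunction (1 / 2 + z₁) *
        (kroneckerChar d).LFunction (1 / 2 + z₂)‖) →
      ∑ d ∈ (fundamentalDiscriminants X).filter
          (fun d => d.1 ≠ 1 ∧ T d ≤ Real.exp (M * Real.log (Real.log X))), T d ^ k ≤
        C * X * Real.exp (k * shiftM z₁ z₂ X + 3 * k * η * Real.log (Real.log X) +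
          k ^ 2 / 2 * (shiftV z₁ z₂ X + η * Real.log (Real.log X))) + 4 * X := by
  obtain ⟨C, hC, hS⟩ := exists_norm_mul_LFunction_le hGRH hη
  obtain ⟨C₁, hC₁, hvar⟩ := exists_sum_rieszCoeff_sq_le_shiftV hGRH hη
  obtain ⟨C₂, hC₂, hsd⟩ := exists_sum_rieszCoeff_sq_sdiff_le
  refine ⟨16 * Real.exp (k ^ 2 / 2 * C₁), by positivity, ?_⟩
  -- Chosen so that the tail bound `e ^ (-c l')` below, where `l' ≥ η log log X / (6 C)`, offsets the
  -- trivial bound `(log X) ^ (k M)` for the values.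
  set c := 6 * C * k * M / η with hc
  have hc0 : 0 < c := by positivity
  have hexp : ∀ a : ℝ, 0 < a → ∀ n : ℕ, ∀ᶠ u : ℝ in atTop, a * u ^ n ≤ Real.exp u := fun a ha n => by
    filter_upwards [(Real.isLittleO_pow_exp_atTop (n := n)).bound (inv_pos.2 ha),
      eventually_ge_atTop 0] with u hu hu0
    rw [Real.norm_of_nonneg (by positivity), Real.norm_of_nonneg (Real.exp_pos _).le] at hu
    rwa [inv_mul_eq_div, le_div_iff₀ ha, mul_comm] at hu
  filter_upwards [eventually_ge_atTop 10,
    tendsto_log_log_atTop.eventually (hexp 2 two_pos 2),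
    tendsto_log_log_atTop.eventually (hexp (3 * η / C) (by positivity) 1),
    tendsto_log_log_atTop.eventually_ge_atTop (C / η),
    tendsto_log_log_atTop.eventually_ge_atTop (η / C),
    tendsto_log_log_atTop.eventually_ge_atTop (6 * C / η),
    tendsto_log_log_atTop.eventually_ge_atTop (3 * (k * M + 1)),
    tendsto_log_log_atTop.eventually_ge_atTop 1,
    tendsto_log_log_atTop.eventually (eventually_log_add_le (a := 8) (b := C₂)
      (by positivity : 0 < Real.exp (-c) * (3 * C * η)))]
    with X hX he1 he2 hu1 hu2 hu3 hu4 hu5 hlu z₁ z₂ h₁ h₂ T hT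
  have hL2 := two_lt_log hX
  set L := Real.log X with hL
  have hL0 : 0 < L := by linarith
  set u := Real.log L with hu
  rw [hu, Real.exp_log hL0, ← hu] at he1 he2
  have hu0 : 0 < u := by linarith
  have hX1 : 1 ≤ X := by linarith
  -- The longest sum for which the error term of the prime sum bound is at most `η log log X`.
  set R := C * L / (η * u) with hR
  have hR3 : 3 ≤ R := by
    rw [hR, le_div_iff₀ (by positivity)]
    rw [pow_one, div_mul_eq_mul_div, div_le_iff₀ hC] at he2
    linarith
  have hRL : R ≤ L := by
    rw [hR, div_le_iff₀ (by positivity), mul_comm]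
    rw [div_le_iff₀ hη] at hu1
    gcongr
    linarith
  set r := L / u ^ 2 with hr
  have hr2 : 2 ≤ r := by
    rw [hr, le_div_iff₀ (by positivity)]; exact he1
  have hrR : r ≤ R := by
    rw [hr, hR, div_le_div_iff₀ (by positivity) (by positivity)]
    rw [div_le_iff₀ hC] at hu2
    have : L * u * η ≤ L * u * (u * C) := by gcongr
    linarith
  set y₁ := Real.exp r with hy₁
  set y₂ := Real.exp R with hy₂
  have hy₁3 : 3 ≤ y₁ := by linarith [Real.add_one_le_exp r]
  have hy₁₂ : y₁ ≤ y₂ := Real.exp_le_exp.2 hrR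
  have hy₂X : y₂ ≤ X := (Real.le_log_iff_exp_le (by linarith)).1 hRL
  set S₁ := oddPrimesUpTo y₁ with hS₁
  set S₂ := oddPrimesUpTo y₂ with hS₂
  set b := rieszCoeff R z₁ z₂ with hb
  have mem1 : ∀ p ∈ S₁, p.Prime ∧ p ≠ 2 ∧ (p : ℝ) ≤ y₁ := fun p hp =>
    (mem_oddPrimesUpTo (Real.exp_pos _).le).1 hp
  have mem2 : ∀ p ∈ S₂, p.Prime ∧ p ≠ 2 ∧ (p : ℝ) ≤ y₂ := fun p hp =>
    (mem_oddPrimesUpTo (Real.exp_pos _).le).1 hp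
  have hsub : S₁ ⊆ S₂ := fun p hp => by
    obtain ⟨a1, a2, a3⟩ := mem1 p hp
    exact (mem_oddPrimesUpTo (Real.exp_pos _).le).2 ⟨a1, a2, a3.trans hy₁₂⟩
  -- The orders of the moments for which the two prime sums are short enough: `y₁ ^ (3 l) ≤ X` and
  -- `y₂ ^ (3 l) ≤ X` for the respective order `l`.
  set l := ⌊u ^ 2 / 3⌋₊ with hl
  set l' := ⌊η * u / (3 * C)⌋₊ with hl'
  have hl1 : (l : ℝ) ≤ u ^ 2 / 3 := Nat.floor_le (by positivity)
  have hl2 : k * (M * u) ≤ l := by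
    have := Nat.lt_floor_add_one (u ^ 2 / 3)
    nlinarith
  have hl'1 : (l' : ℝ) ≤ η * u / (3 * C) := Nat.floor_le (by positivity)
  have hl'2 : η * u / (6 * C) ≤ l' := by
    have a1 := Nat.lt_floor_add_one (η * u / (3 * C))
    have a2 : 1 ≤ η * u / (6 * C) := by
      rw [one_le_div (by positivity)]
      rw [div_le_iff₀ hη] at hu3
      linarith
    have a3 : η * u / (3 * C) = η * u / (6 * C) + η * u / (6 * C) := by field_simp; norm_num
    linarith
  have hpow1 : y₁ ^ (3 * l) ≤ X := by
    rw [hy₁, ← Real.exp_nat_mul, ← Real.le_log_iff_exp_le (by linarith)]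
    push_cast
    calc 3 * (l : ℝ) * r ≤ 3 * (u ^ 2 / 3) * r := by gcongr
      _ = L := by rw [hr]; field_simp
  have hpow2 : y₂ ^ (3 * l') ≤ X := by
    rw [hy₂, ← Real.exp_nat_mul, ← Real.le_log_iff_exp_le (by linarith)]
    push_cast
    calc 3 * (l' : ℝ) * R ≤ 3 * (η * u / (3 * C)) * R := by gcongr
      _ = L := by rw [hR]; field_simp
  have hV := hvar X hX y₁ hy₁3 (hy₁₂.trans hy₂X) R (by linarith) z₁ z₂ h₁ h₂
  have hB := hsd X y₁ y₂ hy₁3 hy₁₂ R (by linarith) z₁ z₂ h₁ h₂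
  have hB' : ∑ p ∈ S₂ \ S₁, b p ^ 2 ≤ 8 * Real.log u + C₂ := by
    refine hB.trans ?_
    have a1 : Real.log (Real.log y₂) ≤ u := by
      rw [hy₂, Real.log_exp]
      exact Real.log_le_log (by linarith) hRL
    have a2 : Real.log (Real.log y₁) = u - 2 * Real.log u := by
      rw [hy₁, Real.log_exp, hr, Real.log_div hL0.ne' (by positivity), Real.log_pow]
      push_cast; ring
    rw [a2]; linarith
  have hcond : (l' : ℝ) * ∑ p ∈ S₂ \ S₁, b p ^ 2 ≤ Real.exp (-c) * (η * u) ^ 2 := by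
    have a0 : 0 ≤ ∑ p ∈ S₂ \ S₁, b p ^ 2 := Finset.sum_nonneg fun p _ => sq_nonneg _
    calc _ ≤ η * u / (3 * C) * (Real.exp (-c) * (3 * C * η) * u) := by
          gcongr
          exact hB'.trans hlu
      _ = _ := by field_simp
  have hmA := sum_truncated_cosh_le hX1 (by linarith : 1 ≤ y₁) mem1 hpow1 b k
  have hmB := sum_primeCharSum_div_pow_le hX1 (Real.exp_pos R).le
    (fun p hp => mem2 p (Finset.mem_sdiff.1 hp).1) hpow2 b (by positivity : 0 < η * u) hcond
  have hM0 := shiftM_nonneg hX (z₁ := z₁) (z₂ := z₂)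
  set E := shiftM z₁ z₂ X + 2 * η * u with hE
  have hpt : ∀ d ∈ (fundamentalDiscriminants X).filter
      (fun d => d.1 ≠ 1 ∧ T d ≤ Real.exp (M * u)), T d ^ k ≤
      4 * Real.exp (k * (E + η * u)) * ∑ j ∈ Finset.range (l + 1),
        (k * primeCharSum S₁ b d.1) ^ (2 * j) / (2 * j).factorial +
        Real.exp (k * (M * u)) * (primeCharSum (S₂ \ S₁) b d.1 / (η * u)) ^ (2 * l') := by
    intro d hd
    obtain ⟨hdX, hd1, hdT⟩ := Finset.mem_filter.1 hd
    rw [mem_fundamentalDiscriminants] at hdX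
    have hT0 : 0 ≤ T d := by rw [hT]; exact norm_nonneg _
    refine rpow_le_of_le_exp hk hT0 (by positivity) (by positivity) hl2 hdT ?_
    have a1 := hS X hX d hd1 hdX z₁ z₂ h₁.1 h₁.2.1 h₂.1 h₂.2.1 h₁.2.2 h₂.2.2 R hR3 hRL
    rw [hT]
    refine a1.trans (Real.exp_le_exp.2 ?_)
    rw [primeCharSum_add_sdiff hsub]
    have a2 : C * L / R = η * u := by rw [hR]; field_simp
    rw [a2, hE]
    linarith
  refine (Finset.sum_le_sum hpt).trans ?_
  refine (Finset.sum_le_sum_of_subset_of_nonneg (Finset.filter_subset _ _) fun d _ _ =>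
    add_nonneg (mul_nonneg (by positivity) (Finset.sum_nonneg fun j _ =>
      div_nonneg ((even_two_mul j).pow_nonneg _) (by positivity)))
      (mul_nonneg (Real.exp_pos _).le ((even_two_mul _).pow_nonneg _))).trans ?_
  rw [Finset.sum_add_distrib, ← Finset.mul_sum, ← Finset.mul_sum]
  refine add_le_add ?_ ?_
  · calc _ ≤ 4 * Real.exp (k * (E + η * u)) *
          (4 * X * Real.exp (k ^ 2 / 2 * (shiftV z₁ z₂ X + η * u + C₁))) := by
          refine mul_le_mul_of_nonneg_left (hmA.trans ?_) (by positivity)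
          gcongr
      _ = 16 * X * Real.exp (k * (E + η * u) +
            k ^ 2 / 2 * (shiftV z₁ z₂ X + η * u + C₁)) := by
          rw [Real.exp_add]; ring
      _ = _ := by
          have e : k * (E + η * u) + k ^ 2 / 2 * (shiftV z₁ z₂ X + η * u + C₁) =
              k ^ 2 / 2 * C₁ + (k * shiftM z₁ z₂ X + 3 * k * η * u +
                k ^ 2 / 2 * (shiftV z₁ z₂ X + η * u)) := by rw [hE]; ring
          rw [e, Real.exp_add (k ^ 2 / 2 * C₁)]
          ring
  · calc _ ≤ Real.exp (k * (M * u)) * (4 * X * Real.exp (-(c * l'))) := by gcongr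
      _ = 4 * X * Real.exp (k * (M * u) - c * l') := by
          rw [Real.exp_sub, Real.exp_neg]; ring
      _ ≤ 4 * X * Real.exp 0 := by
          gcongr
          have : k * (M * u) ≤ c * l' := by
            calc k * (M * u) = c * (η * u / (6 * C)) := by rw [hc]; field_simp
              _ ≤ c * l' := by gcongr
          linarith
      _ = _ := by rw [Real.exp_zero, mul_one]

/-! ### The discriminant `1`, bounded ranges and the conclusion -/

/-- The discriminant `d = 1`: a single term, for which the Lindelöf hypothesis suffices. -/
theorem exists_sum_filter_eq_one_le (hGRH : QuadraticGRH) {k : ℝ} (hk : 0 < k) :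
    ∃ C : ℝ, 0 < C ∧ ∀ X : ℝ, 10 ≤ X → ∀ z₁ z₂ : ℂ, IsAdmissibleShift X z₁ →
      IsAdmissibleShift X z₂ →
      ∑ d ∈ (fundamentalDiscriminants X).filter (fun d => d.1 = 1),
        ‖(kroneckerChar d).LFunction (1 / 2 + z₁) * (kroneckerChar d).LFunction (1 / 2 + z₂)‖ ^ k ≤
        C * X := by
  obtain ⟨C, hC, h⟩ := exists_norm_riemannZeta_le hGRH (by positivity : 0 < 1 / (2 * k))
  refine ⟨(C * C) ^ k, by positivity, fun X hX z₁ z₂ h₁ h₂ => ?_⟩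
  have hX0 : 0 < X := by linarith
  have hcard : ((fundamentalDiscriminants X).filter (fun d => d.1 = 1)).card ≤ 1 := by
    refine Finset.card_le_one.2 fun a ha b hb => Subtype.ext ?_
    rw [(Finset.mem_filter.1 ha).2, (Finset.mem_filter.1 hb).2]
  refine (Finset.sum_le_card_nsmul _ _ ((C * C) ^ k * X) fun d hd => ?_).trans ?_
  · have hd1 := (Finset.mem_filter.1 hd).2
    rw [LFunction_kroneckerChar_of_eq_one hd1, LFunction_kroneckerChar_of_eq_one hd1, norm_mul]
    have a1 := h X hX z₁ h₁.1 h₁.2.1 h₁.2.2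
    have a2 := h X hX z₂ h₂.1 h₂.2.1 h₂.2.2
    calc _ ≤ ((C * X ^ (1 / (2 * k))) * (C * X ^ (1 / (2 * k)))) ^ k := by gcongr
      _ = (C * C * X ^ (1 / k)) ^ k := by
          congr 1
          rw [mul_mul_mul_comm, ← Real.rpow_add hX0]
          congr 2
          field_simp
          norm_num
      _ = _ := by
          rw [Real.mul_rpow (by positivity) (by positivity), ← Real.rpow_mul hX0.le,
            one_div_mul_cancel hk.ne', Real.rpow_one]
  · rw [nsmul_eq_mul]
    refine mul_le_of_le_one_left (by positivity) ?_
    exact_mod_cast hcard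

theorem card_fundamentalDiscriminants_le {X : ℝ} (hX : 1 ≤ X) :
    ((fundamentalDiscriminants X).card : ℝ) ≤ 3 * X := by
  have h := sum_fundamentalDiscriminants_le (X := X) (by linarith) (f := fun _ => 1)
    fun _ => zero_le_one
  rw [Finset.sum_const, Finset.sum_const, nsmul_eq_mul, nsmul_eq_mul, mul_one, mul_one,
    Int.card_Icc] at h
  have e : ((⌊X⌋₊ : ℤ) + 1 - -(⌊X⌋₊ : ℤ)).toNat = 2 * ⌊X⌋₊ + 1 := by omega
  rw [e] at h
  push_cast at h
  linarith [Nat.floor_le (by linarith : 0 ≤ X)]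

/-- In a bounded range of `X` trivial bounds suffice. -/
theorem exists_sum_filter_ne_one_le_of_le {k : ℝ} (hk : 0 < k) (X₁ : ℝ) :
    ∃ C : ℝ, 0 < C ∧ ∀ X : ℝ, 10 ≤ X → X ≤ X₁ → ∀ z₁ z₂ : ℂ, IsAdmissibleShift X z₁ →
      IsAdmissibleShift X z₂ →
      ∑ d ∈ (fundamentalDiscriminants X).filter (fun d => d.1 ≠ 1),
        ‖(kroneckerChar d).LFunction (1 / 2 + z₁) * (kroneckerChar d).LFunction (1 / 2 + z₂)‖ ^ k ≤
        C * X := by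
  refine ⟨3 * (1 + (2 * X₁ * (1 + X₁)) ^ 2) ^ k, by positivity, fun X hX hX₁ z₁ z₂ h₁ h₂ => ?_⟩
  have one : ∀ d : FundamentalDiscriminant, d.1 ≠ 1 → |(d.1 : ℝ)| ≤ X → ∀ z, IsAdmissibleShift X z →
      ‖(kroneckerChar d).LFunction (1 / 2 + z)‖ ≤ 2 * X₁ * (1 + X₁) := by
    intro d hd hdX z hz
    have hre : (1 / 2 + z).re = 1 / 2 + z.re := by simp
    have a1 := DirichletCharacter.norm_LFunction_le (kroneckerChar_ne_one hd) (s := 1 / 2 + z)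
      (by rw [hre]; linarith [hz.1])
    have a2 : (d.1.natAbs : ℝ) ≤ X₁ := by
      rw [Nat.cast_natAbs, Int.cast_abs]; exact hdX.trans hX₁
    have hz2 : z.re ≤ 1 / 2 := hz.2.1.trans
      (one_div_le_one_div_of_le two_pos (two_lt_log hX).le)
    have a3 : ‖1 / 2 + z‖ ≤ 1 + X₁ := by
      refine (Complex.norm_le_abs_re_add_abs_im _).trans ?_
      rw [hre, abs_of_nonneg (by linarith [hz.1])]
      have : (1 / 2 + z).im = z.im := by simp
      rw [this]
      linarith [hz.2.2]
    have a4 : (0 : ℝ) ≤ d.1.natAbs := Nat.cast_nonneg _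
    refine a1.trans ?_
    rw [div_le_iff₀ (by rw [hre]; linarith [hz.1]), hre]
    have hX10 : 0 ≤ X₁ := by linarith
    calc _ ≤ X₁ * (1 + X₁) := by gcongr
      _ = 2 * X₁ * (1 + X₁) * (1 / 2) := by ring
      _ ≤ _ := by
          gcongr
          linarith [hz.1]
  refine (Finset.sum_le_card_nsmul _ _ ((1 + (2 * X₁ * (1 + X₁)) ^ 2) ^ k) fun d hd => ?_).trans ?_
  · obtain ⟨hdX, hd1⟩ := Finset.mem_filter.1 hd
    rw [mem_fundamentalDiscriminants] at hdX
    refine Real.rpow_le_rpow (norm_nonneg _) ?_ hk.le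
    rw [norm_mul]
    have := mul_le_mul (one d hd1 hdX z₁ h₁) (one d hd1 hdX z₂ h₂) (norm_nonneg _)
      ((norm_nonneg _).trans (one d hd1 hdX z₁ h₁))
    nlinarith
  · rw [nsmul_eq_mul]
    have a1 : (((fundamentalDiscriminants X).filter (fun d => d.1 ≠ 1)).card : ℝ) ≤ 3 * X :=
      le_trans (by exact_mod_cast Finset.card_filter_le _ _)
        (card_fundamentalDiscriminants_le (by linarith))
    calc _ ≤ 3 * X * (1 + (2 * X₁ * (1 + X₁)) ^ 2) ^ k := by gcongr
      _ = _ := by ring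

theorem theorem8p3 (hGRH : QuadraticGRH) :
    ∃ X₀ : ℝ, 10 ≤ X₀ ∧
      ∀ k : ℝ, 0 < k → ∀ ε : ℝ, 0 < ε →
        ∃ C : ℝ, 0 < C ∧
          ∀ X : ℝ, X₀ ≤ X →
            ∀ z₁ z₂ : ℂ,
              0 ≤ z₁.re → z₁.re ≤ 1 / Real.log X →
              0 ≤ z₂.re → z₂.re ≤ 1 / Real.log X →
              |z₁.im| ≤ X → |z₂.im| ≤ X →
                ∑ d ∈ fundamentalDiscriminants X,
                    ‖(kroneckerChar d).LFunction (1 / 2 + z₁)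
                      * (kroneckerChar d).LFunction (1 / 2 + z₂)‖ ^ k
                  ≤ C * (X * Real.log X ^ ε
                      * Real.exp (k * shiftM z₁ z₂ X + k ^ 2 / 2 * shiftV z₁ z₂ X)) := by
  refine ⟨10, le_rfl, fun k hk ε hε => ?_⟩
  -- The three losses `3 k η` and `k ^ 2 η / 2` in the exponent of `log X` add up to `ε`.
  set η := ε / (3 * k + k ^ 2 / 2) with hη
  have hη0 : 0 < η := by positivity
  have hηε : 3 * k * η + k ^ 2 / 2 * η = ε := by rw [hη]; field_simp
  obtain ⟨M, hM, hlarge⟩ := exists_sum_large_values_le hGRH hk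
  obtain ⟨C₁, hC₁, hmod⟩ := exists_sum_moderate_values_le hGRH hk hM hη0
  obtain ⟨X₁, hX₁⟩ := eventually_atTop.1 (hlarge.and hmod)
  obtain ⟨C₂, hC₂, hone⟩ := exists_sum_filter_eq_one_le hGRH hk
  obtain ⟨C₃, hC₃, hsmall⟩ := exists_sum_filter_ne_one_le_of_le hk X₁
  refine ⟨C₁ + C₂ + C₃ + 12, by positivity, fun X hX z₁ z₂ a1 a2 a3 a4 a5 a6 => ?_⟩
  have h₁ : IsAdmissibleShift X z₁ := ⟨a1, a2, a5⟩
  have h₂ : IsAdmissibleShift X z₂ := ⟨a3, a4, a6⟩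
  have hX0 : 0 < X := by linarith
  have hL := two_lt_log hX
  have hu := log_log_pos hX
  have hM0 := shiftM_nonneg hX (z₁ := z₁) (z₂ := z₂)
  have hV0 := shiftV_nonneg hX (z₁ := z₁) (z₂ := z₂)
  set m := shiftM z₁ z₂ X
  set v := shiftV z₁ z₂ X
  set G := X * Real.log X ^ ε * Real.exp (k * m + k ^ 2 / 2 * v) with hG
  have hGX : X ≤ G := by
    have b1 : 1 ≤ Real.log X ^ ε := Real.one_le_rpow (by linarith) hε.le
    have b2 : 1 ≤ Real.exp (k * m + k ^ 2 / 2 * v) := Real.one_le_exp (by positivity)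
    calc X = X * 1 * 1 := by ring
      _ ≤ G := by rw [hG]; gcongr
  have hGe : X * Real.exp (k * m + 3 * k * η * Real.log (Real.log X) +
      k ^ 2 / 2 * (v + η * Real.log (Real.log X))) = G := by
    rw [hG, Real.rpow_def_of_pos (by linarith), mul_assoc X, ← Real.exp_add, ← hηε]
    ring_nf
  rw [← Finset.sum_filter_add_sum_filter_not _ fun d : FundamentalDiscriminant => d.1 = 1]
  have c1 := hone X hX z₁ z₂ h₁ h₂
  rcases le_or_gt X X₁ with hXX | hXX
  · have c2 := hsmall X hX hXX z₁ z₂ h₁ h₂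
    simp only [ne_eq] at c2
    have c3 : (C₂ + C₃) * X ≤ (C₂ + C₃) * G := by gcongr
    have c4 : 0 ≤ (C₁ + 12) * G := mul_nonneg (by positivity) (hX0.le.trans hGX)
    linarith
  · obtain ⟨d1, d2⟩ := hX₁ X hXX.le
    have d1 := d1 z₁ z₂ h₁ h₂ _ rfl
    have d2 := d2 z₁ z₂ h₁ h₂ _ rfl
    rw [mul_assoc C₁, hGe] at d2
    rw [← Finset.sum_filter_add_sum_filter_not (Finset.filter (fun d => ¬ d.1 = 1) _)
      fun d : FundamentalDiscriminant => ‖(kroneckerChar d).LFunction (1 / 2 + z₁) *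
        (kroneckerChar d).LFunction (1 / 2 + z₂)‖ ≤ Real.exp (M * Real.log (Real.log X)),
      Finset.filter_filter, Finset.filter_filter]
    simp only [not_le]
    simp only [ne_eq] at d1 d2
    have c3 : (C₂ + 12) * X ≤ (C₂ + 12) * G := by gcongr
    have c4 : 0 ≤ C₃ * G := mul_nonneg hC₃.le (hX0.le.trans hGX)
    linarith
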